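/- Let $\Bbbk$ be a field, and let $\mathcal S:\ 1\to H\xrightarrow{j} G\xrightarrow{q} A\to 0$ be an affine extension: $A$ is an abelian variety over $\Bbbk$ (a geometrically reduced, connected, proper group scheme), $H,G$ are $\Bbbk$-group schemes (not necessarily of finite type), $1\to H(T)\to G(T)\to A(T)$ is exact for every $\Bbbk$-scheme $T$, and $q$ is affine and faithfully flat. For a vector bundle $\pi:E\to A$ of finite rank, let $\operatorname{Aut}_{\rm gr}(E)$ be the group functor whose $T$-points are the pairs $(\varphi,a)$, where $a\in A(T)$ and $\varphi$ is a $T$-automorphism of $E_T=E\times T$ over the translation $t_a:A_T\to A_T$ inducing an isomorphism of vector bundles $E_T\to t_a^*E_T$ over $A_T$; let $d(\varphi,a)=a$ and $\operatorname{Aut}_0(E)=\operatorname{Ker} d$. The bundle $E$ is *homogeneous* if $d:\operatorname{Aut}_{\rm gr}(E)\to A$ is surjective for the fpqc topology (equivalently, if the group scheme representing $\operatorname{Aut}_{\rm gr}(E)$ is faithfully flat over $A$). An *$\mathcal S$-module* is a homogeneous vector bundle $E\to A$ together with a homomorphism of group functors $\rho:G\to\operatorname{Aut}_{\rm gr}(E)$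 with $d\circ\rho=q$; thus $G$ acts on $E$, linearly on the fibres and over the translations of $A$, and $H$ acts on the fibre $E_0$ over $0\in A$. Let $\operatorname{Rep}_0(\mathcal S)$ be the category of $\mathcal S$-modules and $G$-equivariant morphisms of vector bundles over $\operatorname{id}_A$, and let $\operatorname{Rep}_{\rm fin}(H)$ be the category of finite-dimensional rational $H$-modules. 1. For every $V\in\operatorname{Rep}_{\rm fin}(H)$ the quotient $\kappa:G\times V\to G\times^HV=(G\times V)/H$, $(g,v)\mapsto[g,v]$, by the action $h\cdot(g,v)=(gh^{-1},hv)$ exists as a $\Bbbk$-scheme (representing the quotient fpqc sheaf). It is an $\mathcal S$-module, with projection $[g,v]\mapsto q(g)$ and action $g'\cdot[g,v]=[g'g,v]$, and for every $g\in G(T)$ the map $v\mapsto[g,v]$ is an $\mathcal O(T)$-linear isomorphism of $\mathcal O(T)\otimes V$ with the set of $T$-points of $G\times^HV$ over $q(g)$; in particular the fibres are isomorphic to $V$. 2. Conversely, for every $\mathcal S$-module $E$, with $H$ acting on $E_0$ by restriction, $[g,v]\mapsto g\cdot v$ is an isomorphism $G\times^HE_0\cong E$ in $\operatorname{Rep}_0(\mathcal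 S)$ (in particular, of homogeneous vector bundles over $A$). 3. The functors $V\mapsto G\times^HV$, $f\mapsto\bigl([g,v]\mapsto[g,f(v)]\bigr)$, and $E\mapsto E_0$ are mutually quasi-inverse equivalences of categories between $\operatorname{Rep}_{\rm fin}(H)$ and $\operatorname{Rep}_0(\mathcal S)$. 4. In particular, $\operatorname{Rep}_0(\mathcal S)$ is an abelian category, and it is monoidal and rigid for the tensor product of vector bundles with the diagonal action of $G$, with unit the trivial line bundle $\mathbb A^1\times A$ with the trivial action $g\cdot(c,b)=(c,q(g)+b)$. -/

import Mathlib

open CategoryTheory AlgebraicGeometry MonoidalCategory CartesianMonoidalCategory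
open scoped MonObj TensorProduct

universe u

namespace AffExt

noncomputable section

/-- Schemes over the field `k`. Products are the cartesian monoidal structure `⊗`,
and `T ⟶ X` is the set `X(T)` of `T`-points. For a group scheme `G` the group `T ⟶ G` is written
multiplicatively, also when `G` is an abelian variety (so its neutral element `0` is `1`). -/
abbrev Sch (k : Type u) [Field k] := Over (Spec (CommRingCat.of k))

variable {k : Type u} [Field k]

/-! ### Functions -/

/-- The ring `𝒪(T)` of global functions of a `k`-scheme `T`. -/
def Fn (T : Sch k) : Type u := Γ(T.left, ⊤)

instance (T : Sch k) : CommRing (Fn T) := inferInstanceAs (CommRing Γ(T.left, ⊤))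

instance (T : Sch k) : Algebra k (Fn T) :=
  (((Scheme.ΓSpecIso (CommRingCat.of k)).inv ≫ T.hom.appTop).hom : k →+* Γ(T.left, ⊤)).toAlgebra

/-- Pullback of functions along a morphism of `k`-schemes. -/
def Fn.pull {T' T : Sch k} (f : T' ⟶ T) : Fn T →ₐ[k] Fn T' :=
  { (f.left.appTop.hom : Γ(T.left, ⊤) →+* Γ(T'.left, ⊤)) with
    commutes' := fun c => by
      have h : T.hom.appTop ≫ f.left.appTop = T'.hom.appTop := by
        rw [← Scheme.Hom.comp_appTop, Over.w f]
      exact congrArg (fun φ => φ.hom ((Scheme.ΓSpecIso (CommRingCat.of k)).inv.hom c)) h }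

/-- `f` is a faithfully flat quasi-compact morphism. -/
def IsFpqc {T' T : Sch k} (f : T' ⟶ T) : Prop :=
  Flat f.left ∧ Surjective f.left ∧ QuasiCompact f.left

/-! ### Finite dimensional representations of a group scheme -/

/-- Base change of the `T`-points `𝒪(T) ⊗ V` of the `k`-vector space `V`. -/
def ptPull (V : Type u) [AddCommGroup V] [Module k V] {T' T : Sch k} (f : T' ⟶ T) :
    Fn T ⊗[k] V →ₗ[k] Fn T' ⊗[k] V :=
  LinearMap.rTensor V (Fn.pull f).toLinearMap

/-- A finite dimensional (rational) `H`-module: a finite dimensional `k`-vector space `V` with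
an action of the group functor `H` on the functor `T ↦ 𝒪(T) ⊗ V` by `𝒪(T)`-linear maps,
natural in the `k`-scheme `T`. -/
structure FinRep (H : Sch k) [GrpObj H] where
  V : Type u
  [addCommGroup : AddCommGroup V]
  [module : Module k V]
  [finite : Module.Finite k V]
  ρ : ∀ T : Sch k, (T ⟶ H) →* Module.End (Fn T) (Fn T ⊗[k] V)
  ρ_natural : ∀ {T' T : Sch k} (f : T' ⟶ T) (h : T ⟶ H) (v : Fn T ⊗[k] V),
    ρ T' (f ≫ h) (ptPull V f v) = ptPull V f (ρ T h v)

attribute [instance] FinRep.addCommGroup FinRep.module FinRep.finite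

/-- Morphisms of `H`-modules: `k`-linear maps commuting with the action. -/
@[ext]
structure FinRep.Hom {H : Sch k} [GrpObj H] (M N : FinRep H) where
  toLin : M.V →ₗ[k] N.V
  equivariant : ∀ {T : Sch k} (h : T ⟶ H) (v : Fn T ⊗[k] M.V),
    LinearMap.baseChange (Fn T) toLin (M.ρ T h v) = N.ρ T h (LinearMap.baseChange (Fn T) toLin v)

/-- The category of finite dimensional `H`-modules. -/
instance (H : Sch k) [GrpObj H] : Category (FinRep H) where
  Hom := FinRep.Hom
  id M := ⟨LinearMap.id, by simp⟩
  comp f g := ⟨g.toLin ∘ₗ f.toLin, fun h v => by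
    simp only [LinearMap.baseChange_comp, LinearMap.comp_apply, f.equivariant, g.equivariant]⟩

/-! ### Vector bundles -/

/-- For `π : X ⟶ A` and `b ∈ A(T)`, the set `X(T)_b` of `T`-points of `X` lying over `b`. -/
def Fib {X A : Sch k} (π : X ⟶ A) {T : Sch k} (b : T ⟶ A) : Type u :=
  {e : T ⟶ X // e ≫ π = b}

/-- Pullback of points of `X` over `A` along `f : T' ⟶ T`. -/
def Fib.pull {X A : Sch k} {π : X ⟶ A} {T' T : Sch k} (f : T' ⟶ T) {b : T ⟶ A}
    (e : Fib π b) : Fib π (f ≫ b) :=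
  ⟨f ≫ e.1, by rw [Category.assoc, e.2]⟩

/-- The open subscheme `U` of `A` as a `k`-scheme. -/
def openSub {A : Sch k} (U : A.left.Opens) : Sch k := Over.mk (U.ι ≫ A.hom)

/-- The inclusion of an open subscheme. -/
def openIncl {A : Sch k} (U : A.left.Opens) : openSub U ⟶ A := Over.homMk U.ι rfl

/-- A vector bundle structure (of finite rank) on `π : X ⟶ A`: the structure of a module scheme
over the ring scheme `𝔸¹` on the `A`-scheme `X`, given on points (an `𝒪(T)`-module
structure on `X(T)_b` for all `b ∈ A(T)`, compatible with pullback), which is isomorphic to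
`U × 𝔸ⁿ` locally for the Zariski topology of `A`, the isomorphism
`(c₁, …, cₙ) ↦ ∑ cᵢ eᵢ` being given by a frame `e₁, …, eₙ` of sections over `U`. -/
class VectorBundle {X A : Sch k} (π : X ⟶ A) where
  [addCommGroup : ∀ {T : Sch k} (b : T ⟶ A), AddCommGroup (Fib π b)]
  [module : ∀ {T : Sch k} (b : T ⟶ A), Module (Fn T) (Fib π b)]
  pull_add : ∀ {T' T : Sch k} (f : T' ⟶ T) {b : T ⟶ A} (e e' : Fib π b),
    (e + e').pull f = e.pull f + e'.pull f
  pull_smul : ∀ {T' T : Sch k} (f : T' ⟶ T) {b : T ⟶ A} (c : Fn T) (e : Fib π b),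
    (c • e).pull f = Fn.pull f c • e.pull f
  locally_trivial : ∀ x : A.left, ∃ U : A.left.Opens, x ∈ U ∧
    ∃ (n : ℕ) (frame : Fin n → Fib π (openIncl U)), ∀ {T : Sch k} (t : T ⟶ openSub U),
      Function.Bijective fun c : Fin n → Fn T => ∑ i, c i • (frame i).pull t

attribute [reducible, instance] VectorBundle.addCommGroup VectorBundle.module

section

variable {X X' A : Sch k}

lemma Fib.coe_add_congr {π : X ⟶ A} [VectorBundle π] {T : Sch k} {b b' : T ⟶ A} (h : b = b')
    {x y : Fib π b} {x' y' : Fib π b'} (hx : x.1 = x'.1) (hy : y.1 = y'.1) :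
    (x + y).1 = (x' + y').1 := by
  subst h
  rw [Subtype.ext hx, Subtype.ext hy]

lemma Fib.coe_zero_congr {π : X ⟶ A} [VectorBundle π] {T : Sch k} {b b' : T ⟶ A} (h : b = b') :
    (0 : Fib π b).1 = (0 : Fib π b').1 := by
  subst h
  rfl

lemma Fib.coe_smul_congr {π : X ⟶ A} [VectorBundle π] {T : Sch k} {b b' : T ⟶ A} (h : b = b')
    (c : Fn T) {x : Fib π b} {x' : Fib π b'} (hx : x.1 = x'.1) :
    (c • x).1 = (c • x').1 := by
  subst h
  rw [Subtype.ext hx]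

/-- The map on points over `b` induced by a morphism of `A`-schemes. -/
def Fib.map {π : X ⟶ A} {π' : X' ⟶ A} (f : X ⟶ X') (w : f ≫ π' = π) {T : Sch k} {b : T ⟶ A}
    (e : Fib π b) : Fib π' b :=
  ⟨e.1 ≫ f, by rw [Category.assoc, w, e.2]⟩

/-- A morphism of vector bundles over `A`: a morphism of `A`-schemes that is linear on the
fibres. -/
structure IsBundleHom (π : X ⟶ A) (π' : X' ⟶ A) [VectorBundle π] [VectorBundle π']
    (f : X ⟶ X') : Prop where
  w : f ≫ π' = π
  map_add : ∀ {T : Sch k} {b : T ⟶ A} (e e' : Fib π b),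
    (e + e').map f w = e.map f w + e'.map f w
  map_smul : ∀ {T : Sch k} {b : T ⟶ A} (c : Fn T) (e : Fib π b),
    (c • e).map f w = c • e.map f w

lemma IsBundleHom.id (π : X ⟶ A) [VectorBundle π] : IsBundleHom π π (𝟙 X) where
  w := Category.id_comp _
  map_add e e' := by
    apply Subtype.ext
    simp only [Fib.map, Category.comp_id]
    rfl
  map_smul c e := by
    apply Subtype.ext
    simp only [Fib.map, Category.comp_id]
    rfl

lemma IsBundleHom.comp {X'' : Sch k} {π : X ⟶ A} {π' : X' ⟶ A} {π'' : X'' ⟶ A}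
    [VectorBundle π] [VectorBundle π'] [VectorBundle π''] {f : X ⟶ X'} {g : X' ⟶ X''}
    (hf : IsBundleHom π π' f) (hg : IsBundleHom π' π'' g) : IsBundleHom π π'' (f ≫ g) where
  w := by rw [Category.assoc, hg.w, hf.w]
  map_add e e' := by
    have h1 := congrArg (Fib.map g hg.w) (hf.map_add e e')
    rw [hg.map_add] at h1
    have h2 := congrArg Subtype.val h1
    apply Subtype.ext
    simp only [Fib.map, Category.assoc] at h2 ⊢
    exact h2
  map_smul c e := by
    have h1 := congrArg (Fib.map g hg.w) (hf.map_smul c e)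
    rw [hg.map_smul] at h1
    have h2 := congrArg Subtype.val h1
    apply Subtype.ext
    simp only [Fib.map, Category.assoc] at h2 ⊢
    exact h2

end

/-! ### Graded endomorphisms and homogeneous vector bundles -/

section

variable {X A : Sch k} [GrpObj A]

/-- A pair `(φ, a)` with `a ∈ A(T)` and `φ : X × T ⟶ X` such that `(φ, id) : X_T ⟶ X_T` lies
over the translation `t_a : A_T ⟶ A_T`. -/
structure GradedMap (π : X ⟶ A) (T : Sch k) where
  deg : T ⟶ A
  hom : X ⊗ T ⟶ X
  w : hom ≫ π = (snd X T ≫ deg) * (fst X T ≫ π)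

/-- The map `X(T')_b → X(T')_{a + b}` induced by `φ`, for `t : T' ⟶ T`. -/
def GradedMap.onFib {π : X ⟶ A} {T : Sch k} (φ : GradedMap π T) {T' : Sch k} (t : T' ⟶ T)
    {b : T' ⟶ A} (e : Fib π b) : Fib π ((t ≫ φ.deg) * b) :=
  ⟨lift e.1 t ≫ φ.hom, by
    rw [Category.assoc, φ.w, MonObj.comp_mul, lift_snd_assoc, lift_fst_assoc, e.2]⟩

/-- The `T`-points of `End_gr(X)`: pairs `(φ, a)` as above such that the induced morphism
`X_T ⟶ t_a^* X_T` is a morphism of vector bundles over `A_T`. -/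
structure GradedEnd (π : X ⟶ A) [VectorBundle π] (T : Sch k) extends GradedMap π T where
  map_add : ∀ {T' : Sch k} (t : T' ⟶ T) {b : T' ⟶ A} (e e' : Fib π b),
    toGradedMap.onFib t (e + e') = toGradedMap.onFib t e + toGradedMap.onFib t e'
  map_smul : ∀ {T' : Sch k} (t : T' ⟶ T) {b : T' ⟶ A} (c : Fn T') (e : Fib π b),
    toGradedMap.onFib t (c • e) = c • toGradedMap.onFib t e

variable {π : X ⟶ A} [VectorBundle π] {T : Sch k}

lemma GradedEnd.ext {φ ψ : GradedEnd π T} (hd : φ.deg = ψ.deg) (hh : φ.hom = ψ.hom) : φ = ψ := by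
  obtain ⟨⟨_, _, _⟩, _, _⟩ := φ
  obtain ⟨⟨_, _, _⟩, _, _⟩ := ψ
  dsimp at hd hh
  subst hd hh
  rfl

/-- The identity, of degree `0`. -/
def GradedEnd.one : GradedEnd π T where
  deg := 1
  hom := fst X T
  w := by rw [MonObj.comp_one, one_mul]
  map_add t b e e' := by
    apply Subtype.ext
    refine Eq.trans ?_ (Fib.coe_add_congr (b := b) (x := e) (y := e') ?_ ?_ ?_) <;>
      simp [GradedMap.onFib]
  map_smul t b c e := by
    apply Subtype.ext
    refine Eq.trans ?_ (Fib.coe_smul_congr (b := b) (x := e) ?_ c ?_) <;>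
      simp [GradedMap.onFib]

/-- The composition `φ ∘ ψ`, whose degree is the sum of the degrees. -/
def GradedEnd.mul (φ ψ : GradedEnd π T) : GradedEnd π T where
  deg := φ.deg * ψ.deg
  hom := lift ψ.hom (snd X T) ≫ φ.hom
  w := by
    rw [Category.assoc, φ.w, MonObj.comp_mul, lift_snd_assoc, lift_fst_assoc, ψ.w,
      MonObj.comp_mul, mul_assoc]
  map_add t b e e' := by
    apply Subtype.ext
    have h := congrArg Subtype.val (congrArg (φ.onFib t) (ψ.map_add t e e'))
    rw [φ.map_add] at h
    refine Eq.trans ?_ (h.trans (Fib.coe_add_congr ?_ ?_ ?_)) <;>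
      simp [GradedMap.onFib, comp_lift_assoc, MonObj.comp_mul, mul_assoc]
  map_smul t b c e := by
    apply Subtype.ext
    have h := congrArg Subtype.val (congrArg (φ.onFib t) (ψ.map_smul t c e))
    rw [φ.map_smul] at h
    refine Eq.trans ?_ (h.trans (Fib.coe_smul_congr ?_ c ?_)) <;>
      simp [GradedMap.onFib, comp_lift_assoc, MonObj.comp_mul, mul_assoc]

instance : Monoid (GradedEnd π T) where
  one := GradedEnd.one
  mul := GradedEnd.mul
  mul_assoc φ ψ χ := GradedEnd.ext (mul_assoc φ.deg ψ.deg χ.deg) (by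
    change lift χ.hom _ ≫ lift ψ.hom _ ≫ φ.hom = lift (lift χ.hom _ ≫ ψ.hom) _ ≫ φ.hom
    simp [comp_lift_assoc])
  one_mul φ := GradedEnd.ext (one_mul φ.deg) (by
    change lift φ.hom (snd X T) ≫ fst X T = φ.hom
    simp)
  mul_one φ := GradedEnd.ext (mul_one φ.deg) (by
    change lift (fst X T) (snd X T) ≫ φ.hom = φ.hom
    simp)

variable (π T) in
/-- The group `Aut_gr(X)(T)` of graded automorphisms of the vector bundle `X` over `T`. -/
abbrev GradedAut := (GradedEnd π T)ˣ

/-- The vector bundle is homogeneous: the homomorphism of fpqc sheaves of groups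
`d : Aut_gr(X) ⟶ A`, `(φ, a) ↦ a`, is surjective, that is, every point `a ∈ A(T)` lifts to
`Aut_gr(X)(T')` for some faithfully flat quasi-compact `T' ⟶ T`. -/
def IsHomogeneous (π : X ⟶ A) [VectorBundle π] : Prop :=
  ∀ {T : Sch k} (a : T ⟶ A), ∃ (T' : Sch k) (f : T' ⟶ T), IsFpqc f ∧
    ∃ φ : GradedAut π T', φ.1.deg = f ≫ a

end

/-! ### Affine extensions and their modules -/

/-- An abelian variety: a smooth (geometrically reduced), connected, proper group scheme over
`k`. -/
class IsAbelianVariety (A : Sch k) [GrpObj A] : Prop where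
  isProper : IsProper A.hom
  geometricallyReduced : GeometricallyReduced A.hom
  connected : ConnectedSpace A.left

variable (k) in
/-- An affine extension `1 ⟶ H ⟶ G ⟶ A ⟶ 0` of an abelian variety `A`: a sequence of group
schemes, left exact on `T`-points for all `T`, in which `q` is affine and faithfully flat. -/
structure AffineExtension where
  H : Sch k
  G : Sch k
  A : Sch k
  [grpH : GrpObj H]
  [grpG : GrpObj G]
  [grpA : GrpObj A]
  [abelianVariety : IsAbelianVariety A]
  j : H ⟶ G
  q : G ⟶ A
  [isMonHom_j : IsMonHom j]
  [isMonHom_q : IsMonHom q]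
  injective : ∀ {T : Sch k} (h h' : T ⟶ H), h ≫ j = h' ≫ j → h = h'
  exact : ∀ {T : Sch k} (g : T ⟶ G), g ≫ q = 1 ↔ ∃ h : T ⟶ H, h ≫ j = g
  affine : IsAffineHom q.left
  flat : Flat q.left
  surjective : Surjective q.left

attribute [instance] AffineExtension.grpH AffineExtension.grpG AffineExtension.grpA
  AffineExtension.abelianVariety AffineExtension.isMonHom_j AffineExtension.isMonHom_q

variable (S : AffineExtension k)

/-- A morphism of extensions from `S` to `1 ⟶ Aut_0(X) ⟶ Aut_gr(X) ⟶ A ⟶ 0`: a homomorphism of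
group functors `ρ : G ⟶ Aut_gr(X)` over `A`. (The homomorphism `H ⟶ Aut_0(X)` is induced.) -/
structure ExtHom {X : Sch k} (π : X ⟶ S.A) [VectorBundle π] where
  ρ : ∀ T : Sch k, (T ⟶ S.G) →* GradedAut π T
  ρ_natural : ∀ {T' T : Sch k} (f : T' ⟶ T) (g : T ⟶ S.G),
    (ρ T' (f ≫ g)).1.hom = (X ◁ f) ≫ (ρ T g).1.hom
  ρ_deg : ∀ {T : Sch k} (g : T ⟶ S.G), (ρ T g).1.deg = g ≫ S.q

/-- A representation of `S`, or `S`-module: a homogeneous vector bundle `π : X ⟶ A` with a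
morphism of extensions from `S` to the extension given by `Aut_gr(X)`. -/
structure SModule where
  X : Sch k
  π : X ⟶ S.A
  [bundle : VectorBundle π]
  homogeneous : IsHomogeneous π
  rep : ExtHom S π

attribute [instance] SModule.bundle

variable {S}

/-- The action `(g, e) ↦ g · e` of `G` on `X`, on `T`-points. -/
def SModule.act (E : SModule S) {T : Sch k} (g : T ⟶ S.G) (e : T ⟶ E.X) : T ⟶ E.X :=
  lift e (𝟙 T) ≫ (E.rep.ρ T g).1.hom

lemma SModule.act_one (E : SModule S) {T : Sch k} (e : T ⟶ E.X) :
    E.act (1 : T ⟶ S.G) e = e := by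
  rw [SModule.act, map_one]
  exact lift_fst _ _

lemma SModule.act_mul (E : SModule S) {T : Sch k} (g g' : T ⟶ S.G) (e : T ⟶ E.X) :
    E.act (g * g') e = E.act g (E.act g' e) := by
  rw [SModule.act, map_mul]
  change lift e (𝟙 T) ≫ lift (E.rep.ρ T g').1.hom (snd E.X T) ≫ (E.rep.ρ T g).1.hom = _
  simp [SModule.act, comp_lift_assoc]

lemma SModule.comp_act (E : SModule S) {T' T : Sch k} (f : T' ⟶ T) (g : T ⟶ S.G) (e : T ⟶ E.X) :
    f ≫ E.act g e = E.act (f ≫ g) (f ≫ e) := by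
  simp [SModule.act, E.rep.ρ_natural, comp_lift_assoc]

/-- A morphism of `S`-modules of degree `0`: a `G`-equivariant morphism of vector bundles
over `A`. -/
@[ext]
structure SModule.Hom (E F : SModule S) where
  hom : E.X ⟶ F.X
  isBundleHom : IsBundleHom E.π F.π hom
  equivariant : ∀ {T : Sch k} (g : T ⟶ S.G) (e : T ⟶ E.X),
    E.act g e ≫ hom = F.act g (e ≫ hom)

variable (S) in
/-- The category `Rep_0(S)` of `S`-modules and morphisms of degree `0`. -/
abbrev Rep0 := SModule S

instance : Category (Rep0 S) where
  Hom := SModule.Hom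
  id E := ⟨𝟙 _, IsBundleHom.id _, by simp⟩
  comp f g := ⟨f.hom ≫ g.hom, f.isBundleHom.comp g.isBundleHom, fun a e => by
    rw [← Category.assoc, f.equivariant, g.equivariant, Category.assoc]⟩

/-! ### The fibre at the origin -/

instance {X A : Sch k} (π : X ⟶ A) [VectorBundle π] {T : Sch k} (b : T ⟶ A) :
    Module k (Fib π b) := Module.compHom _ (algebraMap k (Fn T))

instance {X A : Sch k} (π : X ⟶ A) [VectorBundle π] {T : Sch k} (b : T ⟶ A) :
    IsScalarTower k (Fn T) (Fib π b) where
  smul_assoc c d e := by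
    rw [Algebra.smul_def, mul_smul]
    rfl

lemma algebraMap_unit_bijective : Function.Bijective (algebraMap k (Fn (𝟙_ (Sch k)))) := by
  change Function.Bijective ((Scheme.ΓSpecIso (CommRingCat.of k)).inv ≫
    (𝟙 (Spec (CommRingCat.of k)) : Spec (CommRingCat.of k) ⟶ _).appTop).hom
  rw [Scheme.Hom.id_appTop, Category.comp_id]
  exact ConcreteCategory.bijective_of_isIso (Scheme.ΓSpecIso (CommRingCat.of k)).inv

lemma bijective_of_eq {X A : Sch k} {π : X ⟶ A} [VectorBundle π] {T : Sch k} {b b' : T ⟶ A}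
    (h : b = b') {n : ℕ} {v : Fin n → Fib π b} {v' : Fin n → Fib π b'}
    (hv : ∀ i, (v i).1 = (v' i).1)
    (hb : Function.Bijective fun c : Fin n → Fn T => ∑ i, c i • v i) :
    Function.Bijective fun c : Fin n → Fn T => ∑ i, c i • v' i := by
  subst h
  obtain rfl : v = v' := funext fun i => Subtype.ext (hv i)
  exact hb

section

variable {X A : Sch k} [GrpObj A] (π : X ⟶ A)

/-- The fibre `X_0` over the neutral element `0 ∈ A(k)`, a `k`-vector space. -/
abbrev Fibre : Type u := Fib π (1 : 𝟙_ (Sch k) ⟶ A)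

variable {π} in
/-- The point of `X(T)` over `0 ∈ A(T)` defined by a point of `X_0`. -/
def Fibre.pt (T : Sch k) (e : Fibre π) : Fib π (1 : T ⟶ A) :=
  ⟨toUnit T ≫ e.1, by rw [Category.assoc, e.2, MonObj.comp_one]⟩

lemma exists_frame [VectorBundle π] : ∃ (n : ℕ) (v : Fin n → Fibre π), ∀ T : Sch k,
    Function.Bijective fun c : Fin n → Fn T => ∑ i, c i • (v i).pt T := by
  let o : 𝟙_ (Sch k) ⟶ A := 1
  obtain ⟨U, hU, n, fr, hfr⟩ := VectorBundle.locally_trivial (π := π)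
    (o.left (IsLocalRing.closedPoint k))
  have hr : Set.range o.left ⊆ Set.range U.ι := by
    rintro _ ⟨y, rfl⟩
    rw [Scheme.Opens.range_ι]
    have : y = IsLocalRing.closedPoint k := Subsingleton.elim (α := PrimeSpectrum k) _ _
    rw [this]
    exact hU
  let l := IsOpenImmersion.lift U.ι o.left hr
  have hl : l ≫ U.ι = o.left := IsOpenImmersion.lift_fac _ _ _
  let s : 𝟙_ (Sch k) ⟶ openSub U := Over.homMk l (by
    change l ≫ U.ι ≫ A.hom = _
    rw [reassoc_of% hl]
    exact Over.w o)
  have hs : s ≫ openIncl U = o := by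
    ext : 1
    exact hl
  have hs' : ∀ T : Sch k, (toUnit T ≫ s) ≫ openIncl U = 1 := fun T => by
    rw [Category.assoc, hs, MonObj.comp_one]
  refine ⟨n, fun i => ⟨s ≫ (fr i).1, by rw [Category.assoc, (fr i).2, hs]⟩, fun T => ?_⟩
  refine bijective_of_eq (hs' T) (fun i => ?_) (hfr (toUnit T ≫ s))
  simp [Fib.pull, Fibre.pt]

variable {π} in
lemma Fibre.pt_unit (e : Fibre π) : e.pt (𝟙_ (Sch k)) = e :=
  Subtype.ext (by simp [Fibre.pt, toUnit_unique (toUnit (𝟙_ (Sch k))) (𝟙 _)])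

variable [VectorBundle π]

lemma Fibre.pt_add (T : Sch k) (e e' : Fibre π) : (e + e').pt T = e.pt T + e'.pt T := by
  have h := congrArg Subtype.val (VectorBundle.pull_add (toUnit T) e e')
  exact Subtype.ext (h.trans (Fib.coe_add_congr (MonObj.comp_one _) rfl rfl))

lemma Fibre.pt_smul (T : Sch k) (c : k) (e : Fibre π) : (c • e).pt T = c • e.pt T := by
  have h := congrArg Subtype.val
    (VectorBundle.pull_smul (toUnit T) (algebraMap k (Fn (𝟙_ (Sch k))) c) e)
  rw [AlgHom.commutes] at h
  exact Subtype.ext (h.trans (Fib.coe_smul_congr (MonObj.comp_one _) _ rfl))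

/-- The canonical map `𝒪(T) ⊗ X_0 → X(T)_0`. -/
def fibreMap (T : Sch k) : Fn T ⊗[k] Fibre π →ₗ[Fn T] Fib π (1 : T ⟶ A) :=
  LinearMap.liftBaseChange (Fn T)
    { toFun := fun e => e.pt T
      map_add' := Fibre.pt_add π T
      map_smul' := Fibre.pt_smul π T }

lemma fibreMap_tmul (T : Sch k) (c : Fn T) (e : Fibre π) :
    fibreMap π T (c ⊗ₜ e) = c • e.pt T := by
  simp [fibreMap]

lemma exists_basis : ∃ (n : ℕ) (v : Module.Basis (Fin n) k (Fibre π)), ∀ T : Sch k,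
    ∃ w : Module.Basis (Fin n) (Fn T) (Fib π (1 : T ⟶ A)), ∀ i, w i = (v i).pt T := by
  obtain ⟨n, v, hv⟩ := exists_frame π
  have key : ∀ (R M : Type u) [CommRing R] [AddCommGroup M] [Module R M] (x : Fin n → M),
      (Function.Bijective fun c : Fin n → R => ∑ i, c i • x i) →
      ∃ w : Module.Basis (Fin n) R M, ∀ i, w i = x i := by
    intro R M _ _ _ x hx
    refine ⟨Module.Basis.ofEquivFun
      (LinearEquiv.ofBijective (Fintype.linearCombination R x) hx).symm, fun i => ?_⟩
    rw [Module.Basis.coe_ofEquivFun]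
    change Fintype.linearCombination R x (Pi.single i 1) = x i
    simp
  have h0 : Function.Bijective fun c : Fin n → k => ∑ i, c i • v i := by
    have h1 := (hv (𝟙_ (Sch k))).comp
      (Function.Bijective.piMap fun _ : Fin n => algebraMap_unit_bijective (k := k))
    convert h1 using 2 with c
    refine Finset.sum_congr rfl fun i _ => ?_
    rw [Fibre.pt_unit]
    rfl
  obtain ⟨w, hw⟩ := key _ _ _ h0
  refine ⟨n, w, fun T => ?_⟩
  obtain ⟨wT, hwT⟩ := key _ _ _ (hv T)
  exact ⟨wT, fun i => by rw [hwT, hw]⟩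

instance : Module.Finite k (Fibre π) := by
  obtain ⟨n, v, -⟩ := exists_basis π
  exact Module.Finite.of_basis v

lemma fibreMap_bijective (T : Sch k) : Function.Bijective (fibreMap π T) := by
  obtain ⟨n, v, h⟩ := exists_basis π
  obtain ⟨w, hw⟩ := h T
  have : fibreMap π T = ((v.baseChange (Fn T)).equiv w (Equiv.refl _)).toLinearMap := by
    refine (v.baseChange (Fn T)).ext fun i => ?_
    rw [LinearEquiv.coe_coe, Module.Basis.equiv_apply, Module.Basis.baseChange_apply,
      fibreMap_tmul, one_smul, hw, Equiv.refl_apply]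
  rw [this]
  exact LinearEquiv.bijective _

/-- The canonical isomorphism `𝒪(T) ⊗ X_0 ≃ X(T)_0`. -/
def fibreEquiv (T : Sch k) : Fn T ⊗[k] Fibre π ≃ₗ[Fn T] Fib π (1 : T ⟶ A) :=
  LinearEquiv.ofBijective (fibreMap π T) (fibreMap_bijective π T)

lemma fibreEquiv_tmul (T : Sch k) (c : Fn T) (e : Fibre π) :
    fibreEquiv π T (c ⊗ₜ e) = c • e.pt T := fibreMap_tmul π T c e

lemma fibreEquiv_pull {T' T : Sch k} (f : T' ⟶ T) (v : Fn T ⊗[k] Fibre π) :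
    (fibreEquiv π T' (ptPull _ f v)).1 = f ≫ (fibreEquiv π T v).1 := by
  induction v using TensorProduct.induction_on with
  | zero =>
    have h := congrArg Subtype.val
      (VectorBundle.pull_smul (π := π) f (b := 1) (0 : Fn T) 0)
    rw [map_zero, map_zero, map_zero]
    rw [map_zero, zero_smul, zero_smul] at h
    refine Eq.trans ?_ h.symm
    exact Fib.coe_zero_congr (MonObj.comp_one f).symm
  | tmul c e =>
    have h := congrArg Subtype.val (VectorBundle.pull_smul f c (e.pt T))
    rw [ptPull, LinearMap.rTensor_tmul, fibreEquiv_tmul, fibreEquiv_tmul]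
    refine Eq.trans ?_ h.symm
    refine Fib.coe_smul_congr (MonObj.comp_one _).symm _ ?_
    simp [Fibre.pt, Fib.pull]
  | add v w hv hw =>
    have h := congrArg Subtype.val (VectorBundle.pull_add f (fibreEquiv π T v) (fibreEquiv π T w))
    rw [map_add, map_add, map_add]
    exact (Fib.coe_add_congr (MonObj.comp_one _).symm hv hw).trans h.symm

end

namespace SModule

/-- An element `g ∈ G(T)` with `q(g) = 0` acts linearly on `X(T)_0`. -/
def actFibre (E : SModule S) {T : Sch k} (g : T ⟶ S.G) (hg : g ≫ S.q = 1) :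
    Fib E.π (1 : T ⟶ S.A) →ₗ[Fn T] Fib E.π (1 : T ⟶ S.A) :=
  have hd : (𝟙 T ≫ (E.rep.ρ T g).1.deg) * (1 : T ⟶ S.A) = 1 := by
    rw [E.rep.ρ_deg, hg, MonObj.comp_one, mul_one]
  { toFun := fun e => ⟨E.act g e.1, ((E.rep.ρ T g).1.onFib (𝟙 T) e).2.trans hd⟩
    map_add' := fun e e' => by
      have h := congrArg Subtype.val ((E.rep.ρ T g).1.map_add (𝟙 T) e e')
      exact Subtype.ext (h.trans (Fib.coe_add_congr hd rfl rfl))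
    map_smul' := fun c e => by
      have h := congrArg Subtype.val ((E.rep.ρ T g).1.map_smul (𝟙 T) c e)
      exact Subtype.ext (h.trans (Fib.coe_smul_congr hd c rfl)) }

lemma _root_.AffExt.AffineExtension.j_q {T : Sch k} (h : T ⟶ S.H) : (h ≫ S.j) ≫ S.q = 1 :=
  (S.exact _).2 ⟨h, rfl⟩

/-- The action of `h ∈ H(T)` on `𝒪(T) ⊗ E_0 ≃ X(T)_0`. -/
def fibreAct (E : SModule S) {T : Sch k} (h : T ⟶ S.H) : Module.End (Fn T) (Fn T ⊗[k] Fibre E.π) :=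
  (fibreEquiv E.π T).symm.toLinearMap ∘ₗ E.actFibre (h ≫ S.j) (AffineExtension.j_q h) ∘ₗ
    (fibreEquiv E.π T).toLinearMap

lemma fibreEquiv_fibreAct (E : SModule S) {T : Sch k} (h : T ⟶ S.H)
    (v : Fn T ⊗[k] Fibre E.π) :
    (fibreEquiv E.π T (E.fibreAct h v)).1 = E.act (h ≫ S.j) (fibreEquiv E.π T v).1 :=
  congrArg Subtype.val ((fibreEquiv E.π T).apply_symm_apply _)

/-- The fibre `E_0`, as an `H`-module for the restriction of the action of `G`. -/
def fibre (E : SModule S) : FinRep S.H where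
  V := Fibre E.π
  ρ T :=
    { toFun := fun h => E.fibreAct h
      map_one' := LinearMap.ext fun v => (fibreEquiv E.π T).injective (Subtype.ext (by
        rw [fibreEquiv_fibreAct, MonObj.one_comp, act_one]
        rfl))
      map_mul' := fun h h' => LinearMap.ext fun v =>
        (fibreEquiv E.π T).injective (Subtype.ext (by
          rw [Module.End.mul_apply, fibreEquiv_fibreAct, fibreEquiv_fibreAct,
            fibreEquiv_fibreAct, MonObj.mul_comp, act_mul])) }
  ρ_natural f h v := (fibreEquiv E.π _).injective (Subtype.ext (by
    change (fibreEquiv E.π _ (E.fibreAct (f ≫ h) (ptPull _ f v))).1 =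
      (fibreEquiv E.π _ (ptPull _ f (E.fibreAct h v))).1
    rw [fibreEquiv_pull, fibreEquiv_fibreAct, fibreEquiv_fibreAct, fibreEquiv_pull, comp_act,
      Category.assoc]))

lemma fibreEquiv_ρ (E : SModule S) {T : Sch k} (h : T ⟶ S.H) (v : Fn T ⊗[k] Fibre E.π) :
    (fibreEquiv E.π T (E.fibre.ρ T h v)).1 = E.act (h ≫ S.j) (fibreEquiv E.π T v).1 :=
  congrArg Subtype.val ((fibreEquiv E.π T).apply_symm_apply _)

/-- The restriction of a morphism of `S`-modules to the fibres at the origin. -/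
def Hom.fibre {E F : SModule S} (f : SModule.Hom E F) : Fibre E.π →ₗ[k] Fibre F.π where
  toFun e := e.map f.hom f.isBundleHom.w
  map_add' := f.isBundleHom.map_add
  map_smul' c e := f.isBundleHom.map_smul (algebraMap k _ c) e

lemma Hom.fibreEquiv_fibre {E F : SModule S} (f : SModule.Hom E F) (T : Sch k)
    (v : Fn T ⊗[k] Fibre E.π) :
    fibreEquiv F.π T (LinearMap.baseChange (Fn T) f.fibre v) =
      (fibreEquiv E.π T v).map f.hom f.isBundleHom.w := by
  let m : Fib E.π (1 : T ⟶ S.A) →ₗ[Fn T] Fib F.π (1 : T ⟶ S.A) :=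
    { toFun := fun e => e.map f.hom f.isBundleHom.w
      map_add' := f.isBundleHom.map_add
      map_smul' := f.isBundleHom.map_smul }
  change (((fibreEquiv F.π T).toLinearMap ∘ₗ LinearMap.baseChange (Fn T) f.fibre) v) =
    (m ∘ₗ (fibreEquiv E.π T).toLinearMap) v
  congr 1
  ext e
  change fibreEquiv F.π T (LinearMap.baseChange (Fn T) f.fibre (1 ⊗ₜ e)) =
    m (fibreEquiv E.π T (1 ⊗ₜ e))
  rw [LinearMap.baseChange_tmul, fibreEquiv_tmul, fibreEquiv_tmul, one_smul, one_smul]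
  exact Subtype.ext (Category.assoc _ _ _).symm

lemma Hom.fibre_equivariant {E F : SModule S} (f : SModule.Hom E F) {T : Sch k} (h : T ⟶ S.H)
    (v : Fn T ⊗[k] Fibre E.π) :
    LinearMap.baseChange (Fn T) f.fibre (E.fibre.ρ T h v) =
      F.fibre.ρ T h (LinearMap.baseChange (Fn T) f.fibre v) := by
  apply (fibreEquiv F.π T).injective
  apply Subtype.ext
  refine Eq.trans ?_ (F.fibreEquiv_ρ h (LinearMap.baseChange (Fn T) f.fibre v)).symm
  refine (congrArg Subtype.val (f.fibreEquiv_fibre T (E.fibre.ρ T h v))).trans ?_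
  rw [f.fibreEquiv_fibre]
  change (fibreEquiv E.π T (E.fibre.ρ T h v)).1 ≫ f.hom = F.act _ (_ ≫ f.hom)
  rw [fibreEquiv_ρ, f.equivariant]

end SModule

variable (S) in
/-- The functor `E ↦ E_0`, restriction to the fibre at the origin. -/
def fibreFunctor : Rep0 S ⥤ FinRep S.H where
  obj E := E.fibre
  map f := ⟨SModule.Hom.fibre f, SModule.Hom.fibre_equivariant f⟩
  map_id E := by
    apply FinRep.Hom.ext
    exact LinearMap.ext fun e => Subtype.ext (Category.comp_id e.1)
  map_comp f g := by
    apply FinRep.Hom.ext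
    exact LinearMap.ext fun e => Subtype.ext (Category.assoc e.1 f.hom g.hom).symm

/-! ### Induced spaces -/

variable (S) in
/-- `X` is the induced space `G ×^H V = (G × V) / H`: the quotient of `G × V` (with `T`-points
`G(T) × (𝒪(T) ⊗ V)`) by the free action `h · (g, v) = (g h⁻¹, h v)` of `H`. That is, `X`
represents the quotient fpqc sheaf, with quotient morphism `κ : G × V ⟶ X`: two points of
`(G × V)(T)` have the same image if and only if they are in the same `H(T)`-orbit, and
each point of `X(T)` lifts to `G × V` over some faithfully flat quasi-compact `T' ⟶ T`. -/
structure InducedSpace (M : FinRep S.H) (X : Sch k) where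
  κ : ∀ {T : Sch k}, (T ⟶ S.G) → (Fn T ⊗[k] M.V) → (T ⟶ X)
  natural : ∀ {T' T : Sch k} (f : T' ⟶ T) (g : T ⟶ S.G) (v : Fn T ⊗[k] M.V),
    κ (f ≫ g) (ptPull M.V f v) = f ≫ κ g v
  eq_iff : ∀ {T : Sch k} (g g' : T ⟶ S.G) (v v' : Fn T ⊗[k] M.V),
    κ g v = κ g' v' ↔ ∃ h : T ⟶ S.H, g' = g * (h ≫ S.j)⁻¹ ∧ v' = M.ρ T h v
  lifts : ∀ {T : Sch k} (x : T ⟶ X), ∃ (T' : Sch k) (f : T' ⟶ T), IsFpqc f ∧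
    ∃ (g : T' ⟶ S.G) (v : Fn T' ⊗[k] M.V), κ g v = f ≫ x

/-- The `S`-module structure of `E` on the induced space `G ×^H V` is the canonical one:
writing `[g, v] = κ(g, v)`, the bundle map sends `[g, v]` to `q(g)`, for all `g ∈ G(T)` the map
`v ↦ [g, v]` is an `𝒪(T)`-linear isomorphism from `𝒪(T) ⊗ V` to the fibre `X(T)_{q(g)}`, and the
action of `G` is `g' · [g, v] = [g' g, v]`. -/
structure InducedSpace.IsCanonical {M : FinRep S.H} {E : SModule S}
    (P : InducedSpace S M E.X) : Prop where
  fibre_iso : ∀ {T : Sch k} (g : T ⟶ S.G),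
    ∃ e : Fn T ⊗[k] M.V ≃ₗ[Fn T] Fib E.π (g ≫ S.q), ∀ v, (e v).1 = P.κ g v
  act : ∀ {T : Sch k} (g' g : T ⟶ S.G) (v : Fn T ⊗[k] M.V),
    E.act g' (P.κ g v) = P.κ (g' * g) v

/-! ### Tensor products of `S`-modules -/

variable (S) in
/-- The given monoidal structure on `Rep_0(S)` is the tensor product of vector bundles with the
diagonal action of `G`. The bundle `E ⊗ F` carries bilinear maps `X_E(T)_b × X_F(T)_b → X_{E ⊗ F}(T)_b`,
compatible with pullback, that induce
`X_E(T)_b ⊗ X_F(T)_b ≃ X_{E ⊗ F}(T)_b` for `T` affine, with `g · (e ⊗ f) = (g · e) ⊗ (g · f)`;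
the unit is the trivial line bundle `𝔸¹ × A` with the trivial action
`g · (c, b) = (c, q(g) + b)`; the tensor product of morphisms, the associator and the
unitors are given by the usual formulas. -/
structure BundleTensor [MonoidalCategory (Rep0 S)] where
  tmul : ∀ (E F : Rep0 S) {T : Sch k} (b : T ⟶ S.A),
    Fib E.π b →ₗ[Fn T] Fib F.π b →ₗ[Fn T] Fib (SModule.π (E ⊗ F)) b
  tmul_pull : ∀ (E F : Rep0 S) {T' T : Sch k} (t : T' ⟶ T) (b : T ⟶ S.A)
    (e : Fib E.π b) (f : Fib F.π b),
    tmul E F (t ≫ b) (e.pull t) (f.pull t) = (tmul E F b e f).pull t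
  isTensorProduct : ∀ (E F : Rep0 S) {T : Sch k} [IsAffine T.left] (b : T ⟶ S.A),
    IsTensorProduct (tmul E F b)
  act_tmul : ∀ (E F : Rep0 S) {T : Sch k} (g : T ⟶ S.G) (b b' : T ⟶ S.A)
    (e : Fib E.π b) (f : Fib F.π b) (e' : Fib E.π b') (f' : Fib F.π b'),
    e'.1 = E.act g e.1 → f'.1 = F.act g f.1 →
      (tmul E F b' e' f').1 = SModule.act (E ⊗ F) g (tmul E F b e f).1
  unit : ∀ {T : Sch k} (b : T ⟶ S.A), Fn T ≃ₗ[Fn T] Fib (SModule.π (𝟙_ (Rep0 S))) b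
  unit_pull : ∀ {T' T : Sch k} (t : T' ⟶ T) (b : T ⟶ S.A) (c : Fn T),
    unit (t ≫ b) (Fn.pull t c) = (unit b c).pull t
  act_unit : ∀ {T : Sch k} (g : T ⟶ S.G) (b : T ⟶ S.A) (c : Fn T),
    SModule.act (𝟙_ (Rep0 S)) g (unit b c).1 = (unit ((g ≫ S.q) * b) c).1
  map_tmul : ∀ {E E' F F' : Rep0 S} (φ : E ⟶ E') (ψ : F ⟶ F') {T : Sch k} (b : T ⟶ S.A)
    (e : Fib E.π b) (f : Fib F.π b),
    (tmul E F b e f).map (SModule.Hom.hom (φ ⊗ₘ ψ)) (φ ⊗ₘ ψ).isBundleHom.w =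
      tmul E' F' b (e.map φ.hom φ.isBundleHom.w) (f.map ψ.hom ψ.isBundleHom.w)
  associator : ∀ (E F K : Rep0 S) {T : Sch k} (b : T ⟶ S.A)
    (e : Fib E.π b) (f : Fib F.π b) (l : Fib K.π b),
    (tmul (E ⊗ F) K b (tmul E F b e f) l).map (SModule.Hom.hom (α_ E F K).hom)
        (α_ E F K).hom.isBundleHom.w =
      tmul E (F ⊗ K) b e (tmul F K b f l)
  leftUnitor : ∀ (E : Rep0 S) {T : Sch k} (b : T ⟶ S.A) (c : Fn T) (e : Fib E.π b),
    (tmul (𝟙_ (Rep0 S)) E b (unit b c) e).map (SModule.Hom.hom (λ_ E).hom)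
      (λ_ E).hom.isBundleHom.w = c • e
  rightUnitor : ∀ (E : Rep0 S) {T : Sch k} (b : T ⟶ S.A) (c : Fn T) (e : Fib E.π b),
    (tmul E (𝟙_ (Rep0 S)) b e (unit b c)).map (SModule.Hom.hom (ρ_ E).hom)
      (ρ_ E).hom.isBundleHom.w = c • e

end

end AffExt

/-! The fibre of `G ×^H V` over `b ∈ A(T)` is described directly. The lifts of `b` to `G` form an
`H`-torsor `T ×_A G → T` (`torsor b`), which is affine and faithfully flat because `q` is, and a
point of `G ×^H V` over `b` is an equivariant function `s` on this torsor with values in `V`, `s(g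
h⁻¹) = h s(g)` (`Sec M b`). A lift `g` of `b` identifies these functions with `𝒪(T) ⊗ V` by
evaluation, and `[g, v]` corresponds to the function with value `v` at `g`.

Existence of the quotient is then a representability statement for `T ↦ {(b, s)}`. For affine `T`,
descent for modules shows that `Sec M b` becomes `𝒪(T ×_A G) ⊗ V` after base change to the torsor
(`sec_isBaseChange`). Hence near a given point one can choose `dim V` equivariant functions whose
determinant does not vanish there. The nonvanishing locus is stable under changing the lift, so it
descends to an open subset of `A`, and the functions are a frame over it (`exists_sec_frame`,
`exists_sec_frame_pull`). The functor is a Zariski sheaf (`indFunctor_isSheaf`) covered by affine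
spaces over opens of `A`, so it is representable (`indFunctor_isRepresentable`,
`exists_inducedSpace`). Conversely, the points of any quotient are equivariant functions
(`InducedSpace.fibEquiv`), which gives it its bundle structure; left translation gives the action of
`G`.

If `E` is an `S`-module, then after passing to the torsor every point of `E` can be moved to the
fibre at the origin, so `(g, v) ↦ g · v` exhibits `E` itself as a quotient `G ×^H E_0`
(`SModule.inducedSpace`). Quotients of the same `H`-module are canonically isomorphic, which yields
the equivalence `indEquivalence`.

The rest is transport of structure from `H`-modules, where kernels, cokernels, tensor products and
duals are those of vector spaces. To recognise the transported product as the tensor product of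
bundles, the maps `E_0 ⊗ F_0 → (E ⊗ F)_0` are spread out by `G` to bilinear maps of bundles, and
their universal property is checked on the torsor by faithfully flat descent
(`SModule.isTensorProduct_bilin`). -/

namespace AffExt

/-! ### Functions and vectors on `k`-schemes, their fpqc descent and Zariski gluing. -/

noncomputable section

variable {k : Type u} [Field k]

/-! ### Pullback of functions and vectors -/

lemma Fn.pull_id (T : Sch k) (c : Fn T) : Fn.pull (𝟙 T) c = c := rfl

lemma Fn.pull_comp {T'' T' T : Sch k} (f : T'' ⟶ T') (g : T' ⟶ T) (c : Fn T) :
    Fn.pull (f ≫ g) c = Fn.pull f (Fn.pull g c) := by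
  change (f ≫ g).left.appTop.hom c = f.left.appTop.hom (g.left.appTop.hom c)
  rw [Over.comp_left, Scheme.Hom.comp_appTop]
  rfl

variable (V : Type u) [AddCommGroup V] [Module k V]

lemma ptPull_tmul {T' T : Sch k} (f : T' ⟶ T) (c : Fn T) (v : V) :
    ptPull V f (c ⊗ₜ v) = Fn.pull f c ⊗ₜ v := rfl

lemma ptPull_id (T : Sch k) (v : Fn T ⊗[k] V) : ptPull V (𝟙 T) v = v := by
  induction v using TensorProduct.induction_on with
  | zero => exact map_zero _
  | tmul c e => rfl
  | add x y hx hy => rw [map_add, hx, hy]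

lemma ptPull_comp {T'' T' T : Sch k} (f : T'' ⟶ T') (g : T' ⟶ T) (v : Fn T ⊗[k] V) :
    ptPull V (f ≫ g) v = ptPull V f (ptPull V g v) := by
  induction v using TensorProduct.induction_on with
  | zero => simp only [map_zero]
  | tmul c e => rw [ptPull_tmul, ptPull_tmul, ptPull_tmul, Fn.pull_comp]
  | add x y hx hy => simp only [map_add, hx, hy]

lemma ptPull_smul {T' T : Sch k} (f : T' ⟶ T) (c : Fn T) (v : Fn T ⊗[k] V) :
    ptPull V f (c • v) = Fn.pull f c • ptPull V f v := by
  induction v using TensorProduct.induction_on with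
  | zero => simp only [map_zero, smul_zero]
  | tmul d e =>
    rw [TensorProduct.smul_tmul', ptPull_tmul, ptPull_tmul, TensorProduct.smul_tmul', smul_eq_mul,
      smul_eq_mul, map_mul]
  | add x y hx hy => simp only [map_add, smul_add, hx, hy]

lemma ptPull_baseChange {V W : Type u} [AddCommGroup V] [Module k V] [AddCommGroup W] [Module k W]
    (φ : V →ₗ[k] W) {T' T : Sch k} (f : T' ⟶ T) (v : Fn T ⊗[k] V) :
    ptPull W f (φ.baseChange (Fn T) v) = φ.baseChange (Fn T') (ptPull V f v) := by
  induction v using TensorProduct.induction_on with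
  | zero => simp only [map_zero]
  | tmul d e => rfl
  | add x y hx hy => simp only [map_add, hx, hy]

/-- The index type of a basis of `V`. -/
abbrev BIdx : Type u := Module.Free.ChooseBasisIndex k V

variable (k) in
/-- The coordinates of a `T`-point of `V` with respect to a chosen basis. -/
def vecCoord [Module.Finite k V] (T : Sch k) : Fn T ⊗[k] V ≃ (BIdx (k := k) V → Fn T) :=
  ((Module.Free.chooseBasis k V).baseChange (Fn T)).equivFun.toEquiv

lemma vecCoord_ptPull [Module.Finite k V] {T' T : Sch k} (f : T' ⟶ T) (v : Fn T ⊗[k] V)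
    (i : BIdx (k := k) V) :
    vecCoord k V T' (ptPull V f v) i = Fn.pull f (vecCoord k V T v i) := by
  induction v using TensorProduct.induction_on with
  | zero => simp [vecCoord]
  | tmul c e =>
    simp [vecCoord, ptPull_tmul, Module.Basis.baseChange_repr_tmul]
  | add x y hx hy =>
    simp only [vecCoord, map_add, LinearEquiv.coe_toEquiv, Pi.add_apply] at hx hy ⊢
    rw [hx, hy]

/-- Points of `V` as morphisms to an affine space over `ℤ`. -/
def vecHom [Module.Finite k V] (T : Sch k) :
    Fn T ⊗[k] V ≃ (T.left ⟶ Spec (.of (MvPolynomial (BIdx (k := k) V) (ULift.{u} ℤ)))) :=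
  (vecCoord k V T).trans (AffineSpace.toSpecMvPolyIntEquiv _).symm

/-- By this naturality, uniqueness, descent and gluing for points of `V` reduce to the same
questions for morphisms of schemes into an affine space. -/
lemma vecHom_ptPull [Module.Finite k V] {T' T : Sch k} (f : T' ⟶ T) (v : Fn T ⊗[k] V) :
    vecHom V T' (ptPull V f v) = f.left ≫ vecHom V T v := by
  apply (AffineSpace.toSpecMvPolyIntEquiv _).injective
  funext i
  rw [AffineSpace.toSpecMvPolyIntEquiv_comp]
  have h : ∀ (T : Sch k) (v : Fn T ⊗[k] V),
      AffineSpace.toSpecMvPolyIntEquiv _ (vecHom V T v) = vecCoord k V T v := fun T v =>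
    Equiv.apply_symm_apply (AffineSpace.toSpecMvPolyIntEquiv _) (vecCoord k V T v)
  exact (congrFun (h T' _) i).trans ((vecCoord_ptPull V f v i).trans
    (congrArg (Fn.pull f) (congrFun (h T v) i).symm))

/-! ### Descent -/

lemma IsFpqc.epi {T' T : Sch k} {f : T' ⟶ T} (hf : IsFpqc f) : Epi f.left := by
  have := hf.1; have := hf.2.1; have := hf.2.2
  exact Flat.epi_of_flat_of_surjective _

lemma IsFpqc.hom_ext {T' T Y : Sch k} {f : T' ⟶ T} (hf : IsFpqc f) {x y : T ⟶ Y}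
    (h : f ≫ x = f ≫ y) : x = y := by
  have := hf.epi
  ext : 1
  rw [← cancel_epi f.left, ← Over.comp_left, h, Over.comp_left]

lemma IsFpqc.ptPull_injective [Module.Finite k V] {T' T : Sch k} {f : T' ⟶ T} (hf : IsFpqc f) :
    Function.Injective (ptPull V f) := by
  intro v w h
  have := hf.epi
  apply (vecHom V T).injective
  rw [← cancel_epi f.left, ← vecHom_ptPull, h, vecHom_ptPull]

/-- A faithfully flat quasi-compact morphism is a regular epimorphism of schemes. The target `Y` has
no structure over `k`, so that the affine space over `ℤ` used for vectors is allowed. -/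
lemma IsFpqc.exists_desc_left {T' T : Sch k} {f : T' ⟶ T} (hf : IsFpqc f) {Y : Scheme.{u}}
    (x : T'.left ⟶ Y)
    (hx : ∀ {T'' : Sch k} (a b : T'' ⟶ T'), a ≫ f = b ≫ f → a.left ≫ x = b.left ≫ x) :
    ∃ y : T.left ⟶ Y, f.left ≫ y = x := by
  have := hf.1; have := hf.2.1; have := hf.2.2
  refine IsRegularEpi.exists_of_isKernelPair f.left (IsPullback.of_hasPullback f.left f.left) x ?_
  let P : Sch k := Over.mk (Limits.pullback.fst f.left f.left ≫ T'.hom)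
  have h2 : Limits.pullback.snd f.left f.left ≫ T'.hom =
      Limits.pullback.fst f.left f.left ≫ T'.hom := by
    rw [← Over.w f, ← Category.assoc, ← Category.assoc, Limits.pullback.condition]
  let a : P ⟶ T' := Over.homMk (Limits.pullback.fst f.left f.left) rfl
  let b : P ⟶ T' := Over.homMk (Limits.pullback.snd f.left f.left) h2
  refine hx a b ?_
  ext : 1
  exact Limits.pullback.condition

lemma IsFpqc.exists_desc {T' T Y : Sch k} {f : T' ⟶ T} (hf : IsFpqc f) (x : T' ⟶ Y)
    (hx : ∀ {T'' : Sch k} (a b : T'' ⟶ T'), a ≫ f = b ≫ f → a ≫ x = b ≫ x) :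
    ∃ y : T ⟶ Y, f ≫ y = x := by
  obtain ⟨y, hy⟩ := hf.exists_desc_left x.left fun a b h => by
    rw [← Over.comp_left, hx a b h, Over.comp_left]
  have := hf.epi
  refine ⟨Over.homMk y ?_, ?_⟩
  -- The descended morphism is compatible with the structure morphisms because this holds after
  -- composition with the epimorphism `f`.
  · rw [← cancel_epi f.left, reassoc_of% hy, Over.w, Over.w]
  · ext : 1
    exact hy

lemma IsFpqc.exists_vec [Module.Finite k V] {T' T : Sch k} {f : T' ⟶ T} (hf : IsFpqc f)
    (v : Fn T' ⊗[k] V)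
    (hv : ∀ {T'' : Sch k} (a b : T'' ⟶ T'), a ≫ f = b ≫ f → ptPull V a v = ptPull V b v) :
    ∃ w : Fn T ⊗[k] V, ptPull V f w = v := by
  obtain ⟨y, hy⟩ := hf.exists_desc_left (vecHom V T' v) fun a b h => by
    rw [← vecHom_ptPull, ← vecHom_ptPull, hv a b h]
  refine ⟨(vecHom V T).symm y, (vecHom V T').injective ?_⟩
  rw [vecHom_ptPull, Equiv.apply_symm_apply, hy]

lemma Fn.rid_pull {T' T : Sch k} (f : T' ⟶ T) (v : Fn T ⊗[k] k) :
    Fn.pull f (TensorProduct.rid k (Fn T) v) = TensorProduct.rid k (Fn T') (ptPull k f v) := by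
  induction v using TensorProduct.induction_on with
  | zero => simp only [map_zero]
  | tmul c e => rw [ptPull_tmul]; simp
  | add x y hx hy => simp only [map_add, hx, hy]

/-- A function is a point of the vector space `k`, by `𝒪(T) ⊗ k ≃ 𝒪(T)`; this one and
`IsFpqc.exists_fn` are the case `V = k` of the statements for vectors. -/
lemma IsFpqc.pull_injective {T' T : Sch k} {f : T' ⟶ T} (hf : IsFpqc f) :
    Function.Injective (Fn.pull f) := by
  intro v w h
  apply (TensorProduct.rid k (Fn T)).symm.injective
  apply hf.ptPull_injective k
  apply (TensorProduct.rid k (Fn T')).injective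
  rw [← Fn.rid_pull, ← Fn.rid_pull]
  simpa using h

lemma IsFpqc.exists_fn {T' T : Sch k} {f : T' ⟶ T} (hf : IsFpqc f) (c : Fn T')
    (hc : ∀ {T'' : Sch k} (a b : T'' ⟶ T'), a ≫ f = b ≫ f → Fn.pull a c = Fn.pull b c) :
    ∃ d : Fn T, Fn.pull f d = c := by
  obtain ⟨w, hw⟩ := hf.exists_vec k ((TensorProduct.rid k (Fn T')).symm c) fun a b h => by
    apply (TensorProduct.rid k _).injective
    rw [← Fn.rid_pull, ← Fn.rid_pull]
    simpa using hc a b h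
  refine ⟨TensorProduct.rid k _ w, ?_⟩
  rw [Fn.rid_pull, hw]
  simp

lemma IsFpqc.of_isPullback {P X Y Z : Sch k} {fst : P ⟶ X} {snd : P ⟶ Y} {f : X ⟶ Z} {g : Y ⟶ Z}
    (h : IsPullback fst snd f g) (hg : IsFpqc g) : IsFpqc fst := by
  have h' := h.map (Over.forget _)
  obtain ⟨h1, h2, h3⟩ := hg
  exact ⟨MorphismProperty.of_isPullback (P := @Flat) h'.flip h1,
    MorphismProperty.of_isPullback (P := @Surjective) h'.flip h2,
    MorphismProperty.of_isPullback (P := @QuasiCompact) h'.flip h3⟩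

/-! ### Zariski covers -/

/-- A member of an open cover, as a `k`-scheme. -/
def coverObj {T : Sch k} (𝒰 : T.left.OpenCover) (i : 𝒰.I₀) : Sch k := Over.mk (𝒰.f i ≫ T.hom)

/-- The inclusion of a member of an open cover. -/
def coverMap {T : Sch k} (𝒰 : T.left.OpenCover) (i : 𝒰.I₀) : coverObj 𝒰 i ⟶ T :=
  Over.homMk (𝒰.f i) rfl

lemma cover_ptPull_ext [Module.Finite k V] {T : Sch k} (𝒰 : T.left.OpenCover) {v w : Fn T ⊗[k] V}
    (h : ∀ i, ptPull V (coverMap 𝒰 i) v = ptPull V (coverMap 𝒰 i) w) : v = w := by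
  apply (vecHom V T).injective
  refine Scheme.Cover.hom_ext 𝒰 _ _ fun i => ?_
  change (coverMap 𝒰 i).left ≫ _ = (coverMap 𝒰 i).left ≫ _
  rw [← vecHom_ptPull, h, vecHom_ptPull]

lemma cover_exists_left {T : Sch k} (𝒰 : T.left.OpenCover) {Y : Scheme.{u}}
    (x : ∀ i, (coverObj 𝒰 i).left ⟶ Y)
    (hx : ∀ {T' : Sch k} (i j : 𝒰.I₀) (a : T' ⟶ coverObj 𝒰 i) (b : T' ⟶ coverObj 𝒰 j),
      a ≫ coverMap 𝒰 i = b ≫ coverMap 𝒰 j → a.left ≫ x i = b.left ≫ x j) :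
    ∃ y : T.left ⟶ Y, ∀ i, (coverMap 𝒰 i).left ≫ y = x i := by
  refine ⟨Scheme.Cover.glueMorphisms 𝒰 x fun i j => ?_, fun i => Scheme.Cover.ι_glueMorphisms ..⟩
  let P : Sch k := Over.mk (Limits.pullback.fst (𝒰.f i) (𝒰.f j) ≫ 𝒰.f i ≫ T.hom)
  let a : P ⟶ coverObj 𝒰 i := Over.homMk (Limits.pullback.fst (𝒰.f i) (𝒰.f j)) rfl
  let b : P ⟶ coverObj 𝒰 j := Over.homMk (Limits.pullback.snd (𝒰.f i) (𝒰.f j)) (by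
    change _ ≫ 𝒰.f j ≫ T.hom = _ ≫ 𝒰.f i ≫ T.hom
    rw [← Category.assoc, ← Category.assoc, Limits.pullback.condition])
  refine hx i j a b ?_
  ext : 1
  exact Limits.pullback.condition

lemma cover_exists_vec [Module.Finite k V] {T : Sch k} (𝒰 : T.left.OpenCover)
    (v : ∀ i, Fn (coverObj 𝒰 i) ⊗[k] V)
    (hv : ∀ {T' : Sch k} (i j : 𝒰.I₀) (a : T' ⟶ coverObj 𝒰 i) (b : T' ⟶ coverObj 𝒰 j),
      a ≫ coverMap 𝒰 i = b ≫ coverMap 𝒰 j → ptPull V a (v i) = ptPull V b (v j)) :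
    ∃ w : Fn T ⊗[k] V, ∀ i, ptPull V (coverMap 𝒰 i) w = v i := by
  obtain ⟨y, hy⟩ := cover_exists_left 𝒰 (fun i => vecHom V _ (v i)) fun i j a b h => by
    rw [← vecHom_ptPull, ← vecHom_ptPull, hv i j a b h]
  refine ⟨(vecHom V T).symm y, fun i => (vecHom V _).injective ?_⟩
  rw [vecHom_ptPull, Equiv.apply_symm_apply, hy]

end

end AffExt

/-! ### The torsor of lifts of a point of `A`, and equivariant functions on it. -/

namespace AffExt

noncomputable section

variable {k : Type u} [Field k] {S : AffineExtension k}

/-! ### The torsor of lifts of a point of `A` -/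

/-- The scheme `T ×_A G` of lifts to `G` of a point `b ∈ A(T)`. -/
def torsor {T : Sch k} (b : T ⟶ S.A) : Sch k := Limits.pullback b S.q

/-- The projection `T ×_A G ⟶ T`. -/
def torsor.fst {T : Sch k} (b : T ⟶ S.A) : torsor b ⟶ T := Limits.pullback.fst b S.q

/-- The universal lift `T ×_A G ⟶ G`. -/
def torsor.snd {T : Sch k} (b : T ⟶ S.A) : torsor b ⟶ S.G := Limits.pullback.snd b S.q

lemma torsor.isPullback {T : Sch k} (b : T ⟶ S.A) :
    IsPullback (torsor.fst b) (torsor.snd b) b S.q := IsPullback.of_hasPullback b S.q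

lemma torsor.w {T : Sch k} (b : T ⟶ S.A) : torsor.fst b ≫ b = torsor.snd b ≫ S.q :=
  Limits.pullback.condition

/-- The point of `T ×_A G` given by a lift `g` of the pullback of `b` along `t`. -/
def torsor.lift {T T' : Sch k} {b : T ⟶ S.A} (t : T' ⟶ T) (g : T' ⟶ S.G)
    (w : t ≫ b = g ≫ S.q) : T' ⟶ torsor b := Limits.pullback.lift t g w

@[simp]
lemma torsor.lift_fst {T T' : Sch k} {b : T ⟶ S.A} (t : T' ⟶ T) (g : T' ⟶ S.G)
    (w : t ≫ b = g ≫ S.q) : torsor.lift t g w ≫ torsor.fst b = t := Limits.pullback.lift_fst _ _ _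

@[simp]
lemma torsor.lift_snd {T T' : Sch k} {b : T ⟶ S.A} (t : T' ⟶ T) (g : T' ⟶ S.G)
    (w : t ≫ b = g ≫ S.q) : torsor.lift t g w ≫ torsor.snd b = g := Limits.pullback.lift_snd _ _ _

@[simp]
lemma torsor.lift_fst_assoc {T T' Y : Sch k} {b : T ⟶ S.A} (t : T' ⟶ T) (g : T' ⟶ S.G)
    (w : t ≫ b = g ≫ S.q) (z : T ⟶ Y) : torsor.lift t g w ≫ torsor.fst b ≫ z = t ≫ z := by
  rw [← Category.assoc, torsor.lift_fst]

lemma torsor.hom_ext {T T' : Sch k} {b : T ⟶ S.A} {p p' : T' ⟶ torsor b}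
    (h1 : p ≫ torsor.fst b = p' ≫ torsor.fst b) (h2 : p ≫ torsor.snd b = p' ≫ torsor.snd b) :
    p = p' := Limits.pullback.hom_ext h1 h2

lemma torsor.comp_w {T T' : Sch k} {b : T ⟶ S.A} (p : T' ⟶ torsor b) :
    (p ≫ torsor.snd b) ≫ S.q = p ≫ torsor.fst b ≫ b := by
  rw [Category.assoc, ← torsor.w]

lemma torsor.comp_lift {T T' T'' : Sch k} {b : T ⟶ S.A} (f : T'' ⟶ T') (t : T' ⟶ T) (g : T' ⟶ S.G)
    (w : t ≫ b = g ≫ S.q) :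
    f ≫ torsor.lift t g w = torsor.lift (f ≫ t) (f ≫ g) (by simp only [Category.assoc, w]) :=
  torsor.hom_ext (by simp) (by simp)

variable (S) in
lemma AffineExtension.isFpqc_q : IsFpqc S.q := by
  have := S.affine
  exact ⟨S.flat, S.surjective, inferInstance⟩

lemma torsor.isFpqc {T : Sch k} (b : T ⟶ S.A) : IsFpqc (torsor.fst b) :=
  IsFpqc.of_isPullback (torsor.isPullback b) S.isFpqc_q

lemma torsor.isAffineHom {T : Sch k} (b : T ⟶ S.A) : IsAffineHom (torsor.fst b).left :=
  MorphismProperty.of_isPullback (P := @IsAffineHom)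
    ((torsor.isPullback b).map (Over.forget _)).flip S.affine

lemma torsor.isAffine {T : Sch k} [IsAffine T.left] (b : T ⟶ S.A) : IsAffine (torsor b).left := by
  have := torsor.isAffineHom b
  exact isAffine_of_isAffineHom (torsor.fst b).left

/-! ### Comparison of two lifts -/

open Classical in
/-- The element `h = g'⁻¹ g` of `H(T)`, for two lifts `g`, `g'` of the same point of `A`, so that
`g' = g h⁻¹`. -/
def hdiff {T : Sch k} (g g' : T ⟶ S.G) : T ⟶ S.H :=
  -- By exactness the default value `1` occurs only when `g` and `g'` have different images in `A`.
  if h : ∃ h : T ⟶ S.H, h ≫ S.j = g'⁻¹ * g then h.choose else 1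

lemma hdiff_j {T : Sch k} {g g' : T ⟶ S.G} (w : g ≫ S.q = g' ≫ S.q) :
    hdiff g g' ≫ S.j = g'⁻¹ * g := by
  have h : ∃ h : T ⟶ S.H, h ≫ S.j = g'⁻¹ * g := by
    rw [← S.exact, MonObj.mul_comp, GrpObj.inv_comp, w, inv_mul_cancel]
  rw [hdiff, dif_pos h]
  exact h.choose_spec

lemma hdiff_eq {T : Sch k} {g g' : T ⟶ S.G} {h : T ⟶ S.H} (e : h ≫ S.j = g'⁻¹ * g) :
    hdiff g g' = h := by
  refine S.injective _ _ ?_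
  have h : ∃ h : T ⟶ S.H, h ≫ S.j = g'⁻¹ * g := ⟨_, e⟩
  rw [hdiff, dif_pos h, h.choose_spec, e]

lemma hdiff_eq' {T : Sch k} {g g' : T ⟶ S.G} {h : T ⟶ S.H} (e : g' = g * (h ≫ S.j)⁻¹) :
    hdiff g g' = h := hdiff_eq (by rw [e]; group)

lemma q_mul_inv {T : Sch k} (g : T ⟶ S.G) (h : T ⟶ S.H) :
    (g * (h ≫ S.j)⁻¹) ≫ S.q = g ≫ S.q := by
  rw [MonObj.mul_comp, GrpObj.inv_comp, AffineExtension.j_q, inv_one, mul_one]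

variable (M : FinRep S.H)

/-- The isomorphism from the fibre of an induced space in the trivialization given by `g` to that in
the trivialization given by `g'`. -/
def tr {T : Sch k} (g g' : T ⟶ S.G) : Module.End (Fn T) (Fn T ⊗[k] M.V) := M.ρ T (hdiff g g')

lemma tr_self {T : Sch k} (g : T ⟶ S.G) : tr M g g = 1 := by
  rw [tr, hdiff_eq (h := 1), map_one]
  rw [MonObj.one_comp, inv_mul_cancel]

/-- The cocycle condition for the descent datum that twists `V` by the torsor; it expresses `(g''⁻¹
g')(g'⁻¹ g) = g''⁻¹ g`. -/
lemma tr_mul {T : Sch k} {g g' g'' : T ⟶ S.G} (w : g ≫ S.q = g' ≫ S.q)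
    (w' : g' ≫ S.q = g'' ≫ S.q) : tr M g' g'' * tr M g g' = tr M g g'' := by
  rw [tr, tr, tr, ← map_mul, hdiff_eq (g := g) (g' := g'')]
  rw [MonObj.mul_comp, hdiff_j w, hdiff_j w']
  group

lemma tr_tr {T : Sch k} {g g' g'' : T ⟶ S.G} (w : g ≫ S.q = g' ≫ S.q)
    (w' : g' ≫ S.q = g'' ≫ S.q) (v : Fn T ⊗[k] M.V) :
    tr M g' g'' (tr M g g' v) = tr M g g'' v := by
  rw [← tr_mul M w w']
  rfl

lemma ptPull_tr {T' T : Sch k} (f : T' ⟶ T) {g g' : T ⟶ S.G} (w : g ≫ S.q = g' ≫ S.q)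
    (v : Fn T ⊗[k] M.V) :
    ptPull M.V f (tr M g g' v) = tr M (f ≫ g) (f ≫ g') (ptPull M.V f v) := by
  rw [tr, tr, ← M.ρ_natural, hdiff_eq (g := f ≫ g) (h := f ≫ hdiff g g')]
  rw [Category.assoc, hdiff_j w, MonObj.comp_mul, GrpObj.comp_inv]

/-! ### Equivariant functions -/

instance {T : Sch k} (b : T ⟶ S.A) : Algebra (Fn T) (Fn (torsor b)) :=
  (Fn.pull (torsor.fst b)).toRingHom.toAlgebra

lemma torsor.algebraMap_eq {T : Sch k} (b : T ⟶ S.A) (c : Fn T) :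
    algebraMap (Fn T) (Fn (torsor b)) c = Fn.pull (torsor.fst b) c := rfl

instance {T : Sch k} (b : T ⟶ S.A) : IsScalarTower k (Fn T) (Fn (torsor b)) :=
  IsScalarTower.of_algebraMap_eq fun c => ((Fn.pull (torsor.fst b)).commutes c).symm

/-- The `𝒪(T)`-module of equivariant functions `s : T ×_A G ⟶ V`,
`s (g h⁻¹) = h s (g)`. -/
def secSub {T : Sch k} (b : T ⟶ S.A) : Submodule (Fn T) (Fn (torsor b) ⊗[k] M.V) where
  -- Equivariance is stated for pairs of points of the torsor over the same point of `T`; since such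
  -- a pair differs by a unique element of `H`, this replaces the action of `H`.
  carrier := {s | ∀ {T' : Sch k} (p p' : T' ⟶ torsor b), p ≫ torsor.fst b = p' ≫ torsor.fst b →
    ptPull M.V p' s = tr M (p ≫ torsor.snd b) (p' ≫ torsor.snd b) (ptPull M.V p s)}
  add_mem' hs hs' := fun p p' h => by rw [map_add, map_add, map_add, hs p p' h, hs' p p' h]
  zero_mem' := fun p p' h => by rw [map_zero, map_zero, map_zero]
  smul_mem' c s hs := fun p p' h => by
    rw [← algebraMap_smul (Fn (torsor b)) c s, ptPull_smul, ptPull_smul, map_smul, hs p p' h,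
      torsor.algebraMap_eq, ← Fn.pull_comp, ← Fn.pull_comp, h]

/-- Equivariant functions `T ×_A G ⟶ V`. -/
abbrev Sec {T : Sch k} (b : T ⟶ S.A) : Type u := secSub M b

variable {M}

/-- The value of an equivariant function at a lift `g` of `b`. -/
def Sec.eval {T T' : Sch k} {b : T ⟶ S.A} (s : Sec M b) (t : T' ⟶ T) (g : T' ⟶ S.G)
    (w : t ≫ b = g ≫ S.q) : Fn T' ⊗[k] M.V := ptPull M.V (torsor.lift t g w) s.1

lemma Sec.val_eq_eval {T : Sch k} {b : T ⟶ S.A} (s : Sec M b) :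
    s.1 = s.eval (torsor.fst b) (torsor.snd b) (torsor.w b) := by
  rw [Sec.eval, show torsor.lift (torsor.fst b) (torsor.snd b) (torsor.w b) = 𝟙 _ from
    torsor.hom_ext (by simp) (by simp), ptPull_id]

lemma Sec.ptPull_eval {T T' T'' : Sch k} {b : T ⟶ S.A} (s : Sec M b) (f : T'' ⟶ T') (t : T' ⟶ T)
    (g : T' ⟶ S.G) (w : t ≫ b = g ≫ S.q) :
    ptPull M.V f (s.eval t g w) = s.eval (f ≫ t) (f ≫ g) (by simp only [Category.assoc, w]) := by
  rw [Sec.eval, Sec.eval, ← ptPull_comp, torsor.comp_lift]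

lemma Sec.ptPull_val {T T' : Sch k} {b : T ⟶ S.A} (s : Sec M b) (p : T' ⟶ torsor b) :
    ptPull M.V p s.1 = s.eval (p ≫ torsor.fst b) (p ≫ torsor.snd b)
      (by simp only [Category.assoc, torsor.w]) := by
  rw [val_eq_eval, ptPull_eval]

lemma Sec.eval_tr {T T' : Sch k} {b : T ⟶ S.A} (s : Sec M b) (t : T' ⟶ T) (g g' : T' ⟶ S.G)
    (w : t ≫ b = g ≫ S.q) (w' : t ≫ b = g' ≫ S.q) :
    s.eval t g' w' = tr M g g' (s.eval t g w) := by
  have := s.2 (torsor.lift t g w) (torsor.lift t g' w') (by simp)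
  rwa [torsor.lift_snd, torsor.lift_snd] at this

lemma Sec.ext_eval {T : Sch k} {b : T ⟶ S.A} {s s' : Sec M b}
    (h : ∀ {T' : Sch k} (t : T' ⟶ T) (g : T' ⟶ S.G) (w : t ≫ b = g ≫ S.q),
      s.eval t g w = s'.eval t g w) : s = s' := by
  apply Subtype.ext
  rw [val_eq_eval, val_eq_eval, h]

lemma Sec.eval_add {T T' : Sch k} {b : T ⟶ S.A} (s s' : Sec M b) (t : T' ⟶ T) (g : T' ⟶ S.G)
    (w : t ≫ b = g ≫ S.q) : (s + s').eval t g w = s.eval t g w + s'.eval t g w :=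
  map_add _ _ _

lemma Sec.eval_zero {T T' : Sch k} {b : T ⟶ S.A} (t : T' ⟶ T) (g : T' ⟶ S.G)
    (w : t ≫ b = g ≫ S.q) : (0 : Sec M b).eval t g w = 0 :=
  map_zero _

lemma Sec.eval_smul {T T' : Sch k} {b : T ⟶ S.A} (c : Fn T) (s : Sec M b) (t : T' ⟶ T)
    (g : T' ⟶ S.G) (w : t ≫ b = g ≫ S.q) :
    (c • s).eval t g w = Fn.pull t c • s.eval t g w := by
  rw [eval, eval]
  change ptPull _ _ (c • s.1) = _
  rw [← algebraMap_smul (Fn (torsor b)) c s.1, ptPull_smul, torsor.algebraMap_eq, ← Fn.pull_comp,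
    torsor.lift_fst]

/-- Pullback of equivariant functions. -/
def Sec.pull {T T' : Sch k} {b : T ⟶ S.A} (s : Sec M b) (f : T' ⟶ T) {b' : T' ⟶ S.A}
    (hb : f ≫ b = b') : Sec M b' :=
  ⟨s.eval (torsor.fst b' ≫ f) (torsor.snd b') (by rw [Category.assoc, hb, torsor.w]),
    fun p p' h => by
      rw [s.ptPull_eval, s.ptPull_eval, s.eval_tr _ (p ≫ torsor.snd b')]
      · simp only [← Category.assoc, h]
      · simp only [Category.assoc, ← torsor.w, hb]
        simp only [← Category.assoc, h]⟩

lemma Sec.eval_pull {T T' T'' : Sch k} {b : T ⟶ S.A} (s : Sec M b) (f : T' ⟶ T) {b' : T' ⟶ S.A}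
    (hb : f ≫ b = b') (t : T'' ⟶ T') (g : T'' ⟶ S.G) (w : t ≫ b' = g ≫ S.q) :
    (s.pull f hb).eval t g w = s.eval (t ≫ f) g (by rw [Category.assoc, hb, w]) := by
  rw [Sec.eval]
  simp only [Sec.pull, s.ptPull_eval]
  simp only [torsor.lift_snd, torsor.lift_fst_assoc]

/-- One global lift determines the function, as its value at any other lift is obtained by `tr`. -/
lemma Sec.eval_injective {T : Sch k} {b : T ⟶ S.A} {g : T ⟶ S.G} (w : 𝟙 T ≫ b = g ≫ S.q)
    {s s' : Sec M b} (h : s.eval (𝟙 T) g w = s'.eval (𝟙 T) g w) : s = s' := by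
  refine Sec.ext_eval fun t g' w' => ?_
  have e := congrArg (ptPull M.V t) h
  rw [s.ptPull_eval, s'.ptPull_eval] at e
  simp only [Category.comp_id] at e
  rw [s.eval_tr t (t ≫ g) g', s'.eval_tr t (t ≫ g) g', e]
  simpa using congrArg (fun x => t ≫ x) w

variable (M) in
/-- The equivariant function with value `v` at `g`. -/
def Sec.ofPt {T : Sch k} {b : T ⟶ S.A} (g : T ⟶ S.G) (w : b = g ≫ S.q) (v : Fn T ⊗[k] M.V) :
    Sec M b :=
  ⟨tr M (torsor.fst b ≫ g) (torsor.snd b) (ptPull M.V (torsor.fst b) v), fun p p' h => by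
    have h0 : (torsor.fst b ≫ g) ≫ S.q = torsor.snd b ≫ S.q := by
      rw [← torsor.w, Category.assoc, w]
    have h1 : (p ≫ torsor.snd b) ≫ S.q = (p' ≫ torsor.snd b) ≫ S.q := by
      simp only [Category.assoc, ← torsor.w, reassoc_of% h]
    rw [ptPull_tr _ _ h0, ptPull_tr _ _ h0, tr_tr _ _ h1, ← ptPull_comp, ← ptPull_comp,
      ← Category.assoc, ← Category.assoc, h]
    rw [Category.assoc, Category.assoc, Category.assoc, ← torsor.w, ← w]⟩

lemma Sec.eval_ofPt {T T' : Sch k} {b : T ⟶ S.A} (g : T ⟶ S.G) (w : b = g ≫ S.q)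
    (v : Fn T ⊗[k] M.V) (t : T' ⟶ T) (g' : T' ⟶ S.G) (w' : t ≫ b = g' ≫ S.q) :
    (Sec.ofPt M g w v).eval t g' w' = tr M (t ≫ g) g' (ptPull M.V t v) := by
  have h0 : (torsor.fst b ≫ g) ≫ S.q = torsor.snd b ≫ S.q := by
    rw [← torsor.w, Category.assoc, w]
  rw [Sec.eval]
  simp only [Sec.ofPt, ptPull_tr _ _ h0, ← ptPull_comp, torsor.lift_fst, torsor.lift_snd,
    torsor.lift_fst_assoc]

variable (M) in
/-- Evaluation at `g` as an isomorphism. -/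
def secEquiv {T : Sch k} {b : T ⟶ S.A} (g : T ⟶ S.G) (w : b = g ≫ S.q) :
    Sec M b ≃ₗ[Fn T] Fn T ⊗[k] M.V where
  toFun s := s.eval (𝟙 T) g (by rw [Category.id_comp, w])
  map_add' s s' := s.eval_add _ _ _ _
  map_smul' c s := by rw [Sec.eval_smul]; rfl
  invFun := Sec.ofPt M g w
  left_inv s := Sec.eval_injective (g := g) (by rw [Category.id_comp, w]) (by
    rw [Sec.eval_ofPt, ptPull_id, Category.id_comp, tr_self]
    rfl)
  right_inv v := by
    change (Sec.ofPt M g w v).eval (𝟙 T) g _ = v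
    rw [Sec.eval_ofPt, ptPull_id, Category.id_comp, tr_self]
    rfl

end

end AffExt

/-! ### Descent of modules along flat ring maps, in terms of coactions. -/

namespace AffExt

noncomputable section

/-! ### Flat descent for modules -/

/-- `M` is the kernel of `c - (1 ⊗ ·)`, and flatness keeps this exact after tensoring with `B`.
Coassociativity then says that `c` takes values in `B ⊗ M ⊆ B ⊗ N`, and the counit says that `c` is
inverse to the multiplication `B ⊗ M → N`. -/
theorem isBaseChange_of_coaction {R B N : Type*} [CommRing R] [CommRing B] [Algebra R B]
    [Module.Flat R B] [AddCommGroup N] [Module R N] [Module B N] [IsScalarTower R B N]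
    (c : N →ₗ[B] B ⊗[R] N) (counit : ∀ n, LinearMap.liftBaseChange B LinearMap.id (c n) = n)
    (coassoc : ∀ n, LinearMap.lTensor B (c.restrictScalars R) (c n) =
      LinearMap.lTensor B (TensorProduct.mk R B N 1) (c n))
    (M : Submodule R N) (hM : ∀ n, n ∈ M ↔ c n = 1 ⊗ₜ n) : IsBaseChange B M.subtype := by
  let f : N →ₗ[R] B ⊗[R] N := c.restrictScalars R - TensorProduct.mk R B N 1
  have hf : Function.Exact M.subtype f := fun n => by
    simp [f, sub_eq_zero, hM]
  have hex := Module.Flat.lTensor_exact B hf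
  have h1 : ∀ x, c (LinearMap.liftBaseChange B M.subtype x) = LinearMap.lTensor B M.subtype x := by
    intro x
    induction x using TensorProduct.induction_on with
    | zero => simp only [map_zero]
    | tmul b m =>
      rw [LinearMap.liftBaseChange_tmul, map_smul, LinearMap.lTensor_tmul, Submodule.subtype_apply,
        (hM _).1 m.2, TensorProduct.smul_tmul', smul_eq_mul, mul_one]
    | add x y hx hy => simp only [map_add, hx, hy]
  have h2 : ∀ x, (LinearMap.liftBaseChange B LinearMap.id (LinearMap.lTensor B M.subtype x) : N) =
      LinearMap.liftBaseChange B M.subtype x := by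
    intro x
    induction x using TensorProduct.induction_on with
    | zero => simp only [map_zero]
    | tmul b m => simp
    | add x y hx hy => simp only [map_add, hx, hy]
  have inj : Function.Injective (LinearMap.lTensor B M.subtype) :=
    Module.Flat.lTensor_preserves_injective_linearMap _ M.subtype_injective
  have hb : Function.Bijective (LinearMap.liftBaseChange B M.subtype) := by
    refine ⟨fun x y h => inj (by rw [← h1, ← h1, h]), fun n => ?_⟩
    -- Coassociativity gives `x ∈ B ⊗ M` with image `c n`; its product in `N` is `n` by the counit.
    obtain ⟨x, hx⟩ := (hex (c n)).1 (by
      rw [LinearMap.lTensor_sub, LinearMap.sub_apply, coassoc, sub_self])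
    exact ⟨x, by rw [← h2, hx, counit]⟩
  refine IsBaseChange.of_equiv (LinearEquiv.ofBijective _ hb) fun m => ?_
  change LinearMap.liftBaseChange B M.subtype (1 ⊗ₜ m) = _
  rw [LinearMap.liftBaseChange_tmul, one_smul]

variable {k : Type u} [Field k]

lemma isPushout_fn {Q X Y T : Sch k} {p : Q ⟶ X} {p' : Q ⟶ Y} {f : X ⟶ T} {g : Y ⟶ T}
    (h : IsPullback p p' f g) [IsAffine T.left] [IsAffine X.left] [IsAffine Y.left]
    [Algebra (Fn T) (Fn X)] [Algebra (Fn T) (Fn Y)] [Algebra (Fn T) (Fn Q)] [Algebra (Fn X) (Fn Q)]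
    [Algebra (Fn Y) (Fn Q)] [IsScalarTower (Fn T) (Fn X) (Fn Q)]
    [IsScalarTower (Fn T) (Fn Y) (Fn Q)]
    (hf : ∀ c, algebraMap (Fn T) (Fn X) c = Fn.pull f c)
    (hg : ∀ c, algebraMap (Fn T) (Fn Y) c = Fn.pull g c)
    (hp : ∀ c, algebraMap (Fn X) (Fn Q) c = Fn.pull p c)
    (hp' : ∀ c, algebraMap (Fn Y) (Fn Q) c = Fn.pull p' c) :
    Algebra.IsPushout (Fn T) (Fn X) (Fn Y) (Fn Q) := by
  have h' : IsPullback p.left p'.left f.left g.left := h.map (Over.forget _)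
  have h1 := isPushout_appTop_of_isPullback h'
  rw [← CommRingCat.isPushout_iff_isPushout]
  have ef : CommRingCat.ofHom (algebraMap (Fn T) (Fn X)) = f.left.appTop :=
    CommRingCat.hom_ext (RingHom.ext hf)
  have eg : CommRingCat.ofHom (algebraMap (Fn T) (Fn Y)) = g.left.appTop :=
    CommRingCat.hom_ext (RingHom.ext hg)
  have ep : CommRingCat.ofHom (algebraMap (Fn X) (Fn Q)) = p.left.appTop :=
    CommRingCat.hom_ext (RingHom.ext hp)
  have ep' : CommRingCat.ofHom (algebraMap (Fn Y) (Fn Q)) = p'.left.appTop :=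
    CommRingCat.hom_ext (RingHom.ext hp')
  rw [ef, eg, ep, ep']
  exact h1

variable {S : AffineExtension k}

/-- The projection `Y ×_A G ⟶ T ×_A G`. -/
def torsor.proj {T Y : Sch k} (b : T ⟶ S.A) (y : Y ⟶ T) : torsor (y ≫ b) ⟶ torsor b :=
  torsor.lift (torsor.fst (y ≫ b) ≫ y) (torsor.snd (y ≫ b)) (by rw [Category.assoc, torsor.w])

@[simp]
lemma torsor.proj_fst {T Y : Sch k} (b : T ⟶ S.A) (y : Y ⟶ T) :
    torsor.proj b y ≫ torsor.fst b = torsor.fst (y ≫ b) ≫ y := torsor.lift_fst _ _ _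

@[simp]
lemma torsor.proj_snd {T Y : Sch k} (b : T ⟶ S.A) (y : Y ⟶ T) :
    torsor.proj b y ≫ torsor.snd b = torsor.snd (y ≫ b) := torsor.lift_snd _ _ _

lemma torsor.isPullback_proj {T Y : Sch k} (b : T ⟶ S.A) (y : Y ⟶ T) :
    IsPullback (torsor.proj b y) (torsor.fst (y ≫ b)) (torsor.fst b) y := by
  refine IsPullback.of_right (h₁₂ := torsor.snd b) (h₂₂ := b) (v₁₃ := S.q) ?_ ?_
    (torsor.isPullback b).flip
  · rw [torsor.proj_snd]
    exact (torsor.isPullback (y ≫ b)).flip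
  · exact torsor.proj_fst b y

/-- The torsor over `Y` is `Y ×_T (T ×_A G)`, a fibre product of affine schemes, so its functions
are a tensor product. With `Y` the torsor itself, respectively its self-product over `T`, this
describes vectors on the double and triple fibre products, where a coaction and its coassociativity
live. -/
lemma torsor_baseChange {T Y : Sch k} (b : T ⟶ S.A) (y : Y ⟶ T) [IsAffine T.left] [IsAffine Y.left]
    [Algebra (Fn T) (Fn Y)] [IsScalarTower k (Fn T) (Fn Y)]
    (hy : ∀ c, algebraMap (Fn T) (Fn Y) c = Fn.pull y c) (V : Type u) [AddCommGroup V]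
    [Module k V] :
    ∃ e : Fn (torsor b) ⊗[Fn T] (Fn Y ⊗[k] V) ≃+ Fn (torsor (y ≫ b)) ⊗[k] V,
      ∀ β ξ, e (β ⊗ₜ ξ) = Fn.pull (torsor.proj b y) β • ptPull V (torsor.fst (y ≫ b)) ξ := by
  have := torsor.isAffine b
  have := torsor.isAffine (y ≫ b)
  let : Algebra (Fn (torsor b)) (Fn (torsor (y ≫ b))) :=
    (Fn.pull (torsor.proj b y)).toRingHom.toAlgebra
  let : Algebra (Fn T) (Fn (torsor (y ≫ b))) :=
    (Fn.pull (torsor.fst (y ≫ b) ≫ y)).toRingHom.toAlgebra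
  have : IsScalarTower (Fn T) (Fn Y) (Fn (torsor (y ≫ b))) := by
    refine IsScalarTower.of_algebraMap_eq fun c => ?_
    rw [hy]
    exact Fn.pull_comp _ _ c
  have : IsScalarTower (Fn T) (Fn (torsor b)) (Fn (torsor (y ≫ b))) := by
    refine IsScalarTower.of_algebraMap_eq fun c => ?_
    change Fn.pull _ c = Fn.pull _ (Fn.pull _ c)
    rw [← Fn.pull_comp, torsor.proj_fst]
  have : IsScalarTower k (Fn (torsor b)) (Fn (torsor (y ≫ b))) :=
    IsScalarTower.of_algebraMap_eq fun c => ((Fn.pull (torsor.proj b y)).commutes c).symm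
  have hP := isPushout_fn (torsor.isPullback_proj b y) (fun _ => rfl) hy (fun _ => rfl)
    (fun _ => rfl)
  let e0 : Fn (torsor b) ⊗[Fn T] Fn Y ≃ₗ[Fn (torsor b)] Fn (torsor (y ≫ b)) := hP.out.equiv
  let e1 := TensorProduct.AlgebraTensorModule.congr
    (R := k) (A := Fn (torsor b)) e0 (LinearEquiv.refl k V)
  let e2 := TensorProduct.AlgebraTensorModule.assoc k (Fn T) (Fn (torsor b)) (Fn (torsor b)) (Fn Y) V
  refine ⟨(e2.symm.trans e1).toAddEquiv, fun β ξ => ?_⟩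
  change e1 (e2.symm (β ⊗ₜ ξ)) = _
  induction ξ using TensorProduct.induction_on with
  | zero => simp only [TensorProduct.tmul_zero, map_zero, smul_zero]
  | tmul c v =>
    rw [TensorProduct.AlgebraTensorModule.assoc_symm_tmul,
      TensorProduct.AlgebraTensorModule.congr_tmul, IsBaseChange.equiv_tmul, ptPull_tmul,
      TensorProduct.smul_tmul']
    rfl
  | add x z hx hz => simp only [TensorProduct.tmul_add, map_add, smul_add, hx, hz]

end

end AffExt

/-! ### Equivariant functions as a twisted form of `V`. -/

namespace AffExt

noncomputable section

variable {k : Type u} [Field k] {S : AffineExtension k} (M : FinRep S.H)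

/-- The torsor of `torsor.fst b ≫ b` is the self-product of `torsor b` over `T`, so its two
projections to `torsor b` are the universal pair of lifts, and equivariance for this pair implies
all the others by pullback. -/
lemma mem_secSub_iff {T : Sch k} (b : T ⟶ S.A) (s : Fn (torsor b) ⊗[k] M.V) :
    s ∈ secSub M b ↔ tr M (torsor.snd (torsor.fst b ≫ b))
      (torsor.fst (torsor.fst b ≫ b) ≫ torsor.snd b) (ptPull M.V (torsor.proj b (torsor.fst b)) s) =
        ptPull M.V (torsor.fst (torsor.fst b ≫ b)) s := by
  constructor
  · intro h
    rw [h (torsor.proj b (torsor.fst b)) (torsor.fst (torsor.fst b ≫ b)) (torsor.proj_fst _ _),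
      torsor.proj_snd]
  · intro h T' p p' e
    let z : T' ⟶ torsor (torsor.fst b ≫ b) := torsor.lift p' (p ≫ torsor.snd b) (by
      rw [Category.assoc, ← torsor.w, reassoc_of% e])
    have h1 := congrArg (ptPull M.V z) h
    have hz : z ≫ torsor.proj b (torsor.fst b) = p := by
      refine torsor.hom_ext ?_ ?_ <;> simp [z, e]
    rw [ptPull_tr, ← ptPull_comp, ← ptPull_comp, hz] at h1
    · simp only [z, torsor.lift_fst, torsor.lift_snd, torsor.lift_fst_assoc] at h1
      exact h1.symm
    · rw [← torsor.w, Category.assoc, ← torsor.w]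

lemma torsor.flat {T : Sch k} [IsAffine T.left] (b : T ⟶ S.A) :
    Module.FaithfullyFlat (Fn T) (Fn (torsor b)) := by
  have := torsor.isAffine b
  exact (Flat.flat_and_surjective_iff_faithfullyFlat_of_isAffine (torsor.fst b).left).1
    ⟨(torsor.isFpqc b).1, (torsor.isFpqc b).2.1⟩

/-- The module of equivariant functions is a form of `V`. -/
theorem sec_isBaseChange {T : Sch k} [IsAffine T.left] (b : T ⟶ S.A) :
    IsBaseChange (Fn (torsor b)) (secSub M b).subtype := by
  have := torsor.isAffine b
  have := torsor.flat b
  let b2 := torsor.fst b ≫ b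
  have := torsor.isAffine b2
  have w2 : torsor.snd b2 ≫ S.q = (torsor.fst b2 ≫ torsor.snd b) ≫ S.q := by
    rw [← torsor.w b2, Category.assoc, ← torsor.w b]
  obtain ⟨e, he⟩ := torsor_baseChange b (torsor.fst b) (fun _ => rfl) M.V
  let pr : torsor b2 ⟶ torsor b := torsor.proj b (torsor.fst b)
  have hprf : pr ≫ torsor.fst b = torsor.fst b2 ≫ torsor.fst b := torsor.proj_fst _ _
  have hprs : pr ≫ torsor.snd b = torsor.snd b2 := torsor.proj_snd _ _
  have hprf' : ∀ {Z : Sch k} (p : Z ⟶ torsor b2),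
      (p ≫ pr) ≫ torsor.fst b = (p ≫ torsor.fst b2) ≫ torsor.fst b := fun p => by
    rw [Category.assoc, hprf, Category.assoc]
  have hprs' : ∀ {Z : Sch k} (p : Z ⟶ torsor b2), (p ≫ pr) ≫ torsor.snd b = p ≫ torsor.snd b2 :=
    fun p => by rw [Category.assoc, hprs]
  -- The coaction: the value of `s` at the lift `pr`, rewritten by `tr` in the trivialization of the
  -- other lift. The fixed vectors of the coaction are exactly the equivariant functions.
  let c0 : Fn (torsor b) ⊗[k] M.V → Fn (torsor b2) ⊗[k] M.V := fun s =>
    tr M (torsor.snd b2) (torsor.fst b2 ≫ torsor.snd b) (ptPull M.V pr s)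
  have he_smul : ∀ (β : Fn (torsor b)) z, e (β • z) = Fn.pull pr β • e z := by
    intro β z
    induction z using TensorProduct.induction_on with
    | zero => simp only [map_zero, smul_zero]
    | tmul a x => rw [TensorProduct.smul_tmul', he, he, smul_eq_mul, map_mul, mul_smul]
    | add x y hx hy => simp only [map_add, smul_add, hx, hy]
  let c : Fn (torsor b) ⊗[k] M.V →ₗ[Fn (torsor b)]
      Fn (torsor b) ⊗[Fn T] (Fn (torsor b) ⊗[k] M.V) :=
    { toFun := fun s => e.symm (c0 s)
      map_add' := fun s s' => by simp only [c0, map_add]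
      map_smul' := fun β s => by
        apply e.injective
        rw [RingHom.id_apply, he_smul, e.apply_symm_apply, e.apply_symm_apply]
        simp only [c0, ptPull_smul, map_smul] }
  have hec : ∀ s, e (c s) = c0 s := fun s => e.apply_symm_apply _
  have h1 : ∀ s, e (1 ⊗ₜ s) = ptPull M.V (torsor.fst b2) s := fun s => by
    rw [he, map_one, one_smul]
  refine isBaseChange_of_coaction c ?_ ?_ _ ?_
  · intro s
    -- Multiplication corresponds to pullback along the diagonal, where the two lifts coincide and
    -- `tr` is the identity.
    let Δ : torsor b ⟶ torsor b2 := torsor.lift (𝟙 _) (torsor.snd b) (by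
      rw [Category.id_comp, ← torsor.w])
    have hΔ1 : Δ ≫ pr = 𝟙 _ := torsor.hom_ext
      (by rw [Category.assoc, hprf, torsor.lift_fst_assoc, Category.id_comp])
      (by rw [Category.assoc, hprs, torsor.lift_snd, Category.id_comp])
    have hΔ : ∀ z, LinearMap.liftBaseChange (Fn (torsor b)) (LinearMap.id (R := Fn T)) z =
        ptPull M.V Δ (e z) := by
      intro z
      induction z using TensorProduct.induction_on with
      | zero => simp only [map_zero]
      | tmul a x =>
        rw [he, ptPull_smul, ← Fn.pull_comp, ← ptPull_comp, torsor.lift_fst, hΔ1, ptPull_id,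
          Fn.pull_id, LinearMap.liftBaseChange_tmul, LinearMap.id_apply]
      | add x y hx hy => simp only [map_add, hx, hy]
    rw [hΔ, hec, ptPull_tr _ _ w2, ← ptPull_comp, hΔ1, torsor.lift_snd, torsor.lift_fst_assoc,
      Category.id_comp, tr_self, ptPull_id]
    rfl
  · intro s
    -- Coassociativity is compared on the triple fibre product, which is the torsor over `torsor b2`
    -- for `y3`; there it becomes the cocycle condition `tr_tr`.
    let y3 : torsor b2 ⟶ T := torsor.fst b2 ≫ torsor.fst b
    let : Algebra (Fn T) (Fn (torsor b2)) := (Fn.pull y3).toRingHom.toAlgebra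
    have : IsScalarTower k (Fn T) (Fn (torsor b2)) :=
      IsScalarTower.of_algebraMap_eq fun c => ((Fn.pull y3).commutes c).symm
    obtain ⟨e2, he2⟩ := torsor_baseChange b y3 (fun _ => rfl) M.V
    let e' : Fn (torsor b) ⊗[Fn T] (Fn (torsor b) ⊗[k] M.V) ≃ₗ[Fn T] Fn (torsor b2) ⊗[k] M.V :=
      { e with
        map_smul' := fun r z => by
          change e (r • z) = r • e z
          rw [← algebraMap_smul (Fn (torsor b)) r z, he_smul,
            ← algebraMap_smul (Fn (torsor b2)) r (e z), torsor.algebraMap_eq, ← Fn.pull_comp,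
            torsor.proj_fst]
          rfl }
    have hinj : Function.Injective fun z => e2 (LinearMap.lTensor (Fn (torsor b)) e'.toLinearMap z) :=
      e2.injective.comp (LinearEquiv.lTensor (Fn (torsor b)) e').injective
    apply hinj
    have hy3 : y3 ≫ b = torsor.fst b2 ≫ b2 := Category.assoc _ _ _
    have hq3 : (torsor.fst (y3 ≫ b) ≫ torsor.snd b2) ≫ S.q = torsor.snd (y3 ≫ b) ≫ S.q :=
      (torsor.comp_w _).trans ((congrArg (torsor.fst (y3 ≫ b) ≫ ·) hy3.symm).trans (torsor.w _))
    have hq3' : (torsor.fst (y3 ≫ b) ≫ torsor.fst b2 ≫ torsor.snd b) ≫ S.q =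
        torsor.snd (y3 ≫ b) ≫ S.q :=
      (congrArg (· ≫ S.q) (Category.assoc _ _ _)).symm.trans ((torsor.comp_w _).trans
        ((Category.assoc _ _ _).trans
          ((congrArg (torsor.fst (y3 ≫ b) ≫ ·) hy3.symm).trans (torsor.w _))))
    have hq2 : (torsor.fst (y3 ≫ b) ≫ torsor.fst b2) ≫ b2 = torsor.snd (y3 ≫ b) ≫ S.q :=
      (Category.assoc _ _ _).trans
        ((congrArg (torsor.fst (y3 ≫ b) ≫ ·) hy3.symm).trans (torsor.w _))
    have hq1 : (torsor.fst (y3 ≫ b) ≫ pr) ≫ b2 = torsor.snd (y3 ≫ b) ≫ S.q := by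
      rw [← hq2]
      exact (Category.assoc _ _ _).trans ((congrArg (torsor.fst (y3 ≫ b) ≫ ·)
        (by simp only [b2, reassoc_of% hprf])).trans (Category.assoc _ _ _).symm)
    -- Two projections from triples to pairs: both keep the new lift, paired by `p1` with the `pr`
    -- lift of `torsor b2` and by `p2` with its `torsor.fst` lift.
    let p1 : torsor (y3 ≫ b) ⟶ torsor b2 := torsor.lift (torsor.fst _ ≫ pr) (torsor.snd _) hq1
    let p2 : torsor (y3 ≫ b) ⟶ torsor b2 :=
      torsor.lift (torsor.fst _ ≫ torsor.fst b2) (torsor.snd _) hq2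
    have hp1 : p1 ≫ pr = torsor.proj b y3 := torsor.hom_ext
      (by
        rw [hprf', torsor.lift_fst, hprf', torsor.proj_fst]
        exact Category.assoc _ _ _)
      (by rw [hprs', torsor.lift_snd, torsor.proj_snd])
    have hp2 : p2 ≫ pr = torsor.proj b y3 := torsor.hom_ext
      (by
        rw [hprf', torsor.lift_fst, torsor.proj_fst]
        exact Category.assoc _ _ _)
      (by rw [hprs', torsor.lift_snd, torsor.proj_snd])
    have hc : ∀ z, e2 (LinearMap.lTensor _ e'.toLinearMap
          (LinearMap.lTensor _ (c.restrictScalars (Fn T)) z)) =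
        tr M (torsor.fst _ ≫ torsor.snd b2) (torsor.fst _ ≫ torsor.fst b2 ≫ torsor.snd b)
          (ptPull M.V p1 (e z)) := by
      intro z
      induction z using TensorProduct.induction_on with
      | zero => simp only [map_zero]
      | tmul a x =>
        rw [LinearMap.lTensor_tmul, LinearMap.lTensor_tmul, he2, he, ptPull_smul, ← Fn.pull_comp,
          hp1, map_smul]
        congr 1
        change ptPull _ _ (e (c x)) = _
        rw [hec, ptPull_tr _ _ w2, ← ptPull_comp, ← ptPull_comp, torsor.lift_fst]
      | add x y hx hy => simp only [map_add, hx, hy]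
    have hu : ∀ z, e2 (LinearMap.lTensor _ e'.toLinearMap
          (LinearMap.lTensor _ (TensorProduct.mk (Fn T) (Fn (torsor b)) _ 1) z)) =
          ptPull M.V p2 (e z) := by
      intro z
      induction z using TensorProduct.induction_on with
      | zero => simp only [map_zero]
      | tmul a x =>
        rw [LinearMap.lTensor_tmul, LinearMap.lTensor_tmul, he2, he, ptPull_smul, ← Fn.pull_comp,
          hp2]
        congr 1
        change ptPull _ _ (e (1 ⊗ₜ x)) = _
        rw [h1, ← ptPull_comp, ← ptPull_comp, torsor.lift_fst]
      | add x y hx hy => simp only [map_add, hx, hy]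
    change e2 (LinearMap.lTensor _ e'.toLinearMap _) = e2 (LinearMap.lTensor _ e'.toLinearMap _)
    rw [hc, hu, hec, ptPull_tr _ _ w2, ptPull_tr _ _ w2, ← ptPull_comp, ← ptPull_comp, hp1, hp2]
    simp only [p1, p2, torsor.lift_snd, torsor.lift_fst_assoc, Category.assoc]
    rw [hprs, tr_tr]
    · exact hq3.symm
    · exact hq3.trans hq3'.symm
  · intro s
    rw [mem_secSub_iff, ← e.injective.eq_iff, hec, h1]

end

end AffExt

/-! ### Zariski-local frames of equivariant functions. -/

namespace AffExt

noncomputable section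

/-! ### Local frames of equivariant functions -/

/-- The images of `Z` span `Kⁿ`, hence contain a basis of it. Preimages of this basis work, because
the determinant commutes with `f` and the determinant of a basis is a unit. -/
lemma exists_det_ne_zero {R K N : Type*} [CommRing R] [Field K] (f : R →+* K) [AddCommGroup N]
    [Module R N] {n : ℕ} (v : Module.Basis (Fin n) R N) (Z : Set N)
    (hZ : Submodule.span R Z = ⊤) : ∃ s : Fin n → Z, f (v.det fun i => (s i : N)) ≠ 0 := by
  let : Module R K := Module.compHom K f
  let φ : N →ₛₗ[f] (Fin n → K) :=
    { toFun := fun x i => f (v.repr x i)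
      map_add' := fun x y => by ext; simp
      map_smul' := fun c x => by ext; simp }
  have hspan : ⊤ ≤ Submodule.span K (φ '' Z) := by
    have h1 : ∀ x : N, φ x ∈ Submodule.span K (φ '' Z) := by
      intro x
      have hx : x ∈ Submodule.span R Z := hZ ▸ trivial
      induction hx using Submodule.span_induction with
      | mem x h => exact Submodule.subset_span ⟨x, h, rfl⟩
      | zero => rw [map_zero]; exact zero_mem _
      | add x y _ _ hx hy => rw [map_add]; exact add_mem hx hy
      | smul c x _ hx => rw [map_smulₛₗ]; exact Submodule.smul_mem _ _ hx
    rw [← (Pi.basisFun K (Fin n)).span_eq, Submodule.span_le]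
    rintro _ ⟨i, rfl⟩
    have h2 : Pi.basisFun K (Fin n) i = φ (v i) := ?_
    · rw [h2]
      exact h1 (v i)
    funext j
    by_cases hij : i = j
    · simp [φ, hij]
    · simp [φ, Ne.symm hij]
  let w := Module.Basis.ofSpan hspan
  have hw := Module.Basis.ofSpan_subset hspan
  have := Module.Finite.finite_basis w
  have := Fintype.ofFinite ((linearIndepOn_empty K id).extend (Set.empty_subset (φ '' Z)))
  have e := Fintype.equivFinOfCardEq ((Module.finrank_eq_card_basis w).symm.trans
    (by simp : Module.finrank K (Fin n → K) = n))
  let w' := w.reindex e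
  have hw' : ∀ i, ∃ z : Z, φ z = w' i := fun i => by
    obtain ⟨z, hz, h⟩ := hw ⟨e.symm i, rfl⟩
    exact ⟨⟨z, hz⟩, by rw [h, Module.Basis.reindex_apply]⟩
  choose s hs using hw'
  refine ⟨s, ?_⟩
  have h2 := ((Pi.basisFun K (Fin n)).isUnit_det w').ne_zero
  convert h2 using 1
  rw [Module.Basis.det_apply, Module.Basis.det_apply, RingHom.map_det]
  congr 1
  ext i j
  rw [RingHom.mapMatrix_apply, Matrix.map_apply, Module.Basis.toMatrix_apply,
    Module.Basis.toMatrix_apply, ← hs]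
  simp [φ]

lemma bijective_sum_of_isUnit_det {R N : Type*} [CommRing R] [AddCommGroup N]
    [Module R N] {n : ℕ} (v : Module.Basis (Fin n) R N) (s : Fin n → N) (h : IsUnit (v.det s)) :
    Function.Bijective fun c : Fin n → R => ∑ i, c i • s i := by
  obtain ⟨h1, h2⟩ := v.is_basis_iff_det.2 h
  have h3 := (Module.Basis.mk h1 h2.ge).equivFun.symm.bijective
  convert h3 using 2 with c
  simp [Module.Basis.equivFun_symm_apply]

variable {k : Type u} [Field k]

/-- The open subset where a function does not vanish. -/
def Fn.nonvanishing {T : Sch k} (c : Fn T) : T.left.Opens :=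
  T.left.basicOpen (U := ⊤) (show Γ(T.left, ⊤) from c)

lemma Fn.mem_nonvanishing_pull {T' T : Sch k} (f : T' ⟶ T) (c : Fn T) (x : T'.left) :
    x ∈ (Fn.pull f c).nonvanishing ↔ f.left x ∈ c.nonvanishing := by
  have h := Scheme.preimage_basicOpen_top f.left (show Γ(T.left, ⊤) from c)
  exact (SetLike.ext_iff.1 h x).symm

lemma Fn.isUnit_of_forall_mem {T : Sch k} (c : Fn T) (h : ∀ x, x ∈ c.nonvanishing) : IsUnit c :=
  T.left.toLocallyRingedSpace.toRingedSpace.isUnit_of_isUnit_germ ⊤ _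
    fun x hx => (Scheme.mem_basicOpen _ _ x hx).1 (h x)

lemma Fn.mem_nonvanishing_mul {T : Sch k} {c : Fn T} (hc : IsUnit c) (d : Fn T) (x : T.left) :
    x ∈ (c * d).nonvanishing ↔ x ∈ d.nonvanishing := by
  have h1 : (c * d).nonvanishing = c.nonvanishing ⊓ d.nonvanishing := Scheme.basicOpen_mul _ _ _
  have h2 : c.nonvanishing = ⊤ := Scheme.basicOpen_of_isUnit _ hc
  rw [h1, h2, top_inf_eq]

/-- Determinants are taken in a basis of `V` over `k`, so the matrix entries of a pulled back family
are the pullbacks of its entries. -/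
lemma ptPull_det {V : Type u} [AddCommGroup V] [Module k V] {n : ℕ} (v : Module.Basis (Fin n) k V)
    {T' T : Sch k} (f : T' ⟶ T) (s : Fin n → Fn T ⊗[k] V) :
    (v.baseChange (Fn T')).det (fun i => ptPull V f (s i)) =
      Fn.pull f ((v.baseChange (Fn T)).det s) := by
  change _ = (Fn.pull f).toRingHom _
  rw [Module.Basis.det_apply, Module.Basis.det_apply, RingHom.map_det]
  congr 1
  ext i j
  rw [RingHom.mapMatrix_apply, Matrix.map_apply, Module.Basis.toMatrix_apply,
    Module.Basis.toMatrix_apply]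
  change _ = Fn.pull f _
  generalize s j = x
  induction x using TensorProduct.induction_on with
  | zero => simp
  | tmul c e => simp [ptPull_tmul, Module.Basis.baseChange_repr_tmul]
  | add x y hx hy => simp only [map_add, Finsupp.add_apply, hx, hy]

/-- The inclusion of an open subscheme in a larger one. -/
def openSubLE {A : Sch k} {U W : A.left.Opens} (h : U ≤ W) : openSub U ⟶ openSub W :=
  Over.homMk (A.left.homOfLE h) (by simp [openSub])

@[simp]
lemma openSubLE_openIncl {A : Sch k} {U W : A.left.Opens} (h : U ≤ W) :
    openSubLE h ≫ openIncl W = openIncl U := by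
  ext : 1
  exact A.left.homOfLE_ι h

variable {S : AffineExtension k} (M : FinRep S.H)

lemma isUnit_tr {T : Sch k} (g g' : T ⟶ S.G) : IsUnit (tr M g g') :=
  (Group.isUnit (hdiff g g')).map (M.ρ T)

lemma sec_span {T : Sch k} [IsAffine T.left] (b : T ⟶ S.A) :
    Submodule.span (Fn (torsor b)) (secSub M b : Set (Fn (torsor b) ⊗[k] M.V)) = ⊤ := by
  rw [eq_top_iff]
  rintro x -
  obtain ⟨z, rfl⟩ := (sec_isBaseChange M b).equiv.surjective x
  induction z using TensorProduct.induction_on with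
  | zero => rw [map_zero]; exact zero_mem _
  | tmul c m =>
    rw [IsBaseChange.equiv_tmul]
    exact Submodule.smul_mem _ _ (Submodule.subset_span m.2)
  | add x y hx hy => rw [map_add]; exact add_mem hx hy

/-- Equivariant functions span all functions on the torsor over an affine neighbourhood `U0`, so
some `dim V` of them have a determinant `d` not vanishing at a chosen point above `x`. Changing the
lift multiplies `d` by a unit, so the locus `d ≠ 0` is the preimage of a subset of `U0`. That subset
is open, and over it the chosen functions form a basis at every lift. -/
theorem exists_sec_frame (x : S.A.left) : ∃ U : S.A.left.Opens, x ∈ U ∧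
    ∃ s : Fin (Module.finrank k M.V) → Sec M (openIncl U), ∀ {T : Sch k} (t : T ⟶ openSub U)
      (g : T ⟶ S.G) (w : t ≫ openIncl U = g ≫ S.q),
      Function.Bijective fun c : Fin (Module.finrank k M.V) → Fn T =>
        ∑ i, c i • (s i).eval t g w := by
  obtain ⟨U0, hU0, hx, -⟩ := exists_isAffineOpen_mem_and_subset (X := S.A.left) (x := x) (U := ⊤)
    trivial
  have hA : IsAffine (openSub U0).left := hU0
  let b0 := openIncl U0
  have hfl := torsor.isFpqc b0
  have := hfl.1; have := hfl.2.1; have := hfl.2.2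
  obtain ⟨y, hy⟩ := (torsor.fst b0).left.surjective (⟨x, hx⟩ : U0)
  let v := Module.finBasis k M.V
  let ev : Fn (torsor b0) →+* (torsor b0).left.residueField y :=
    ((torsor b0).left.Γevaluation y).hom
  obtain ⟨m, hm⟩ := exists_det_ne_zero ev
    (v.baseChange (Fn (torsor b0))) _ (sec_span M b0)
  let d : Fn (torsor b0) := (v.baseChange (Fn (torsor b0))).det fun i => (m i).1
  have hyd : y ∈ d.nonvanishing :=
    (Scheme.evaluation_ne_zero_iff_mem_basicOpen (U := ⊤) _ y trivial
      (show Γ((torsor b0).left, ⊤) from d)).1 hm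
  have hsat : ∀ z z' : (torsor b0).left, (torsor.fst b0).left z = (torsor.fst b0).left z' →
      z ∈ d.nonvanishing → z' ∈ d.nonvanishing := by
    intro z z' hz hzd
    -- Two points of the torsor with the same image come from one point of the scheme-theoretic
    -- self-product, where the two pullbacks of `d` can be compared as functions.
    obtain ⟨p, rfl, rfl⟩ := Scheme.Pullback.exists_preimage_pullback z z' hz
    let P : Sch k := Over.mk (Limits.pullback.fst (torsor.fst b0).left (torsor.fst b0).left ≫
      (torsor b0).hom)
    let a : P ⟶ torsor b0 := Over.homMk (Limits.pullback.fst _ _) rfl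
    let a' : P ⟶ torsor b0 := Over.homMk (Limits.pullback.snd _ _) (by
      change _ = Limits.pullback.fst _ _ ≫ (torsor b0).hom
      rw [← Over.w (torsor.fst b0), ← Category.assoc, ← Category.assoc, Limits.pullback.condition])
    have haa : a ≫ torsor.fst b0 = a' ≫ torsor.fst b0 := by
      ext : 1
      exact Limits.pullback.condition
    change a'.left p ∈ _
    change a.left p ∈ _ at hzd
    rw [← Fn.mem_nonvanishing_pull] at hzd ⊢
    -- Equivariance of the family turns the change of lift into the factor `det (tr ..)`, a unit
    -- because `tr` is the action of an element of the group `H(T)`.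
    have h1 : Fn.pull a' d = LinearMap.det (tr M (a ≫ torsor.snd b0) (a' ≫ torsor.snd b0)) *
        Fn.pull a d := by
      rw [← ptPull_det, ← ptPull_det, ← Module.Basis.det_comp]
      congr 1
      funext i
      exact (m i).2 a a' haa
    rw [h1, Fn.mem_nonvanishing_mul]
    · exact hzd
    · exact LinearMap.isUnit_det _ (isUnit_tr M _ _)
  let U1 : Set (openSub U0).left := (torsor.fst b0).left '' d.nonvanishing
  have hpre : (torsor.fst b0).left ⁻¹' U1 = d.nonvanishing := by
    ext z
    constructor
    · rintro ⟨z', hz', h⟩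
      exact hsat z' z h hz'
    · exact fun h => ⟨z, h, rfl⟩
  have hU1 : IsOpen U1 := by
    -- A faithfully flat quasi-compact morphism is a topological quotient map, so openness may be
    -- tested on the preimage.
    rw [← (Flat.isQuotientMap_of_surjective (torsor.fst b0).left).isOpen_preimage, hpre]
    exact d.nonvanishing.isOpen
  let U : S.A.left.Opens := U0.ι ''ᵁ ⟨U1, hU1⟩
  have hUle : U ≤ U0 := by
    rintro _ ⟨z, -, rfl⟩
    exact z.2
  refine ⟨U, ⟨⟨x, hx⟩, ⟨y, hyd, hy⟩, rfl⟩, fun i => Sec.pull (M := M) (b := b0) ⟨(m i).1, (m i).2⟩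
    (openSubLE hUle) (openSubLE_openIncl hUle), fun {T} t g w => ?_⟩
  simp only [Sec.eval_pull]
  let p : T ⟶ torsor b0 := torsor.lift (t ≫ openSubLE hUle) g
    (by rw [Category.assoc, openSubLE_openIncl, w])
  change Function.Bijective fun c : Fin (Module.finrank k M.V) → Fn T =>
        ∑ i, c i • ptPull M.V p (m i).1
  refine bijective_sum_of_isUnit_det (v.baseChange (Fn T)) _ ?_
  rw [ptPull_det]
  -- A point of `T` lying over `U` is sent by the lift into the locus `d ≠ 0`, whence the pulled
  -- back determinant vanishes nowhere.
  refine Fn.isUnit_of_forall_mem _ fun z => ?_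
  rw [Fn.mem_nonvanishing_pull]
  have h1 : p.left z ∈ (torsor.fst b0).left ⁻¹' U1 := by
    change (torsor.fst b0).left (p.left z) ∈ U1
    have h2 : (torsor.fst b0).left (p.left z) = (openSubLE hUle).left (t.left z) := by
      have h3 : p ≫ torsor.fst b0 = t ≫ openSubLE hUle := torsor.lift_fst _ _ _
      exact congrArg (fun f => f.left z) h3
    rw [h2]
    obtain ⟨z1, hz1, e⟩ := (t.left z : U).2
    have h4 : U0.ι ((openSubLE hUle).left (t.left z)) = U.ι (t.left z) :=
      congrArg (fun f => f (t.left z)) (S.A.left.homOfLE_ι hUle)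
    have h5 : (openSubLE hUle).left (t.left z) = z1 := by
      apply U0.ι.injective
      rw [h4]
      exact e.symm
    rw [h5]
    exact hz1
  rw [hpre] at h1
  exact h1

/-- Here `b` need not lift to `G` over `T`. Coefficients exist and are unique over the torsor, where
there is a lift; uniqueness makes them descend to `T`. -/
theorem exists_sec_frame_pull (x : S.A.left) : ∃ U : S.A.left.Opens, x ∈ U ∧
    ∃ s : Fin (Module.finrank k M.V) → Sec M (openIncl U), ∀ {T : Sch k} (t : T ⟶ openSub U)
      {b : T ⟶ S.A} (hb : t ≫ openIncl U = b),
      Function.Bijective fun c : Fin (Module.finrank k M.V) → Fn T =>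
        ∑ i, c i • (s i).pull t hb := by
  obtain ⟨U, hx, s, hs⟩ := exists_sec_frame M x
  refine ⟨U, hx, s, fun {T} t {b} hb => ?_⟩
  have hf := torsor.isFpqc b
  have hev : ∀ (c : Fin (Module.finrank k M.V) → Fn T) {T' : Sch k} (t' : T' ⟶ T) (g : T' ⟶ S.G)
      (w : t' ≫ b = g ≫ S.q), (∑ i, c i • (s i).pull t hb : Sec M b).eval t' g w =
        ∑ i, Fn.pull t' (c i) • (s i).eval (t' ≫ t) g (by rw [Category.assoc, hb, w]) := by
    intro c T' t' g w
    have : ∀ (J : Finset (Fin (Module.finrank k M.V))),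
        (∑ i ∈ J, c i • (s i).pull t hb : Sec M b).eval t' g w =
        ∑ i ∈ J, Fn.pull t' (c i) • (s i).eval (t' ≫ t) g (by rw [Category.assoc, hb, w]) := by
      intro J
      induction J using Finset.cons_induction with
      | empty => simp only [Finset.sum_empty]; exact Sec.eval_zero _ _ _
      | cons i J hi h =>
        rw [Finset.sum_cons, Finset.sum_cons, Sec.eval_add, h, Sec.eval_smul, Sec.eval_pull]
    exact this Finset.univ
  have hw : (torsor.fst b ≫ t) ≫ openIncl U = torsor.snd b ≫ S.q := by
    rw [Category.assoc, hb, torsor.w]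
  constructor
  · intro c c' h
    have h1 := congrArg (fun z : Sec M b => z.eval (torsor.fst b) (torsor.snd b) (torsor.w b)) h
    simp only [hev] at h1
    have h2 := (hs (torsor.fst b ≫ t) (torsor.snd b) hw).1 h1
    funext i
    exact hf.pull_injective (congrFun h2 i)
  · intro z
    obtain ⟨c, hc⟩ := (hs (torsor.fst b ≫ t) (torsor.snd b) hw).2 z.1
    have hc' : ∀ i, ∃ d : Fn T, Fn.pull (torsor.fst b) d = c i := by
      refine fun i => hf.exists_fn (c i) fun {T''} a a' e => ?_
      have hwa : (a ≫ torsor.fst b ≫ t) ≫ openIncl U = (a' ≫ torsor.snd b) ≫ S.q := by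
        rw [reassoc_of% e, Category.assoc, Category.assoc, Category.assoc, ← torsor.w, hb]
      have hwa0 : (a ≫ torsor.fst b ≫ t) ≫ openIncl U = (a ≫ torsor.snd b) ≫ S.q := by
        rw [Category.assoc, Category.assoc, Category.assoc, ← torsor.w, hb]
      -- The two pullbacks of the coefficients express the same vector in the same frame, both
      -- evaluated at the lift `a' ≫ torsor.snd b`, and hence agree.
      refine congrFun ((hs (a ≫ torsor.fst b ≫ t) (a' ≫ torsor.snd b) hwa).1
        (a₁ := fun i => Fn.pull a (c i)) (a₂ := fun i => Fn.pull a' (c i)) ?_) i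
      have h1 := z.2 a a' e
      rw [← hc] at h1
      simp only [map_sum, ptPull_smul, map_smul, Sec.ptPull_eval] at h1
      simp only [reassoc_of% e]
      rw [h1]
      refine Finset.sum_congr rfl fun i _ => ?_
      refine congrArg (Fn.pull a (c i) • ·) (Eq.trans ?_
        (Sec.eval_tr (s i) (a ≫ torsor.fst b ≫ t) _ _ hwa0 hwa))
      simp only [reassoc_of% e]
    choose d hd using hc'
    refine ⟨d, Subtype.ext ?_⟩
    rw [Sec.val_eq_eval, hev, ← hc]
    simp only [hd]

end

end AffExt

/-! ### Bundle structure and `G`-action on a quotient `G ×^H V`. -/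

namespace AffExt

noncomputable section

variable {k : Type u} [Field k] {S : AffineExtension k} {M : FinRep S.H} {X : Sch k}

namespace InducedSpace

/-! ### Points of an induced space -/

lemma κ_eq_iff (P : InducedSpace S M X) {T : Sch k} (g g' : T ⟶ S.G) (v v' : Fn T ⊗[k] M.V) :
    P.κ g v = P.κ g' v' ↔ g ≫ S.q = g' ≫ S.q ∧ v' = tr M g g' v := by
  rw [P.eq_iff]
  constructor
  · rintro ⟨h, hg, hv⟩
    refine ⟨by rw [hg, q_mul_inv], ?_⟩
    rw [tr, hdiff_eq' hg, hv]
  · rintro ⟨w, hv⟩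
    refine ⟨hdiff g g', ?_, hv⟩
    rw [hdiff_j w]
    group

lemma κ_tr (P : InducedSpace S M X) {T : Sch k} {g g' : T ⟶ S.G} (w : g ≫ S.q = g' ≫ S.q)
    (v : Fn T ⊗[k] M.V) : P.κ g' (tr M g g' v) = P.κ g v :=
  ((P.κ_eq_iff _ _ _ _).2 ⟨w, rfl⟩).symm

lemma κ_injective (P : InducedSpace S M X) {T : Sch k} (g : T ⟶ S.G) :
    Function.Injective (P.κ g) := by
  intro v v' h
  have := ((P.κ_eq_iff _ _ _ _).1 h).2
  rw [tr_self] at this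
  exact this.symm

/-- The universal property of the quotient, relative to a point `x`: a natural rule on
representatives `[g, v]` of pullbacks of `x`, independent of the representative, comes from a
morphism on `T`. The rule is descended from one fpqc-local representative. -/
lemma exists_desc (P : InducedSpace S M X) {Y T : Sch k} (x : T ⟶ X)
    (φ : ∀ {T' : Sch k} (_ : T' ⟶ T) (_ : T' ⟶ S.G) (_ : Fn T' ⊗[k] M.V), T' ⟶ Y)
    (nat : ∀ {T'' T' : Sch k} (a : T'' ⟶ T') (f : T' ⟶ T) (g : T' ⟶ S.G) (v : Fn T' ⊗[k] M.V),
      φ (a ≫ f) (a ≫ g) (ptPull M.V a v) = a ≫ φ f g v)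
    (inv : ∀ {T' : Sch k} (f : T' ⟶ T) (g g' : T' ⟶ S.G) (v : Fn T' ⊗[k] M.V),
      g ≫ S.q = g' ≫ S.q → φ f g' (tr M g g' v) = φ f g v) :
    ∃ y : T ⟶ Y, ∀ {T' : Sch k} (f : T' ⟶ T) (g : T' ⟶ S.G) (v : Fn T' ⊗[k] M.V),
      P.κ g v = f ≫ x → f ≫ y = φ f g v := by
  have inv' : ∀ {T' : Sch k} (f f' : T' ⟶ T) (g g' : T' ⟶ S.G) (v v' : Fn T' ⊗[k] M.V),
      f = f' → P.κ g v = f ≫ x → P.κ g' v' = f' ≫ x → φ f g v = φ f' g' v' := by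
    rintro T' f _ g g' v v' rfl h h'
    obtain ⟨w, rfl⟩ := (P.κ_eq_iff _ _ _ _).1 (h.trans h'.symm)
    exact (inv f g g' v w).symm
  have natκ : ∀ {T'' T' : Sch k} (a : T'' ⟶ T') (f : T' ⟶ T) (g : T' ⟶ S.G) (v : Fn T' ⊗[k] M.V),
      P.κ g v = f ≫ x → P.κ (a ≫ g) (ptPull M.V a v) = (a ≫ f) ≫ x := fun a f g v h => by
    rw [P.natural, h, Category.assoc]
  obtain ⟨T₁, f₁, hf₁, g₁, v₁, h₁⟩ := P.lifts x
  obtain ⟨y, hy⟩ := hf₁.exists_desc (φ f₁ g₁ v₁) fun a b e => by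
    rw [← nat, ← nat]
    exact inv' _ _ _ _ _ _ e (natκ a f₁ g₁ v₁ h₁) (natκ b f₁ g₁ v₁ h₁)
  refine ⟨y, fun {T'} f g v h => ?_⟩
  -- An arbitrary representative is compared with the chosen one over their common refinement, which
  -- is an fpqc cover of `T'`.
  let p := Limits.pullback.fst f f₁
  have hp : IsFpqc p := IsFpqc.of_isPullback (IsPullback.of_hasPullback f f₁) hf₁
  refine hp.hom_ext ?_
  have e : p ≫ f = Limits.pullback.snd f f₁ ≫ f₁ := Limits.pullback.condition
  rw [← nat, ← Category.assoc, e, Category.assoc, hy, ← nat]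
  refine inv' _ _ _ _ _ _ rfl (natκ _ f₁ g₁ v₁ h₁) ?_
  rw [natκ p f g v h, e]

lemma hom_ext (P : InducedSpace S M X) {Y : Sch k} {y y' : X ⟶ Y}
    (h : ∀ {T : Sch k} (g : T ⟶ S.G) (v : Fn T ⊗[k] M.V), P.κ g v ≫ y = P.κ g v ≫ y') : y = y' := by
  obtain ⟨T₁, f₁, hf₁, g₁, v₁, h₁⟩ := P.lifts (𝟙 X)
  refine hf₁.hom_ext ?_
  rw [Category.comp_id] at h₁
  rw [← h₁, h]

lemma exists_desc_id (P : InducedSpace S M X) {Y : Sch k}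
    (φ : ∀ {T' : Sch k} (_ : T' ⟶ S.G) (_ : Fn T' ⊗[k] M.V), T' ⟶ Y)
    (nat : ∀ {T'' T' : Sch k} (a : T'' ⟶ T') (g : T' ⟶ S.G) (v : Fn T' ⊗[k] M.V),
      φ (a ≫ g) (ptPull M.V a v) = a ≫ φ g v)
    (inv : ∀ {T' : Sch k} (g g' : T' ⟶ S.G) (v : Fn T' ⊗[k] M.V),
      g ≫ S.q = g' ≫ S.q → φ g' (tr M g g' v) = φ g v) :
    ∃ y : X ⟶ Y, ∀ {T' : Sch k} (g : T' ⟶ S.G) (v : Fn T' ⊗[k] M.V), P.κ g v ≫ y = φ g v := by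
  obtain ⟨y, hy⟩ := P.exists_desc (𝟙 X) (fun _ g v => φ g v) (fun a _ g v => nat a g v)
    (fun _ g g' v h => inv g g' v h)
  exact ⟨y, fun g v => hy _ g v (Category.comp_id _).symm⟩

/-- The projection `[g, v] ↦ q(g)`. -/
def π (P : InducedSpace S M X) : X ⟶ S.A :=
  (P.exists_desc_id (fun g _ => g ≫ S.q) (fun _ _ _ => Category.assoc _ _ _)
    (fun _ _ _ h => h.symm)).choose

lemma κ_π (P : InducedSpace S M X) {T : Sch k} (g : T ⟶ S.G) (v : Fn T ⊗[k] M.V) :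
    P.κ g v ≫ P.π = g ≫ S.q :=
  (P.exists_desc_id (fun g _ => g ≫ S.q) (fun _ _ _ => Category.assoc _ _ _)
    (fun _ _ _ h => h.symm)).choose_spec g v

/-- A local representative `[g₁, v₁]` of `x` can be rewritten as `[g, v]` because `g₁` and `g` lie
over the same point of `A`. As `v` is unique for fixed `g`, it descends. -/
lemma exists_κ_eq (P : InducedSpace S M X) {T : Sch k} (g : T ⟶ S.G) (x : T ⟶ X)
    (w : x ≫ P.π = g ≫ S.q) : ∃ v, P.κ g v = x := by
  obtain ⟨T₁, f₁, hf₁, g₁, v₁, h₁⟩ := P.lifts x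
  have hw : g₁ ≫ S.q = (f₁ ≫ g) ≫ S.q := by
    rw [← P.κ_π g₁ v₁, h₁, Category.assoc, Category.assoc, w]
  have hv := P.κ_tr hw v₁
  obtain ⟨v, hv'⟩ := hf₁.exists_vec M.V (tr M g₁ (f₁ ≫ g) v₁) fun a b e => by
    apply P.κ_injective (a ≫ f₁ ≫ g)
    conv_rhs => rw [← Category.assoc, e, Category.assoc]
    rw [P.natural, P.natural, hv, h₁, ← Category.assoc, e, Category.assoc]
  refine ⟨v, hf₁.hom_ext ?_⟩
  rw [← P.natural, hv', hv, h₁]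

/-- The equivariant function defined by a point of the induced space. -/
def toSec (P : InducedSpace S M X) {T : Sch k} {b : T ⟶ S.A} (e : Fib P.π b) : Sec M b :=
  have h := P.exists_κ_eq (torsor.snd b) (torsor.fst b ≫ e.1)
    (by rw [Category.assoc, e.2, torsor.w])
  ⟨h.choose, fun p p' hp => by
    refine ((P.κ_eq_iff _ _ _ _).1 ?_).2
    rw [P.natural, P.natural, h.choose_spec, reassoc_of% hp]⟩

lemma κ_toSec_eval (P : InducedSpace S M X) {T T' : Sch k} {b : T ⟶ S.A} (e : Fib P.π b)
    (t : T' ⟶ T) (g : T' ⟶ S.G) (w : t ≫ b = g ≫ S.q) :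
    P.κ g ((P.toSec e).eval t g w) = t ≫ e.1 := by
  have h := (P.exists_κ_eq (torsor.snd b) (torsor.fst b ≫ e.1)
    (by rw [Category.assoc, e.2, torsor.w])).choose_spec
  have h1 := P.natural (torsor.lift t g w) (torsor.snd b) (P.toSec e).1
  rw [torsor.lift_snd] at h1
  refine h1.trans ?_
  rw [toSec, h, torsor.lift_fst_assoc]

/-- The point of the induced space defined by an equivariant function. -/
def ofSec (P : InducedSpace S M X) {T : Sch k} {b : T ⟶ S.A} (s : Sec M b) : Fib P.π b :=
  have h := (torsor.isFpqc b).exists_desc (P.κ (torsor.snd b) s.1) fun a a' e => by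
    rw [← P.natural, ← P.natural, P.κ_eq_iff]
    refine ⟨?_, s.2 a a' e⟩
    rw [torsor.comp_w, torsor.comp_w, reassoc_of% e]
  ⟨h.choose, (torsor.isFpqc b).hom_ext (by rw [reassoc_of% h.choose_spec, κ_π, torsor.w])⟩

lemma κ_eval (P : InducedSpace S M X) {T T' : Sch k} {b : T ⟶ S.A} (s : Sec M b)
    (t : T' ⟶ T) (g : T' ⟶ S.G) (w : t ≫ b = g ≫ S.q) :
    P.κ g (s.eval t g w) = t ≫ (P.ofSec s).1 := by
  have h := (torsor.isFpqc b).exists_desc (P.κ (torsor.snd b) s.1) fun a a' e => by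
    rw [← P.natural, ← P.natural, P.κ_eq_iff]
    refine ⟨?_, s.2 a a' e⟩
    rw [torsor.comp_w, torsor.comp_w, reassoc_of% e]
  have h2 : torsor.fst b ≫ (P.ofSec s).1 = P.κ (torsor.snd b) s.1 := h.choose_spec
  have h1 := P.natural (torsor.lift t g w) (torsor.snd b) s.1
  rw [torsor.lift_snd] at h1
  refine h1.trans ?_
  rw [← h2, torsor.lift_fst_assoc]

/-- Points of the induced space over `b` are equivariant functions on the torsor of lifts of
`b`. -/
def fibEquiv (P : InducedSpace S M X) {T : Sch k} (b : T ⟶ S.A) : Fib P.π b ≃ Sec M b where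
  toFun := P.toSec
  invFun := P.ofSec
  left_inv e := Subtype.ext ((torsor.isFpqc b).hom_ext (by
    rw [← P.κ_eval _ _ _ (torsor.w b), P.κ_toSec_eval]))
  right_inv s := Sec.ext_eval fun t g w => P.κ_injective g (by rw [P.κ_toSec_eval, P.κ_eval])

lemma toSec_pull (P : InducedSpace S M X) {T T' : Sch k} (f : T' ⟶ T) {b : T ⟶ S.A}
    (e : Fib P.π b) : P.toSec (e.pull f) = (P.toSec e).pull f rfl :=
  Sec.ext_eval fun t g w => P.κ_injective g (by
    rw [P.κ_toSec_eval, Sec.eval_pull, P.κ_toSec_eval, Category.assoc]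
    rfl)

instance (P : InducedSpace S M X) {T : Sch k} (b : T ⟶ S.A) : AddCommGroup (Fib P.π b) :=
  (P.fibEquiv b).addCommGroup

instance (P : InducedSpace S M X) {T : Sch k} (b : T ⟶ S.A) : Module (Fn T) (Fib P.π b) :=
  (P.fibEquiv b).module (Fn T)

/-- The linear form of `fibEquiv`. -/
def fibLinEquiv (P : InducedSpace S M X) {T : Sch k} (b : T ⟶ S.A) :
    Fib P.π b ≃ₗ[Fn T] Sec M b :=
  (P.fibEquiv b).linearEquiv (Fn T)

lemma fibLinEquiv_apply (P : InducedSpace S M X) {T : Sch k} (b : T ⟶ S.A) (e : Fib P.π b) :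
    P.fibLinEquiv b e = P.toSec e := rfl

lemma fibLinEquiv_symm_apply (P : InducedSpace S M X) {T : Sch k} (b : T ⟶ S.A) (s : Sec M b) :
    (P.fibLinEquiv b).symm s = P.ofSec s := rfl

lemma ofSec_pull (P : InducedSpace S M X) {T T' : Sch k} (f : T' ⟶ T) {b : T ⟶ S.A}
    (s : Sec M b) : (P.ofSec s).pull f = P.ofSec (s.pull f rfl) := by
  apply (P.fibEquiv _).injective
  change P.toSec _ = P.fibEquiv _ ((P.fibEquiv _).symm _)
  rw [toSec_pull, Equiv.apply_symm_apply]
  congr 1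
  exact (P.fibEquiv b).apply_symm_apply s

lemma add_pull (P : InducedSpace S M X) {T' T : Sch k} (f : T' ⟶ T) {b : T ⟶ S.A}
    (e e' : Fib P.π b) : (e + e').pull f = e.pull f + e'.pull f := by
  apply (P.fibLinEquiv _).injective
  rw [map_add, fibLinEquiv_apply, fibLinEquiv_apply, fibLinEquiv_apply, toSec_pull, toSec_pull,
    toSec_pull, ← fibLinEquiv_apply, map_add]
  refine Sec.ext_eval fun t g w => ?_
  rw [Sec.eval_add, Sec.eval_pull, Sec.eval_pull, Sec.eval_pull, Sec.eval_add]
  rfl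

lemma smul_pull (P : InducedSpace S M X) {T' T : Sch k} (f : T' ⟶ T) {b : T ⟶ S.A}
    (c : Fn T) (e : Fib P.π b) : (c • e).pull f = Fn.pull f c • e.pull f := by
  apply (P.fibLinEquiv _).injective
  rw [map_smul, fibLinEquiv_apply, fibLinEquiv_apply, toSec_pull, toSec_pull,
    ← fibLinEquiv_apply, map_smul]
  refine Sec.ext_eval fun t g w => ?_
  rw [Sec.eval_smul, Sec.eval_pull, Sec.eval_pull, Sec.eval_smul, Fn.pull_comp]
  rfl

/-- The module structure on fibres is that of equivariant functions, carried over by `fibEquiv`; the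
frames of `exists_sec_frame_pull` trivialize it. -/
instance (P : InducedSpace S M X) : VectorBundle P.π where
  pull_add := P.add_pull
  pull_smul := P.smul_pull
  locally_trivial x := by
    obtain ⟨U, hx, s, hs⟩ := exists_sec_frame_pull M x
    refine ⟨U, hx, _, fun i => P.ofSec (s i), fun {T} t => ?_⟩
    have h := (P.fibLinEquiv (t ≫ openIncl U)).symm.bijective.comp (hs t rfl)
    convert h using 2 with c
    rw [Function.comp_apply, map_sum]
    refine Finset.sum_congr rfl fun i _ => ?_
    rw [map_smul, fibLinEquiv_symm_apply, ofSec_pull]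

/-! ### The action on an induced space -/

/-- Left translation commutes with the right action of `H`: it leaves `g'⁻¹ g`, and therefore `tr`,
unchanged. -/
lemma exists_act (P : InducedSpace S M X) {T : Sch k} (g₀ : T ⟶ S.G) (x : T ⟶ X) :
    ∃ y : T ⟶ X, ∀ {T' : Sch k} (f : T' ⟶ T) (g : T' ⟶ S.G) (v : Fn T' ⊗[k] M.V),
      P.κ g v = f ≫ x → f ≫ y = P.κ ((f ≫ g₀) * g) v :=
  P.exists_desc x (fun f g v => P.κ ((f ≫ g₀) * g) v)
    (fun a f g v => by rw [← P.natural, MonObj.comp_mul, Category.assoc])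
    (fun f g g' v w => by
      have h : ((f ≫ g₀) * g) ≫ S.q = ((f ≫ g₀) * g') ≫ S.q := by
        rw [MonObj.mul_comp, MonObj.mul_comp, w]
      rw [← P.κ_tr h, tr, tr, hdiff_eq (g := (f ≫ g₀) * g) (g' := (f ≫ g₀) * g') (h := hdiff g g')
        (by rw [hdiff_j w]; group)])

/-- The action `g · [g', v] = [g g', v]`. -/
def act (P : InducedSpace S M X) {T : Sch k} (g : T ⟶ S.G) (x : T ⟶ X) : T ⟶ X :=
  (P.exists_act g x).choose

lemma comp_act_eq (P : InducedSpace S M X) {T T' : Sch k} (g₀ : T ⟶ S.G) {x : T ⟶ X} {f : T' ⟶ T}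
    {g : T' ⟶ S.G} {v : Fn T' ⊗[k] M.V} (h : P.κ g v = f ≫ x) :
    f ≫ P.act g₀ x = P.κ ((f ≫ g₀) * g) v :=
  (P.exists_act g₀ x).choose_spec f g v h

lemma act_κ (P : InducedSpace S M X) {T : Sch k} (g₀ g : T ⟶ S.G) (v : Fn T ⊗[k] M.V) :
    P.act g₀ (P.κ g v) = P.κ (g₀ * g) v := by
  have := P.comp_act_eq g₀ (x := P.κ g v) (f := 𝟙 T) (Category.id_comp _).symm
  rwa [Category.id_comp, Category.id_comp] at this

lemma comp_act (P : InducedSpace S M X) {T T' : Sch k} (f : T' ⟶ T) (g₀ : T ⟶ S.G) (x : T ⟶ X) :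
    f ≫ P.act g₀ x = P.act (f ≫ g₀) (f ≫ x) := by
  obtain ⟨T₁, f₁, hf₁, g₁, v₁, h₁⟩ := P.lifts (f ≫ x)
  refine hf₁.hom_ext ?_
  rw [P.comp_act_eq _ h₁, ← Category.assoc, P.comp_act_eq (f := f₁ ≫ f) g₀ (x := x) (by
    rw [h₁, Category.assoc]), Category.assoc]

lemma act_π (P : InducedSpace S M X) {T : Sch k} (g₀ : T ⟶ S.G) (x : T ⟶ X) :
    P.act g₀ x ≫ P.π = (g₀ ≫ S.q) * (x ≫ P.π) := by
  obtain ⟨T₁, f₁, hf₁, g₁, v₁, h₁⟩ := P.lifts x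
  refine hf₁.hom_ext ?_
  rw [← Category.assoc, P.comp_act_eq _ h₁, κ_π, MonObj.mul_comp, MonObj.comp_mul,
    ← Category.assoc f₁ x, ← h₁, κ_π, Category.assoc]

lemma act_one (P : InducedSpace S M X) {T : Sch k} (x : T ⟶ X) : P.act 1 x = x := by
  obtain ⟨T₁, f₁, hf₁, g₁, v₁, h₁⟩ := P.lifts x
  refine hf₁.hom_ext ?_
  rw [P.comp_act_eq _ h₁, MonObj.comp_one, one_mul, h₁]

lemma act_mul (P : InducedSpace S M X) {T : Sch k} (g g' : T ⟶ S.G) (x : T ⟶ X) :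
    P.act (g * g') x = P.act g (P.act g' x) := by
  obtain ⟨T₁, f₁, hf₁, g₁, v₁, h₁⟩ := P.lifts x
  refine hf₁.hom_ext ?_
  rw [P.comp_act_eq _ h₁, P.comp_act_eq _ (P.comp_act_eq g' h₁).symm, MonObj.comp_mul, mul_assoc]

/-- On equivariant functions the action is `(g₀ · s)(g) = s(g₀⁻¹ g)`, from which its linearity is
visible. -/
lemma toSec_act_eval (P : InducedSpace S M X) {T T' : Sch k} {b b' : T ⟶ S.A} (g₀ : T ⟶ S.G)
    {e : Fib P.π b} {e' : Fib P.π b'} (he : e'.1 = P.act g₀ e.1) (t : T' ⟶ T) (g : T' ⟶ S.G)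
    (w : t ≫ b' = g ≫ S.q) (w' : t ≫ b = ((t ≫ g₀)⁻¹ * g) ≫ S.q) :
    (P.toSec e').eval t g w = (P.toSec e).eval t ((t ≫ g₀)⁻¹ * g) w' := by
  apply P.κ_injective g
  rw [P.κ_toSec_eval, he, P.comp_act_eq g₀ (P.κ_toSec_eval e t _ w'), mul_inv_cancel_left]

lemma act_w (P : InducedSpace S M X) {T T' : Sch k} {b b' : T ⟶ S.A} (g₀ : T ⟶ S.G)
    {e : Fib P.π b} {e' : Fib P.π b'} (he : e'.1 = P.act g₀ e.1) (t : T' ⟶ T) (g : T' ⟶ S.G)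
    (w : t ≫ b' = g ≫ S.q) : t ≫ b = ((t ≫ g₀)⁻¹ * g) ≫ S.q := by
  have h : b' = (g₀ ≫ S.q) * b := by rw [← e'.2, he, act_π, e.2]
  rw [h] at w
  rw [MonObj.mul_comp, ← w, MonObj.comp_mul, GrpObj.inv_comp, Category.assoc, inv_mul_cancel_left]

/-- Additivity of the action. The points over `b` and `b'` are related through their underlying
morphisms only, so that it can be used when `b'` is merely provably equal to the translate of `b`.
-/
lemma coe_add_act (P : InducedSpace S M X) {T : Sch k} {b b' : T ⟶ S.A} (g₀ : T ⟶ S.G)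
    {e₁ e₂ e₃ : Fib P.π b} {e₁' e₂' e₃' : Fib P.π b'} (h₁ : e₁'.1 = P.act g₀ e₁.1)
    (h₂ : e₂'.1 = P.act g₀ e₂.1) (h₃ : e₃'.1 = P.act g₀ e₃.1) (h : e₃ = e₁ + e₂) :
    e₃' = e₁' + e₂' := by
  apply (P.fibLinEquiv _).injective
  rw [map_add]
  refine Sec.ext_eval fun t g w => ?_
  have w' := P.act_w g₀ h₁ t g w
  rw [Sec.eval_add, fibLinEquiv_apply, fibLinEquiv_apply, fibLinEquiv_apply,
    P.toSec_act_eval g₀ h₁ t g w w', P.toSec_act_eval g₀ h₂ t g w w',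
    P.toSec_act_eval g₀ h₃ t g w w', h, ← fibLinEquiv_apply, map_add, Sec.eval_add]
  rfl

lemma coe_smul_act (P : InducedSpace S M X) {T : Sch k} {b b' : T ⟶ S.A} (g₀ : T ⟶ S.G)
    {e₁ e₃ : Fib P.π b} {e₁' e₃' : Fib P.π b'} (c : Fn T) (h₁ : e₁'.1 = P.act g₀ e₁.1)
    (h₃ : e₃'.1 = P.act g₀ e₃.1) (h : e₃ = c • e₁) :
    e₃' = c • e₁' := by
  apply (P.fibLinEquiv _).injective
  rw [map_smul]
  refine Sec.ext_eval fun t g w => ?_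
  have w' := P.act_w g₀ h₁ t g w
  rw [Sec.eval_smul, fibLinEquiv_apply, fibLinEquiv_apply,
    P.toSec_act_eval g₀ h₁ t g w w', P.toSec_act_eval g₀ h₃ t g w w', h, ← fibLinEquiv_apply,
    map_smul, Sec.eval_smul]
  rfl

/-- The graded endomorphism given by the action of `g ∈ G(T)`. -/
def gradedEnd (P : InducedSpace S M X) {T : Sch k} (g : T ⟶ S.G) : GradedEnd P.π T where
  deg := g ≫ S.q
  hom := P.act (snd X T ≫ g) (fst X T)
  w := by rw [act_π, Category.assoc]
  map_add t b e e' := by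
    refine P.coe_add_act (t ≫ g) (e₁ := e) (e₂ := e') ?_ ?_ ?_ rfl <;>
      simp [GradedMap.onFib, comp_act]
  map_smul t b c e := by
    refine P.coe_smul_act (t ≫ g) (e₁ := e) c ?_ ?_ rfl <;>
      simp [GradedMap.onFib, comp_act]

/-- The action of `G` on the induced space. -/
def extHom (P : InducedSpace S M X) : ExtHom S P.π where
  ρ T := MonoidHom.toHomUnits
    { toFun := P.gradedEnd
      map_one' := by
        refine GradedEnd.ext ?_ ?_
        · exact MonObj.one_comp _
        · change P.act (snd X T ≫ 1) (fst X T) = fst X T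
          rw [MonObj.comp_one, act_one]
      map_mul' := fun g g' => by
        refine GradedEnd.ext ?_ ?_
        · exact MonObj.mul_comp _ _ _
        · change P.act _ _ = lift (P.act _ _) (snd X T) ≫ P.act _ _
          rw [comp_act, lift_snd_assoc, lift_fst, MonObj.comp_mul, act_mul] }
  ρ_natural f g := by
    change P.act _ _ = _ ≫ P.act _ _
    rw [comp_act, whiskerLeft_snd_assoc, whiskerLeft_fst]
  ρ_deg g := rfl

end InducedSpace

/-- The torsor of lifts is itself an fpqc cover over which the point of `A` lifts to `G`, and `ρ`
sends that lift to a graded automorphism. -/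
lemma ExtHom.isHomogeneous {π : X ⟶ S.A} [VectorBundle π] (rep : ExtHom S π) :
    IsHomogeneous π := fun a =>
  ⟨torsor a, torsor.fst a, torsor.isFpqc a, rep.ρ _ (torsor.snd a), by
    rw [rep.ρ_deg, torsor.w]⟩

namespace InducedSpace

/-- The canonical `S`-module structure on an induced space. -/
def toSModule (P : InducedSpace S M X) : SModule S :=
  SModule.mk X P.π P.extHom.isHomogeneous P.extHom

lemma toSModule_isCanonical (P : InducedSpace S M X) : P.IsCanonical (E := P.toSModule) where
  fibre_iso {T} g := by
    refine ⟨(secEquiv M g rfl).symm.trans (P.fibLinEquiv _).symm, fun v => ?_⟩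
    change (P.ofSec (Sec.ofPt M g rfl v)).1 = _
    rw [← Category.id_comp (P.ofSec _).1, ← P.κ_eval _ (𝟙 T) g (by rw [Category.id_comp]),
      Sec.eval_ofPt, Category.id_comp, tr_self, ptPull_id]
    rfl
  act {T} g' g v := by
    change lift _ _ ≫ P.act (snd X T ≫ g') (fst X T) = _
    rw [comp_act, lift_snd_assoc, lift_fst, Category.id_comp, act_κ]

end InducedSpace

theorem exists_isCanonical (P : InducedSpace S M X) :
    ∃ (π : X ⟶ S.A) (_ : VectorBundle π) (hom : IsHomogeneous π) (rep : ExtHom S π),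
      P.IsCanonical (E := SModule.mk X π hom rep) :=
  ⟨P.π, inferInstance, P.extHom.isHomogeneous, P.extHom, P.toSModule_isCanonical⟩

end

end AffExt

/-! ### The Zariski sheaf of pairs of a point of `A` and an equivariant function. -/

namespace AffExt

noncomputable section

variable {k : Type u} [Field k] {S : AffineExtension k} {M : FinRep S.H}

/-! ### Gluing of equivariant functions -/

section PulledBackCover

variable {T T' : Sch k} (𝒰 : T.left.OpenCover) (f : T' ⟶ T) (i : 𝒰.I₀)

/-- A member of the pullback of an open cover. -/
def pullObj : Sch k := Over.mk (Limits.pullback.fst f.left (𝒰.f i) ≫ T'.hom)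

/-- The inclusion of a member of the pullback of an open cover. -/
def pullMap : pullObj 𝒰 f i ⟶ T' := Over.homMk (Limits.pullback.fst f.left (𝒰.f i)) rfl

/-- The projection from the pullback of an open cover to the cover. -/
def pullProj : pullObj 𝒰 f i ⟶ coverObj 𝒰 i :=
  Over.homMk (Limits.pullback.snd f.left (𝒰.f i)) (by
    change _ ≫ 𝒰.f i ≫ T.hom = Limits.pullback.fst f.left (𝒰.f i) ≫ T'.hom
    rw [← Over.w f, ← Category.assoc, ← Category.assoc, Limits.pullback.condition])

lemma pullProj_coverMap : pullProj 𝒰 f i ≫ coverMap 𝒰 i = pullMap 𝒰 f i ≫ f := by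
  ext : 1
  exact Limits.pullback.condition.symm

lemma pullProj_coverMap_assoc {Y : Sch k} (z : T ⟶ Y) :
    pullProj 𝒰 f i ≫ coverMap 𝒰 i ≫ z = pullMap 𝒰 f i ≫ f ≫ z := by
  rw [← Category.assoc, pullProj_coverMap, Category.assoc]

variable {𝒰 f i} in
lemma exists_pullLift {T'' : Sch k} {p : T'' ⟶ T'} {t : T'' ⟶ coverObj 𝒰 i}
    (h : p ≫ f = t ≫ coverMap 𝒰 i) : ∃ z : T'' ⟶ pullObj 𝒰 f i,
      z ≫ pullMap 𝒰 f i = p ∧ z ≫ pullProj 𝒰 f i = t := by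
  let t' : T''.left ⟶ 𝒰.X i := t.left
  have h' : p.left ≫ f.left = t' ≫ 𝒰.f i := congrArg (fun z => z.left) h
  have h1 : Limits.pullback.lift p.left t' h' ≫ Limits.pullback.fst f.left (𝒰.f i) = p.left :=
    Limits.pullback.lift_fst _ _ _
  refine ⟨Over.homMk (Limits.pullback.lift p.left t' h') ?_, ?_, ?_⟩
  · change _ ≫ Limits.pullback.fst f.left (𝒰.f i) ≫ T'.hom = _
    rw [← Category.assoc, h1, Over.w]
  · ext : 1
    exact h1
  · ext : 1
    exact Limits.pullback.lift_snd _ _ _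

variable {V : Type u} [AddCommGroup V] [Module k V] [Module.Finite k V]

lemma pull_ptPull_ext {v w : Fn T' ⊗[k] V}
    (h : ∀ i, ptPull V (pullMap 𝒰 f i) v = ptPull V (pullMap 𝒰 f i) w) : v = w :=
  cover_ptPull_ext V (Precoverage.ZeroHypercover.pullback₁ f.left 𝒰) h

lemma pull_exists_vec (v : ∀ i, Fn (pullObj 𝒰 f i) ⊗[k] V)
    (hv : ∀ {T'' : Sch k} (i j : 𝒰.I₀) (a : T'' ⟶ pullObj 𝒰 f i) (b : T'' ⟶ pullObj 𝒰 f j),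
      a ≫ pullMap 𝒰 f i = b ≫ pullMap 𝒰 f j → ptPull V a (v i) = ptPull V b (v j)) :
    ∃ w : Fn T' ⊗[k] V, ∀ i, ptPull V (pullMap 𝒰 f i) w = v i :=
  cover_exists_vec V (Precoverage.ZeroHypercover.pullback₁ f.left 𝒰) v hv

end PulledBackCover

lemma cover_sec_ext {T : Sch k} (𝒰 : T.left.OpenCover) {b : T ⟶ S.A} {s s' : Sec M b}
    (h : ∀ i, s.pull (coverMap 𝒰 i) rfl = s'.pull (coverMap 𝒰 i) rfl) : s = s' := by
  refine Sec.ext_eval fun {T'} t g w => ?_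
  refine pull_ptPull_ext 𝒰 t fun i => ?_
  have hw : pullProj 𝒰 t i ≫ coverMap 𝒰 i ≫ b = (pullMap 𝒰 t i ≫ g) ≫ S.q := by
    rw [pullProj_coverMap_assoc, w, Category.assoc]
  have e := congrArg (fun s => s.eval (pullProj 𝒰 t i) (pullMap 𝒰 t i ≫ g) hw) (h i)
  simp only [Sec.eval_pull, pullProj_coverMap] at e
  rw [Sec.ptPull_eval, Sec.ptPull_eval, e]

/-- The cover is pulled back to the torsor, where the values at the universal lift glue to a vector;
its equivariance can be tested locally on the cover. -/
lemma cover_exists_sec {T : Sch k} (𝒰 : T.left.OpenCover) {b : T ⟶ S.A}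
    (s : ∀ i, Sec M (coverMap 𝒰 i ≫ b))
    (hs : ∀ {T' : Sch k} (i j : 𝒰.I₀) (a : T' ⟶ coverObj 𝒰 i) (c : T' ⟶ coverObj 𝒰 j)
      (g : T' ⟶ S.G) (w : a ≫ coverMap 𝒰 i ≫ b = g ≫ S.q) (w' : c ≫ coverMap 𝒰 j ≫ b = g ≫ S.q),
      a ≫ coverMap 𝒰 i = c ≫ coverMap 𝒰 j → (s i).eval a g w = (s j).eval c g w') :
    ∃ t : Sec M b, ∀ i, t.pull (coverMap 𝒰 i) rfl = s i := by
  let p := torsor.fst b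
  obtain ⟨v, hv⟩ := pull_exists_vec 𝒰 p
    (fun i => (s i).eval (pullProj 𝒰 p i) (pullMap 𝒰 p i ≫ torsor.snd b) (by
      rw [pullProj_coverMap_assoc, torsor.w, Category.assoc])) fun i j a c e => by
    rw [Sec.ptPull_eval, Sec.ptPull_eval]
    simp only [← reassoc_of% e]
    exact hs i j _ _ _ _ _ (by
      rw [Category.assoc, Category.assoc, pullProj_coverMap, pullProj_coverMap, reassoc_of% e])
  -- The glued vector takes the prescribed value at every lift over a member of the cover, since
  -- such a lift factors through the pulled back member.
  have key : ∀ {Z : Sch k} (i : 𝒰.I₀) (t : Z ⟶ coverObj 𝒰 i) (x : Z ⟶ torsor b) (g : Z ⟶ S.G)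
      (w : t ≫ coverMap 𝒰 i ≫ b = g ≫ S.q), x ≫ torsor.snd b = g → x ≫ p = t ≫ coverMap 𝒰 i →
      ptPull M.V x v = (s i).eval t g w := fun i t x g w hg e => by
    obtain ⟨z, h1, h2⟩ := exists_pullLift e
    subst h1 h2 hg
    rw [ptPull_comp, hv, Sec.ptPull_eval]
    simp only [Category.assoc]
  refine ⟨⟨v, fun {T'} x x' e => ?_⟩, fun i => Sec.ext_eval fun t g w => ?_⟩
  · refine pull_ptPull_ext 𝒰 (x ≫ p) fun i => ?_
    have hw : (x ≫ torsor.snd b) ≫ S.q = (x' ≫ torsor.snd b) ≫ S.q := by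
      rw [torsor.comp_w, torsor.comp_w, reassoc_of% e]
    have h1 : pullProj 𝒰 (x ≫ p) i ≫ coverMap 𝒰 i ≫ b =
        (pullMap 𝒰 (x ≫ p) i ≫ x ≫ torsor.snd b) ≫ S.q := by
      rw [pullProj_coverMap_assoc]
      simp only [Category.assoc, p, torsor.w]
    have h2 : pullProj 𝒰 (x ≫ p) i ≫ coverMap 𝒰 i ≫ b =
        (pullMap 𝒰 (x ≫ p) i ≫ x' ≫ torsor.snd b) ≫ S.q := by
      rw [h1, Category.assoc, hw]
      simp only [Category.assoc]
    rw [ptPull_tr _ _ hw, ← ptPull_comp, ← ptPull_comp,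
      key i (pullProj 𝒰 (x ≫ p) i) _ _ h1 (Category.assoc _ _ _),
      key i (pullProj 𝒰 (x ≫ p) i) _ _ h2 (Category.assoc _ _ _)]
    · exact (s i).eval_tr _ _ _ _ _
    · rw [pullProj_coverMap, Category.assoc, ← e]
    · rw [pullProj_coverMap, Category.assoc]
  · rw [Sec.eval_pull, Sec.eval]
    exact key i t _ _ _ (torsor.lift_snd _ _ _) (torsor.lift_fst _ _ _)

/-! ### The functor of points of an induced space -/

variable (M) in
/-- A `T`-point of the induced space. -/
structure IndPt (T : Scheme.{u}) where
  hom : T ⟶ Spec (CommRingCat.of k)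
  base : Over.mk hom ⟶ S.A
  sec : Sec M base

/-- Two points may carry different structure morphisms, so their functions have different types.
Values at lifts over a common test scheme are vectors of one type and can be compared. -/
lemma IndPt.ext_eval {T : Scheme.{u}} {x y : IndPt M T} (h : x.base.left = y.base.left)
    (h' : ∀ {T' : Sch k} (t : T' ⟶ Over.mk x.hom) (t' : T' ⟶ Over.mk y.hom) (g : T' ⟶ S.G)
      (w : t ≫ x.base = g ≫ S.q) (w' : t' ≫ y.base = g ≫ S.q), t.left = t'.left →
      x.sec.eval t g w = y.sec.eval t' g w') : x = y := by
  obtain ⟨p, b, s⟩ := x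
  obtain ⟨p', b', s'⟩ := y
  obtain rfl : p = p' := (Over.w b).symm.trans ((congrArg (· ≫ S.A.hom) h).trans (Over.w b'))
  obtain rfl : b = b' := Over.OverMorphism.ext h
  congr 1
  exact Sec.ext_eval fun t g w => h' t t g w w rfl

lemma IndPt.eval_congr {T : Scheme.{u}} {x y : IndPt M T} (h : x = y) {T' : Sch k}
    (t : T' ⟶ Over.mk x.hom) (t' : T' ⟶ Over.mk y.hom) (g : T' ⟶ S.G)
    (w : t ≫ x.base = g ≫ S.q) (w' : t' ≫ y.base = g ≫ S.q) (e : t.left = t'.left) :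
    x.sec.eval t g w = y.sec.eval t' g w' := by
  subst h
  obtain rfl : t = t' := Over.OverMorphism.ext e
  rfl

/-- The underlying point of `A`. -/
def IndPt.left {T : Scheme.{u}} (x : IndPt M T) : T ⟶ S.A.left := x.base.left

/-- A morphism of schemes as a morphism over `k`. -/
def overMap {T T' : Scheme.{u}} (f : T' ⟶ T) (p : T ⟶ Spec (CommRingCat.of k)) :
    Over.mk (f ≫ p) ⟶ Over.mk p := Over.homMk f rfl

/-- Pullback of points. -/
def IndPt.pull {T T' : Scheme.{u}} (f : T' ⟶ T) (x : IndPt M T) : IndPt M T' where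
  hom := f ≫ x.hom
  base := overMap f x.hom ≫ x.base
  sec := x.sec.pull _ rfl

/-- The morphism along which a point is pulled back. -/
def IndPt.pullMap {T T' : Scheme.{u}} (f : T' ⟶ T) (x : IndPt M T) :
    Over.mk (x.pull f).hom ⟶ Over.mk x.hom := overMap f x.hom

lemma IndPt.pull_eval {T T' : Scheme.{u}} (f : T' ⟶ T) (x : IndPt M T) {Z : Sch k}
    (t : Z ⟶ Over.mk (x.pull f).hom) (g : Z ⟶ S.G) (w : t ≫ (x.pull f).base = g ≫ S.q)
    (t' : Z ⟶ Over.mk x.hom) (w' : t' ≫ x.base = g ≫ S.q) (e : t.left ≫ f = t'.left) :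
    (x.pull f).sec.eval t g w = x.sec.eval t' g w' := by
  obtain rfl : t ≫ x.pullMap f = t' := Over.OverMorphism.ext e
  exact x.sec.eval_pull (overMap f x.hom) rfl t g w

lemma IndPt.pull_id {T : Scheme.{u}} (x : IndPt M T) : x.pull (𝟙 T) = x :=
  ext_eval (Category.id_comp _) fun t t' g w w' e =>
    x.pull_eval (𝟙 T) t g w t' w' ((Category.comp_id _).trans e)

lemma IndPt.pull_comp {T T' T'' : Scheme.{u}} (f : T' ⟶ T) (f' : T'' ⟶ T') (x : IndPt M T) :
    x.pull (f' ≫ f) = (x.pull f).pull f' := by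
  refine ext_eval (Category.assoc _ _ _) fun {Z} t t' g w w' e => ?_
  let z : Z ⟶ Over.mk (x.pull f).hom := t' ≫ (x.pull f).pullMap f'
  have wz : z ≫ (x.pull f).base = g ≫ S.q := (Category.assoc _ _ _).trans w'
  have wz' : (z ≫ x.pullMap f) ≫ x.base = g ≫ S.q := (Category.assoc _ _ _).trans wz
  rw [(x.pull f).pull_eval f' t' g w' z wz rfl, x.pull_eval f z g wz (z ≫ x.pullMap f) wz' rfl]
  refine x.pull_eval _ _ _ _ _ _ ?_
  change t.left ≫ f' ≫ f = (t'.left ≫ f') ≫ f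
  rw [e, Category.assoc]

variable (M) in
/-- The functor of points of the induced space. -/
def indFunctor : Scheme.{u}ᵒᵖ ⥤ Type u where
  obj T := IndPt M T.unop
  map f := ↾fun x => x.pull f.unop
  map_id T := by
    ext x
    exact x.pull_id
  map_comp f f' := by
    ext x
    exact x.pull_comp f.unop f'.unop

/-- The points of `A` glue as morphisms of schemes; the glued morphism determines the structure
morphism of `T` over `k`, and then the equivariant functions glue by `cover_exists_sec`. -/
lemma IndPt.existsUnique_glue {T : Scheme.{u}} (𝒰 : T.OpenCover) (x : ∀ i, IndPt M (𝒰.X i))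
    (hx : ∀ (i j : 𝒰.I₀) (Z : Scheme.{u}) (a : Z ⟶ 𝒰.X i) (c : Z ⟶ 𝒰.X j),
      a ≫ 𝒰.f i = c ≫ 𝒰.f j → (x i).pull a = (x j).pull c) :
    ∃! y : IndPt M T, ∀ i, y.pull (𝒰.f i) = x i := by
  let β : T ⟶ S.A.left := Scheme.Cover.glueMorphisms 𝒰 (fun i => (x i).base.left) fun i j =>
    congrArg IndPt.left (hx i j _ _ _ Limits.pullback.condition)
  have hβ : ∀ i, 𝒰.f i ≫ β = (x i).base.left := fun i => Scheme.Cover.ι_glueMorphisms ..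
  let T₀ : Sch k := Over.mk (β ≫ S.A.hom)
  let b : T₀ ⟶ S.A := Over.homMk β
  let 𝒱 : T₀.left.OpenCover := 𝒰
  -- The identity of the underlying scheme, viewed as a morphism over `k`: the structure morphism
  -- induced from `T₀` and the one carried by `x i` are equal but not definitionally so.
  let m : ∀ i, coverObj 𝒱 i ⟶ Over.mk (x i).hom := fun i => Over.homMk (𝟙 _) (by
    change 𝟙 _ ≫ (x i).hom = 𝒰.f i ≫ β ≫ S.A.hom
    rw [Category.id_comp, ← Category.assoc, hβ]
    exact (Over.w (x i).base).symm)
  have hm : ∀ i, m i ≫ (x i).base = coverMap 𝒱 i ≫ b := fun i => by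
    ext : 1
    exact (Category.id_comp _).trans (hβ i).symm
  have hml : ∀ i {Z : Sch k} (z : Z ⟶ coverObj 𝒱 i), (z ≫ m i).left = z.left := fun i Z z =>
    Category.comp_id _
  obtain ⟨s, hs⟩ := cover_exists_sec 𝒱 (fun i => (x i).sec.pull (m i) (hm i))
    fun {T'} i j a c g w w' e => by
    rw [Sec.eval_pull, Sec.eval_pull]
    let a' : T'.left ⟶ 𝒰.X i := a.left
    let c' : T'.left ⟶ 𝒰.X j := c.left
    have e' : a' ≫ 𝒰.f i = c' ≫ 𝒰.f j := congrArg (fun z => z.left) e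
    have h := hx i j _ _ _ e'
    let t : T' ⟶ Over.mk ((x i).pull a').hom := Over.homMk (𝟙 _) (by
      have := Over.w (a ≫ m i)
      rw [hml] at this
      exact (Category.id_comp _).trans this)
    let t' : T' ⟶ Over.mk ((x j).pull c').hom := Over.homMk (𝟙 _) (by
      have := Over.w (c ≫ m j)
      rw [hml] at this
      exact (Category.id_comp _).trans this)
    have ht : t ≫ (x i).pullMap a' = a ≫ m i := by
      ext : 1
      exact (Category.id_comp _).trans (hml _ _).symm
    have ht' : t' ≫ (x j).pullMap c' = c ≫ m j := by
      ext : 1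
      exact (Category.id_comp _).trans (hml _ _).symm
    have w1 : t ≫ ((x i).pull a').base = g ≫ S.q := by
      rw [← w, ← hm, ← Category.assoc a, ← ht, Category.assoc]
      rfl
    have w2 : t' ≫ ((x j).pull c').base = g ≫ S.q := by
      rw [← w', ← hm, ← Category.assoc c, ← ht', Category.assoc]
      rfl
    have := IndPt.eval_congr h t t' g w1 w2 rfl
    rwa [(x i).pull_eval a' t g w1 (a ≫ m i) (by rw [Category.assoc, hm, w]) (by rw [← ht]; rfl),
      (x j).pull_eval c' t' g w2 (c ≫ m j) (by rw [Category.assoc, hm, w']) (by rw [← ht']; rfl)]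
      at this
  refine ⟨⟨T₀.hom, b, s⟩, fun i => ?_, fun y hy => ?_⟩
  · refine IndPt.ext_eval (hβ i) fun {T'} t t' g w w' e => ?_
    let t₀ : T' ⟶ coverObj 𝒱 i := t
    have hw : t₀ ≫ coverMap 𝒱 i ≫ b = g ≫ S.q := w
    have hw1 : (t₀ ≫ coverMap 𝒱 i) ≫ b = g ≫ S.q := by rw [Category.assoc, hw]
    have hw2 : (t₀ ≫ m i) ≫ (x i).base = g ≫ S.q := by rw [Category.assoc, hm, hw]
    have h : s.eval (t₀ ≫ coverMap 𝒱 i) g hw1 = (x i).sec.eval (t₀ ≫ m i) g hw2 := by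
      rw [← Sec.eval_pull s (coverMap 𝒱 i) rfl t₀ g hw, hs, Sec.eval_pull]
    have h1 := IndPt.pull_eval (𝒰.f i) ⟨T₀.hom, b, s⟩ t g w (t₀ ≫ coverMap 𝒱 i) hw1 rfl
    have h2 := IndPt.eval_congr (x := x i) rfl (t₀ ≫ m i) t' g hw2 w' ((hml _ _).trans e)
    exact h1.trans (h.trans h2)
  · obtain ⟨p, b', s'⟩ := y
    obtain hb' : b'.left = β := Scheme.Cover.hom_ext 𝒰 _ _ fun i =>
      (congrArg IndPt.left (hy i)).trans (hβ i).symm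
    obtain rfl : p = β ≫ S.A.hom := (Over.w b').symm.trans (congrArg (· ≫ S.A.hom) hb')
    obtain rfl : b' = b := Over.OverMorphism.ext hb'
    obtain rfl : s' = s := by
      refine cover_sec_ext 𝒱 fun i => ?_
      rw [hs i]
      refine Sec.ext_eval fun {Z} t g w => ?_
      rw [Sec.eval_pull, Sec.eval_pull]
      let y : IndPt M T := ⟨T₀.hom, b, s'⟩
      have hw1 : (t ≫ coverMap 𝒱 i) ≫ b = g ≫ S.q := by rw [Category.assoc, w]
      have w2 : (t ≫ m i) ≫ (x i).base = g ≫ S.q := by rw [Category.assoc, hm, w]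
      let t' : Z ⟶ Over.mk (y.pull (𝒰.f i)).hom := t
      have w1 : t' ≫ (y.pull (𝒰.f i)).base = g ≫ S.q := w
      have h1 := y.pull_eval (𝒰.f i) t' g w1 (t ≫ coverMap 𝒱 i) hw1 rfl
      have h2 := IndPt.eval_congr (hy i) t' (t ≫ m i) g w1 w2 (hml _ _).symm
      exact h1.symm.trans h2
    rfl

theorem indFunctor_isSheaf : Presieve.IsSheaf Scheme.zariskiTopology (indFunctor M) := by
  rw [Precoverage.isSheaf_toGrothendieck_iff_of_isStableUnderBaseChange]
  rintro T R hR
  obtain ⟨(𝒰 : T.OpenCover), rfl⟩ := Scheme.exists_cover_of_mem_pretopology hR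
  rw [Presieve.isSheafFor_arrows_iff]
  exact fun x hx => IndPt.existsUnique_glue 𝒰 x hx

end

end AffExt

/-! ### Representability of the sheaf and existence of the quotient. -/

namespace AffExt

noncomputable section

variable {k : Type u} [Field k] {S : AffineExtension k} {M : FinRep S.H}

/-! ### Charts of an induced space -/

section Chart

variable {U : S.A.left.Opens} {n : ℕ} (s : Fin n → Sec M (openIncl U))

/-- A morphism to `U` as a morphism over `k`. -/
def toOpenSub {Z : Scheme.{u}} (f : Z ⟶ U) : (Over.mk (f ≫ U.ι ≫ S.A.hom) : Sch k) ⟶ openSub U :=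
  Over.homMk f rfl

/-- A function as a function on a scheme over `k`. -/
def toFn {Z : Scheme.{u}} (p : Z ⟶ Spec (CommRingCat.of k)) (c : Γ(Z, ⊤)) : Fn (Over.mk p) := c

/-- The point with the given coordinates in the frame `s`. -/
def framePt {Z : Scheme.{u}} (f : Z ⟶ U) (v : ULift.{u} (Fin n) → Γ(Z, ⊤)) : IndPt M Z where
  hom := f ≫ U.ι ≫ S.A.hom
  base := toOpenSub f ≫ openIncl U
  sec := ∑ i, toFn (f ≫ U.ι ≫ S.A.hom) (v ⟨i⟩) • (s i).pull (toOpenSub f) rfl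

lemma Sec.eval_sum {T T' : Sch k} {b : T ⟶ S.A} (c : Fin n → Fn T) (s : Fin n → Sec M b)
    (t : T' ⟶ T) (g : T' ⟶ S.G) (w : t ≫ b = g ≫ S.q) :
    (∑ i, c i • s i).eval t g w = ∑ i, Fn.pull t (c i) • (s i).eval t g w := by
  rw [← Finset.sum_congr rfl fun i _ => Sec.eval_smul (c i) (s i) t g w, Sec.eval]
  rw [AddSubmonoidClass.coe_finsetSum, map_sum]
  rfl

lemma framePt_eval {Z : Scheme.{u}} (f : Z ⟶ U) (v : ULift.{u} (Fin n) → Γ(Z, ⊤)) {T : Sch k}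
    (t : T ⟶ Over.mk (f ≫ U.ι ≫ S.A.hom)) (t' : T ⟶ openSub U) (g : T ⟶ S.G)
    (w : t ≫ (framePt s f v).base = g ≫ S.q) (w' : t' ≫ openIncl U = g ≫ S.q)
    (e : t ≫ toOpenSub f = t') :
    (framePt s f v).sec.eval t g w =
      ∑ i, Fn.pull t (toFn (f ≫ U.ι ≫ S.A.hom) (v ⟨i⟩)) • (s i).eval t' g w' := by
  subst e
  refine (Sec.eval_sum _ _ _ _ _).trans (Finset.sum_congr rfl fun i _ => ?_)
  exact congrArg (fun z => Fn.pull t (toFn (f ≫ U.ι ≫ S.A.hom) (v ⟨i⟩)) • z)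
    ((s i).eval_pull (toOpenSub f) rfl t g w)

lemma framePt_pull {Z Z' : Scheme.{u}} (f : Z ⟶ U) (v : ULift.{u} (Fin n) → Γ(Z, ⊤))
    (a : Z' ⟶ Z) : (framePt s f v).pull a = framePt s (a ≫ f) fun i => a.appTop (v i) := by
  refine IndPt.ext_eval (Category.assoc _ _ _).symm fun {T'} t t' g w w' e => ?_
  let z : T' ⟶ Over.mk (f ≫ U.ι ≫ S.A.hom) := t ≫ (framePt s f v).pullMap a
  have hz : z.left = t'.left ≫ a := congrArg (· ≫ a) e
  have hw : z ≫ (framePt s f v).base = g ≫ S.q := (Category.assoc _ _ _).trans w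
  have hw' : (t' ≫ toOpenSub (a ≫ f)) ≫ openIncl U = g ≫ S.q := (Category.assoc _ _ _).trans w'
  rw [(framePt s f v).pull_eval a t g w z hw rfl, framePt_eval s f v z _ g hw hw', framePt_eval
    s (a ≫ f) _ t' _ g w' hw' rfl]
  · refine Finset.sum_congr rfl fun i _ => ?_
    congr 1
    change z.left.appTop (v ⟨i⟩) = t'.left.appTop (a.appTop (v ⟨i⟩))
    rw [hz, Scheme.Hom.comp_appTop]
    rfl
  · ext : 1
    change z.left ≫ f = t'.left ≫ a ≫ f
    rw [hz, Category.assoc]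

variable (hs : ∀ {T : Sch k} (t : T ⟶ openSub U) {b : T ⟶ S.A} (hb : t ≫ openIncl U = b),
  Function.Bijective fun c : Fin n → Fn T => ∑ i, c i • (s i).pull t hb)

include hs

lemma framePt_injective {Z : Scheme.{u}} {f f' : Z ⟶ U} {v v' : ULift.{u} (Fin n) → Γ(Z, ⊤)}
    (h : framePt s f v = framePt s f' v') : f = f' ∧ v = v' := by
  obtain rfl : f = f' := by
    rw [← cancel_mono U.ι]
    exact congrArg IndPt.left h
  refine ⟨rfl, ?_⟩
  have h1 := (IndPt.mk.injEq ..).mp h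
  have h2 := (hs (toOpenSub f) rfl).1 (eq_of_heq h1.2.2)
  funext ⟨i⟩
  exact congrFun h2 i

lemma exists_framePt_eq {Z : Scheme.{u}} (x : IndPt M Z) (f : Z ⟶ U) (h : f ≫ U.ι = x.left) :
    ∃ v, framePt s f v = x := by
  obtain ⟨p, b, σ⟩ := x
  obtain rfl : p = f ≫ U.ι ≫ S.A.hom := by
    rw [← Category.assoc, h]
    exact (Over.w b).symm
  obtain rfl : b = toOpenSub f ≫ openIncl U := Over.OverMorphism.ext h.symm
  obtain ⟨c, hc⟩ := (hs (toOpenSub f) rfl).2 σ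
  refine ⟨fun i => c i.down, ?_⟩
  rw [← hc]
  rfl

end Chart

/-- The affine space over `U` with its universal point. -/
def chartPt {U : S.A.left.Opens} {n : ℕ} (s : Fin n → Sec M (openIncl U)) :
    IndPt M (AffineSpace (ULift.{u} (Fin n)) U) :=
  framePt s (AffineSpace (ULift.{u} (Fin n)) U ↘ (U : Scheme.{u})) (AffineSpace.coord _)

section Representable

variable {U : S.A.left.Opens} {n : ℕ} (s : Fin n → Sec M (openIncl U))

/-- The morphism of presheaves given by a chart. -/
def chartHom : yoneda.obj (AffineSpace (ULift.{u} (Fin n)) U) ⟶ indFunctor M :=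
  yonedaEquiv.symm (chartPt s)

variable (hs : ∀ {T : Sch k} (t : T ⟶ openSub U) {b : T ⟶ S.A} (hb : t ≫ openIncl U = b),
  Function.Bijective fun c : Fin n → Fn T => ∑ i, c i • (s i).pull t hb)

include hs

lemma chartPt_pull_injective {Z : Scheme.{u}} {a a' : Z ⟶ AffineSpace (ULift.{u} (Fin n)) U}
    (h : (chartPt s).pull a = (chartPt s).pull a') : a = a' := by
  rw [chartPt, framePt_pull, framePt_pull] at h
  obtain ⟨h1, h2⟩ := framePt_injective s hs h
  exact AffineSpace.hom_ext h1 fun i => congrFun h2 i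

lemma exists_chartPt_pull_eq {Z : Scheme.{u}} (x : IndPt M Z) (f : Z ⟶ U)
    (h : f ≫ U.ι = x.left) : ∃ a, (chartPt s).pull a = x := by
  obtain ⟨v, hv⟩ := exists_framePt_eq s hs x f h
  refine ⟨AffineSpace.homOfVector f v, ?_⟩
  rw [chartPt, framePt_pull, ← hv]
  congr 1
  · exact AffineSpace.homOfVector_over f v
  · funext i
    exact AffineSpace.homOfVector_appTop_coord f v i

/-- A point over `U` is uniquely a morphism to `U` with a vector of coordinates in the frame, that
is, a point of the affine space over `U`. The chart is therefore the part of the functor lying over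
`U`, and its pullback to `T` is the open subscheme on which the base point lands in `U`. -/
lemma chartHom_isOpenImmersion : IsOpenImmersion.presheaf (chartHom s) := by
  refine MorphismProperty.relative.of_exists fun T g => ?_
  obtain ⟨y : IndPt M T, rfl⟩ := yonedaEquiv.symm.surjective g
  let V : T.Opens := y.left ⁻¹ᵁ U
  obtain ⟨a, ha⟩ := exists_chartPt_pull_eq s hs (y.pull V.ι) (y.left ∣_ U)
    (morphismRestrict_ι y.left U)
  refine ⟨V, yoneda.map a, V.ι, ?_, inferInstance⟩
  refine IsPullback.of_forall_isPullback_app fun ⟨Z⟩ => ?_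
  rw [Limits.Types.isPullback_iff]
  refine ⟨?_, ?_, ?_⟩
  · ext z
    change (chartPt s).pull (z ≫ a) = y.pull (z ≫ V.ι)
    rw [IndPt.pull_comp, ha, ← IndPt.pull_comp]
  · rintro z z' ⟨-, h⟩
    exact (cancel_mono V.ι).1 h
  · intro (c : Z ⟶ _) (t : Z ⟶ T) h
    replace h : (chartPt s).pull c = y.pull t := h
    have ht : Set.range t ⊆ Set.range V.ι := by
      rintro _ ⟨z, rfl⟩
      rw [Scheme.Opens.range_ι]
      -- A point in the image of the chart has its base point in `U`, which forces `t` to factor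
      -- through `V`.
      have h1 : (c ≫ (AffineSpace (ULift.{u} (Fin n)) U ↘ (U : Scheme.{u}))) ≫ U.ι = t ≫ y.left :=
        (Category.assoc _ _ _).trans (congrArg IndPt.left h)
      change y.left (t z) ∈ U
      rw [← Scheme.Hom.comp_apply, ← h1, Scheme.Hom.comp_apply]
      exact Subtype.property _
    refine ⟨IsOpenImmersion.lift V.ι t ht, ?_, IsOpenImmersion.lift_fac _ _ _⟩
    refine chartPt_pull_injective s hs ?_
    change (chartPt s).pull (IsOpenImmersion.lift V.ι t ht ≫ a) = _
    rw [IndPt.pull_comp, ha, ← IndPt.pull_comp, IsOpenImmersion.lift_fac, h]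

end Representable

variable (M) in
-- A Zariski sheaf covered by open immersions from schemes is representable. The charts cover
-- because the opens `U x` cover `A`.
theorem indFunctor_isRepresentable : (indFunctor M).IsRepresentable := by
  choose U hU s hs using exists_sec_frame_pull M
  let F : Sheaf Scheme.zariskiTopology.{u} (Type u) :=
    ⟨indFunctor M, (isSheaf_iff_isSheaf_of_type _ _).2 indFunctor_isSheaf⟩
  let f : ∀ x : S.A.left,
      yoneda.obj (AffineSpace (ULift.{u} (Fin (Module.finrank k M.V))) (U x)) ⟶ F.1 :=
    fun x => chartHom (s x)
  have hf : ∀ x, IsOpenImmersion.presheaf (f x) := fun x => chartHom_isOpenImmersion (s x) (hs x)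
  have : Presheaf.IsLocallySurjective Scheme.zariskiTopology (Limits.Sigma.desc f) := by
    refine ⟨fun {T} (y : IndPt M T) => ?_⟩
    let V : S.A.left → T.Opens := fun x => y.left ⁻¹ᵁ U x
    have hV : iSup V = ⊤ := by
      rw [eq_top_iff]
      rintro t -
      rw [TopologicalSpace.Opens.mem_iSup]
      exact ⟨y.left t, hU _⟩
    refine GrothendieckTopology.superset_covering _ ?_
      (Scheme.Cover.mem_grothendieckTopology (T.openCoverOfIsOpenCover V (.mk hV)))
    rw [Sieve.generate_le_iff]
    rintro Z _ ⟨x⟩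
    obtain ⟨a, ha⟩ := exists_chartPt_pull_eq (s x) (hs x) (y.pull (V x).ι) (y.left ∣_ U x)
      (morphismRestrict_ι y.left (U x))
    refine ⟨(Limits.Sigma.ι (fun x => yoneda.obj
      (AffineSpace (ULift.{u} (Fin (Module.finrank k M.V))) (U x))) x).app _ a, ?_⟩
    have h := congrArg (fun φ => φ.app (Opposite.op ((V x : T.Opens) : Scheme.{u})) a)
      (Limits.Sigma.ι_desc f x)
    exact h.trans ha
  exact Scheme.LocalRepresentability.isRepresentable hf

variable (M) in
lemma exists_universal_indPt : ∃ (X : Scheme.{u}) (x : IndPt M X), ∀ {T : Scheme.{u}}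
    (y : IndPt M T), ∃! f : T ⟶ X, x.pull f = y := by
  obtain ⟨X, ⟨R⟩⟩ := indFunctor_isRepresentable M
  refine ⟨X, R.homEquiv (𝟙 X), fun {T} y => ⟨R.homEquiv.symm y, ?_, fun f hf => ?_⟩⟩
  · exact (R.homEquiv_eq _).symm.trans (R.homEquiv.apply_symm_apply y)
  · exact (Equiv.eq_symm_apply _).2 ((R.homEquiv_eq f).trans hf)

/-- The point `[g, v]` of the induced space. -/
def indPtMk {T : Sch k} (g : T ⟶ S.G) (v : Fn T ⊗[k] M.V) : IndPt M T.left where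
  hom := T.hom
  base := g ≫ S.q
  sec := Sec.ofPt M g rfl v

lemma indPtMk_eval {T : Sch k} (g : T ⟶ S.G) (v : Fn T ⊗[k] M.V) {Z : Sch k}
    (t : Z ⟶ Over.mk (indPtMk g v).hom) (g' : Z ⟶ S.G) (w : t ≫ (indPtMk g v).base = g' ≫ S.q)
    (t' : Z ⟶ T) (e : t'.left = t.left) :
    (indPtMk g v).sec.eval t g' w = tr M (t' ≫ g) g' (ptPull M.V t' v) := by
  obtain rfl : t = t' := Over.OverMorphism.ext e.symm
  exact Sec.eval_ofPt g rfl v t g' w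

lemma indPtMk_w {T : Sch k} (g : T ⟶ S.G) (v : Fn T ⊗[k] M.V) {Z : Sch k}
    (t : Z ⟶ Over.mk (indPtMk g v).hom) (g' : Z ⟶ S.G) (w : t ≫ (indPtMk g v).base = g' ≫ S.q)
    (t' : Z ⟶ T) (e : t'.left = t.left) : (t' ≫ g) ≫ S.q = g' ≫ S.q := by
  obtain rfl : t = t' := Over.OverMorphism.ext e.symm
  exact (Category.assoc _ _ _).trans w

lemma indPtMk_pull {T' T : Sch k} (f : T' ⟶ T) (g : T ⟶ S.G) (v : Fn T ⊗[k] M.V) :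
    (indPtMk g v).pull f.left = indPtMk (f ≫ g) (ptPull M.V f v) := by
  refine IndPt.ext_eval (congrArg (fun z => z.left) (Category.assoc f g S.q).symm)
    fun {Z} t t' g' w w' e => ?_
  let z : Z ⟶ T' := t'
  have hz : z.left = t'.left := rfl
  let y : Z ⟶ Over.mk (indPtMk g v).hom := z ≫ f
  have hw : y ≫ (indPtMk g v).base = g' ≫ S.q := by
    rw [← indPtMk_w _ _ t' g' w' z rfl]
    simp only [Category.assoc]
    exact Category.assoc _ _ _
  refine ((indPtMk g v).pull_eval f.left t g' w y hw (congrArg (· ≫ f.left) e)).trans ?_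
  refine (indPtMk_eval (M := M) _ _ y g' hw (z ≫ f) rfl).trans ?_
  refine Eq.trans ?_ (indPtMk_eval (M := M) _ _ t' g' w' z rfl).symm
  rw [ptPull_comp, Category.assoc]

lemma indPtMk_eq_iff {T : Sch k} (g g' : T ⟶ S.G) (v v' : Fn T ⊗[k] M.V) :
    indPtMk g v = indPtMk g' v' ↔ ∃ h : T ⟶ S.H, g' = g * (h ≫ S.j)⁻¹ ∧ v' = M.ρ T h v := by
  constructor
  · intro h
    have w : g ≫ S.q = g' ≫ S.q := Over.OverMorphism.ext (congrArg IndPt.left h)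
    refine ⟨hdiff g g', by rw [hdiff_j w]; group, ?_⟩
    have h1 := IndPt.eval_congr h (𝟙 T) (𝟙 T) g' ((Category.id_comp _).trans w)
      (Category.id_comp _) rfl
    have h2 := (Sec.eval_ofPt g rfl v (𝟙 T) g' ((Category.id_comp _).trans w)).symm.trans
      (h1.trans (Sec.eval_ofPt g' rfl v' (𝟙 T) g' (Category.id_comp _)))
    rw [ptPull_id, ptPull_id, Category.id_comp, Category.id_comp, tr_self] at h2
    exact h2.symm
  · rintro ⟨h, hg, rfl⟩
    have w : g ≫ S.q = g' ≫ S.q := by rw [hg, q_mul_inv]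
    refine IndPt.ext_eval (congrArg (fun z => z.left) w) fun {Z} t t' g'' w1 w2 e => ?_
    let z : Z ⟶ T := t
    rw [indPtMk_eval (M := M) _ _ t g'' w1 z rfl, indPtMk_eval (M := M) _ _ t' g'' w2 z e]
    have h3 : tr M g g' v = M.ρ T h v := by rw [tr, hdiff_eq' hg]
    rw [← h3, ptPull_tr _ _ w, tr_tr]
    · simp only [Category.assoc, w]
    · exact indPtMk_w _ _ t' g'' w2 z e

variable (M) in
/-- Existence of the quotient `G ×^H V`. -/
theorem exists_inducedSpace : ∃ X : Sch k, Nonempty (InducedSpace S M X) := by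
  obtain ⟨X, x, hx⟩ := exists_universal_indPt M
  choose f hf hf' using fun {T : Scheme.{u}} (y : IndPt M T) => hx y
  -- Morphisms to `X` are determined by the pullback of the universal point, so identities between
  -- them are identities between points of the functor.
  have ext : ∀ {T : Scheme.{u}} {a b : T ⟶ X}, x.pull a = x.pull b → a = b := fun h =>
    (hf' _ _ rfl).trans (hf' _ _ h.symm).symm |>.symm ▸ rfl
  refine ⟨Over.mk x.hom, ⟨{
    κ := fun g v => Over.homMk (f (indPtMk g v)) (congrArg IndPt.hom (hf (indPtMk g v)))
    natural := fun {T' T} t g v => ?_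
    eq_iff := fun {T} g g' v v' => ?_
    lifts := fun {T} z => ?_ }⟩⟩
  · ext : 1
    refine ext ?_
    change x.pull (f _) = x.pull (t.left ≫ f _)
    rw [IndPt.pull_comp, hf, hf, indPtMk_pull]
  · rw [← indPtMk_eq_iff]
    constructor
    · intro h
      rw [← hf (indPtMk g v), ← hf (indPtMk g' v')]
      exact congrArg (fun z => x.pull z.left) h
    · intro h
      ext : 1
      exact congrArg f h
  · obtain ⟨b, s, hs⟩ : ∃ (b : Over.mk T.hom ⟶ S.A) (s : Sec M b), x.pull z.left = ⟨T.hom, b, s⟩ := by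
      have h : (x.pull z.left).hom = T.hom := Over.w z
      generalize x.pull z.left = y at h
      obtain ⟨p, b, s⟩ := y
      subst h
      exact ⟨b, s, rfl⟩
    refine ⟨torsor b, torsor.fst b, torsor.isFpqc b, torsor.snd b, s.1, ?_⟩
    ext : 1
    refine ext ?_
    change x.pull (f _) = x.pull ((torsor.fst b).left ≫ z.left)
    rw [IndPt.pull_comp, hf, hs]
    refine IndPt.ext_eval (congrArg (fun z => z.left) (torsor.w b).symm)
      fun {Z} t t' g w w' e => ?_
    let t₀ : Z ⟶ torsor b := t
    have hw : (t₀ ≫ torsor.fst b) ≫ b = g ≫ S.q := by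
      rw [← w, Category.assoc, torsor.w]
      rfl
    refine (Sec.eval_ofPt _ rfl _ t g w).trans (Eq.trans ?_
      (IndPt.pull_eval _ ⟨T.hom, b, s⟩ t' g w' (t₀ ≫ torsor.fst b) hw
        (congrArg (· ≫ (torsor.fst b).left) e.symm)).symm)
    change tr M (t₀ ≫ torsor.snd b) g (ptPull M.V t₀ s.1) = s.eval (t₀ ≫ torsor.fst b) g hw
    rw [Sec.ptPull_val]
    exact (s.eval_tr _ _ _ _ _).symm

end

end AffExt

/-! ### Comparison of `S`-modules with induced spaces, and the equivalence. -/

namespace AffExt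

noncomputable section

variable {k : Type u} [Field k] {S : AffineExtension k}

/-! ### Points of vector bundles -/

lemma Fib.pull_injective {X A : Sch k} {π : X ⟶ A} {T' T : Sch k} {f : T' ⟶ T} (hf : IsFpqc f)
    {b : T ⟶ A} {e e' : Fib π b} (h : e.pull f = e'.pull f) : e = e' :=
  Subtype.ext (hf.hom_ext (congrArg Subtype.val h))

lemma Fib.pull_map {X X' A : Sch k} {π : X ⟶ A} {π' : X' ⟶ A} (φ : X ⟶ X') (w : φ ≫ π' = π)
    {T' T : Sch k} (f : T' ⟶ T) {b : T ⟶ A} (e : Fib π b) :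
    (e.map φ w).pull f = (e.pull f).map φ w :=
  Subtype.ext (Category.assoc _ _ _).symm

/-- Transport of points along an equality of base points. -/
def Fib.congr {X A : Sch k} {π : X ⟶ A} [VectorBundle π] {T : Sch k} {b b' : T ⟶ A} (h : b = b') :
    Fib π b ≃ₗ[Fn T] Fib π b' where
  toFun e := ⟨e.1, e.2.trans h⟩
  invFun e := ⟨e.1, e.2.trans h.symm⟩
  map_add' _ _ := Subtype.ext (Fib.coe_add_congr h rfl rfl)
  map_smul' c _ := Subtype.ext (Fib.coe_smul_congr h c rfl)
  left_inv _ := rfl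
  right_inv _ := rfl

namespace SModule

lemma act_π (E : SModule S) {T : Sch k} (g : T ⟶ S.G) (e : T ⟶ E.X) :
    E.act g e ≫ E.π = (g ≫ S.q) * (e ≫ E.π) := by
  rw [act, Category.assoc, (E.rep.ρ T g).1.w, MonObj.comp_mul, lift_snd_assoc, lift_fst_assoc,
    E.rep.ρ_deg, Category.id_comp]

lemma act_inv_act (E : SModule S) {T : Sch k} (g : T ⟶ S.G) (e : T ⟶ E.X) :
    E.act g⁻¹ (E.act g e) = e := by
  rw [← act_mul, inv_mul_cancel, act_one]

lemma act_act_inv (E : SModule S) {T : Sch k} (g : T ⟶ S.G) (e : T ⟶ E.X) :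
    E.act g (E.act g⁻¹ e) = e := by
  rw [← act_mul, mul_inv_cancel, act_one]

/-- The action of `g` as a linear isomorphism between fibres. -/
def actEquiv (E : SModule S) {T : Sch k} (g : T ⟶ S.G) {b b' : T ⟶ S.A}
    (h : b' = (g ≫ S.q) * b) : Fib E.π b ≃ₗ[Fn T] Fib E.π b' :=
  have hd : (𝟙 T ≫ (E.rep.ρ T g).1.deg) * b = b' := by
    rw [E.rep.ρ_deg, Category.id_comp, h]
  { toFun := fun e => ⟨E.act g e.1, by rw [act_π, e.2, h]⟩
    map_add' := fun e e' => by
      have h := congrArg Subtype.val ((E.rep.ρ T g).1.map_add (𝟙 T) e e')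
      exact Subtype.ext (h.trans (Fib.coe_add_congr hd rfl rfl))
    map_smul' := fun c e => by
      have h := congrArg Subtype.val ((E.rep.ρ T g).1.map_smul (𝟙 T) c e)
      exact Subtype.ext (h.trans (Fib.coe_smul_congr hd c rfl))
    invFun := fun e => ⟨E.act g⁻¹ e.1, by
      rw [act_π, e.2, h, GrpObj.inv_comp, inv_mul_cancel_left]⟩
    left_inv := fun e => Subtype.ext (E.act_inv_act g e.1)
    right_inv := fun e => Subtype.ext (E.act_act_inv g e.1) }

/-- Every `S`-module is induced from its fibre at the origin. -/
def inducedSpace (E : SModule S) : InducedSpace S E.fibre E.X where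
  κ {T} g v := E.act g (fibreEquiv E.π T v).1
  natural {T' T} f g v := by
    rw [comp_act]
    congr 1
    exact fibreEquiv_pull E.π f v
  eq_iff {T} g g' v v' := by
    constructor
    · intro h
      have w : g ≫ S.q = g' ≫ S.q := by
        have : E.act g _ ≫ E.π = E.act g' _ ≫ E.π := congrArg (· ≫ E.π) h
        rwa [act_π, act_π, (fibreEquiv E.π T v).2, (fibreEquiv E.π T v').2, mul_one,
          mul_one] at this
      refine ⟨hdiff g g', by rw [hdiff_j w]; group, ?_⟩
      apply (fibreEquiv E.π T).injective
      apply Subtype.ext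
      refine Eq.trans ?_ (E.fibreEquiv_ρ (hdiff g g') v).symm
      rw [hdiff_j w, act_mul]
      refine Eq.trans ?_ (congrArg (E.act g'⁻¹) h).symm
      exact (E.act_inv_act _ _).symm
    · rintro ⟨h, rfl, rfl⟩
      refine Eq.trans ?_ (congrArg (E.act _) (E.fibreEquiv_ρ h v)).symm
      rw [← act_mul, inv_mul_cancel_right]
  lifts {T} x := by
    let b := x ≫ E.π
    -- The inverse of the universal lift of `b = π(x)` moves `x` into the fibre over the origin,
    -- where it is given by a vector of `E_0`.
    let y : Fib E.π (1 : torsor b ⟶ S.A) := ⟨E.act (torsor.snd b)⁻¹ (torsor.fst b ≫ x), by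
      rw [act_π, Category.assoc, torsor.w, GrpObj.inv_comp, inv_mul_cancel]⟩
    refine ⟨torsor b, torsor.fst b, torsor.isFpqc b, torsor.snd b,
      (fibreEquiv E.π _).symm y, ?_⟩
    rw [LinearEquiv.apply_symm_apply]
    exact E.act_act_inv _ _

lemma inducedSpace_isCanonical (E : SModule S) : E.inducedSpace.IsCanonical where
  fibre_iso {T} g := ⟨(fibreEquiv E.π T).trans (E.actEquiv g (mul_one _).symm), fun v => rfl⟩
  act g' g v := (E.act_mul _ _ _).symm

end SModule

lemma FinRep.Hom.tr {M N : FinRep S.H} (f : M ⟶ N) {T : Sch k} (g g' : T ⟶ S.G)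
    (v : Fn T ⊗[k] M.V) : f.toLin.baseChange (Fn T) (tr M g g' v) =
      tr N g g' (f.toLin.baseChange (Fn T) v) := f.equivariant _ _

namespace InducedSpace

variable {M N L : FinRep S.H} {E F K : SModule S} {P : InducedSpace S M E.X}
  {Q : InducedSpace S N F.X} {R : InducedSpace S L K.X}

lemma IsCanonical.κ_π (hP : P.IsCanonical) {T : Sch k} (g : T ⟶ S.G) (v : Fn T ⊗[k] M.V) :
    P.κ g v ≫ E.π = g ≫ S.q := by
  obtain ⟨e, he⟩ := hP.fibre_iso g
  rw [← he, (e v).2]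

/-- The rule `[g, v] ↦ [g, f(v)]` does not depend on the representative because `f` commutes with
`tr`. Linearity is checked over the torsor, where both fibres are trivialized by the same lift;
equivariance is checked on local representatives. -/
lemma IsCanonical.exists_hom (hP : P.IsCanonical) (hQ : Q.IsCanonical) (f : M ⟶ N) :
    ∃ φ : E ⟶ F, ∀ {T : Sch k} (g : T ⟶ S.G) (v : Fn T ⊗[k] M.V),
      P.κ g v ≫ φ.hom = Q.κ g (f.toLin.baseChange (Fn T) v) := by
  obtain ⟨φ, hφ⟩ := P.exists_desc_id (fun {T} g v => Q.κ g (f.toLin.baseChange (Fn T) v))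
    (fun a g v => by rw [← Q.natural, ptPull_baseChange])
    (fun g g' v w => by rw [f.tr, Q.κ_tr w])
  have w : φ ≫ F.π = E.π := P.hom_ext fun g v => by
    rw [← Category.assoc, hφ, hP.κ_π, hQ.κ_π]
  have key : ∀ {T : Sch k} (g : T ⟶ S.G) {b : T ⟶ S.A} (_ : b = g ≫ S.q),
      ∃ l : Fib E.π b →ₗ[Fn T] Fib F.π b, ∀ e, l e = e.map φ w := by
    rintro T g _ rfl
    obtain ⟨e, he⟩ := hP.fibre_iso g
    obtain ⟨e', he'⟩ := hQ.fibre_iso g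
    refine ⟨e'.toLinearMap ∘ₗ f.toLin.baseChange (Fn T) ∘ₗ e.symm.toLinearMap, fun x => ?_⟩
    obtain ⟨v, rfl⟩ := e.surjective x
    apply Subtype.ext
    simp only [LinearMap.comp_apply, LinearEquiv.coe_coe, LinearEquiv.symm_apply_apply]
    rw [he', ← hφ, ← he]
    rfl
  refine ⟨⟨φ, ⟨w, fun {T b} x y => ?_, fun {T b} c x => ?_⟩, fun {T} g x => ?_⟩, hφ⟩
  · apply Fib.pull_injective (torsor.isFpqc b)
    obtain ⟨l, hl⟩ := key (torsor.snd b) (torsor.w b)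
    rw [VectorBundle.pull_add, Fib.pull_map, Fib.pull_map, Fib.pull_map, VectorBundle.pull_add,
      ← hl, ← hl, ← hl, map_add]
  · apply Fib.pull_injective (torsor.isFpqc b)
    obtain ⟨l, hl⟩ := key (torsor.snd b) (torsor.w b)
    rw [VectorBundle.pull_smul, Fib.pull_map, Fib.pull_map, VectorBundle.pull_smul,
      ← hl, ← hl, map_smul]
  · obtain ⟨T', a, ha, g', v, h⟩ := P.lifts x
    refine ha.hom_ext ?_
    rw [← Category.assoc, SModule.comp_act, SModule.comp_act, ← Category.assoc, ← h, hφ, hP.act,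
      hφ, hQ.act]

/-- The morphism `[g, v] ↦ [g, f(v)]`. -/
def homMk (hP : P.IsCanonical) (hQ : Q.IsCanonical) (f : M ⟶ N) : E ⟶ F :=
  (hP.exists_hom hQ f).choose

lemma κ_homMk (hP : P.IsCanonical) (hQ : Q.IsCanonical) (f : M ⟶ N) {T : Sch k} (g : T ⟶ S.G)
    (v : Fn T ⊗[k] M.V) :
    P.κ g v ≫ (homMk hP hQ f).hom = Q.κ g (f.toLin.baseChange (Fn T) v) :=
  (hP.exists_hom hQ f).choose_spec g v

lemma rep_hom_ext (P : InducedSpace S M E.X) {φ ψ : E ⟶ F}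
    (h : ∀ {T : Sch k} (g : T ⟶ S.G) (v : Fn T ⊗[k] M.V), P.κ g v ≫ φ.hom = P.κ g v ≫ ψ.hom) :
    φ = ψ := SModule.Hom.ext (P.hom_ext h)

lemma rep_comp_hom {E F K : SModule S} (φ : E ⟶ F) (ψ : F ⟶ K) :
    (φ ≫ ψ).hom = φ.hom ≫ ψ.hom := rfl

lemma homMk_id (hP : P.IsCanonical) : homMk hP hP (𝟙 M) = 𝟙 E := by
  refine rep_hom_ext P fun {T} g v => ?_
  rw [κ_homMk]
  refine Eq.trans ?_ (Category.comp_id _).symm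
  change P.κ g (LinearMap.baseChange (Fn T) LinearMap.id v) = _
  rw [LinearMap.baseChange_id, LinearMap.id_apply]

lemma homMk_comp (hP : P.IsCanonical) (hQ : Q.IsCanonical) (hR : R.IsCanonical) (f : M ⟶ N)
    (f' : N ⟶ L) : homMk hP hR (f ≫ f') = homMk hP hQ f ≫ homMk hQ hR f' := by
  refine rep_hom_ext P fun {T} g v => ?_
  rw [κ_homMk, rep_comp_hom, ← Category.assoc, κ_homMk, κ_homMk]
  change R.κ g (LinearMap.baseChange (Fn T) (f'.toLin ∘ₗ f.toLin) v) = _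
  rw [LinearMap.baseChange_comp, LinearMap.comp_apply]

/-- Two induced spaces of the same module are isomorphic. -/
def isoMk {Q : InducedSpace S M F.X} (hP : P.IsCanonical) (hQ : Q.IsCanonical) : E ≅ F where
  hom := homMk hP hQ (𝟙 M)
  inv := homMk hQ hP (𝟙 M)
  hom_inv_id := by rw [← homMk_comp, Category.id_comp, homMk_id]
  inv_hom_id := by rw [← homMk_comp, Category.id_comp, homMk_id]

lemma κ_isoMk_hom {Q : InducedSpace S M F.X} (hP : P.IsCanonical) (hQ : Q.IsCanonical)
    {T : Sch k} (g : T ⟶ S.G) (v : Fn T ⊗[k] M.V) :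
    P.κ g v ≫ (isoMk hP hQ).hom.hom = Q.κ g v := by
  refine (κ_homMk hP hQ (𝟙 M) g v).trans ?_
  change Q.κ g (LinearMap.baseChange (Fn T) LinearMap.id v) = _
  rw [LinearMap.baseChange_id, LinearMap.id_apply]

end InducedSpace

/-! ### The equivalence -/

variable (S) in
/-- A chosen quotient `G ×^H V`. -/
def Ind.space (M : FinRep S.H) : InducedSpace S M (exists_inducedSpace M).choose :=
  (exists_inducedSpace M).choose_spec.some

variable (S) in
/-- The functor `V ↦ G ×^H V`. -/
def Ind : FinRep S.H ⥤ Rep0 S where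
  obj M := (Ind.space S M).toSModule
  map f := InducedSpace.homMk (Ind.space S _).toSModule_isCanonical
    (Ind.space S _).toSModule_isCanonical f
  map_id M := InducedSpace.homMk_id _
  map_comp f f' := InducedSpace.homMk_comp _ _ _ f f'

/-- The quotient morphism of `G ×^H V`. -/
def Ind.induced (M : FinRep S.H) : InducedSpace S M ((Ind S).obj M).X := Ind.space S M

lemma Ind.isCanonical (M : FinRep S.H) : (Ind.induced M).IsCanonical :=
  (Ind.space S M).toSModule_isCanonical

lemma Ind.κ_map {M N : FinRep S.H} (f : M ⟶ N) {T : Sch k} (g : T ⟶ S.G) (v : Fn T ⊗[k] M.V) :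
    (Ind.induced M).κ g v ≫ ((Ind S).map f).hom =
      (Ind.induced N).κ g (f.toLin.baseChange (Fn T) v) :=
  InducedSpace.κ_homMk (Ind.isCanonical M) (Ind.isCanonical N) f g v

/-- An isomorphism of representations from an equivariant linear isomorphism. -/
def FinRep.isoMk {H : Sch k} [GrpObj H] {M N : FinRep H} (e : M.V ≃ₗ[k] N.V)
    (h : ∀ {T : Sch k} (h : T ⟶ H) (v : Fn T ⊗[k] M.V),
      e.toLinearMap.baseChange (Fn T) (M.ρ T h v) =
        N.ρ T h (e.toLinearMap.baseChange (Fn T) v)) : M ≅ N where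
  hom := ⟨e.toLinearMap, h⟩
  inv := ⟨e.symm.toLinearMap, fun {T} a v => by
    apply (LinearEquiv.baseChange k (Fn T) _ _ e).injective
    have h1 : ∀ x, e.toLinearMap.baseChange (Fn T) (e.symm.toLinearMap.baseChange (Fn T) x) = x :=
      fun x => by
        rw [← LinearMap.comp_apply, ← LinearMap.baseChange_comp]
        simp
    refine (h1 _).trans (Eq.trans ?_ (h _ _).symm)
    rw [h1]⟩
  hom_inv_id := FinRep.Hom.ext (LinearMap.ext e.symm_apply_apply)
  inv_hom_id := FinRep.Hom.ext (LinearMap.ext e.apply_symm_apply)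

namespace InducedSpace

variable {M N : FinRep S.H} {E F : SModule S} {P : InducedSpace S M E.X}

lemma IsCanonical.exists_fibreEquiv (hP : P.IsCanonical) : ∃ e : M.V ≃ₗ[k] Fibre E.π,
    ∀ v, (e v).1 = P.κ 1 (1 ⊗ₜ v) := by
  obtain ⟨e, he⟩ := hP.fibre_iso (1 : 𝟙_ (Sch k) ⟶ S.G)
  -- The functions on `Spec k` are `k`, so points of `V` over `Spec k` are the vectors of `V`.
  have hb : Function.Bijective fun v : M.V => (1 : Fn (𝟙_ (Sch k))) ⊗ₜ[k] v := by
    let e0 : k ≃ₗ[k] Fn (𝟙_ (Sch k)) :=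
      LinearEquiv.ofBijective (Algebra.linearMap k _) algebraMap_unit_bijective
    have := ((TensorProduct.lid k M.V).symm.trans
      (TensorProduct.congr e0 (LinearEquiv.refl k M.V))).bijective
    convert this using 2 with v
    change _ = algebraMap k (Fn (𝟙_ (Sch k))) 1 ⊗ₜ[k] v
    rw [map_one]
  have h1 : (1 : 𝟙_ (Sch k) ⟶ S.G) ≫ S.q = 1 := MonObj.one_comp _
  let l : M.V →ₗ[k] Fibre E.π :=
    { toFun := fun v => Fib.congr h1 (e (1 ⊗ₜ v))
      map_add' := fun v w => by rw [TensorProduct.tmul_add, map_add, map_add]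
      map_smul' := fun c v => by
        rw [TensorProduct.tmul_smul, ← algebraMap_smul (Fn (𝟙_ (Sch k))) c, map_smul, map_smul]
        rfl }
  refine ⟨LinearEquiv.ofBijective l ((Fib.congr h1).bijective.comp (e.bijective.comp hb)),
    fun v => he _⟩

/-- The isomorphism of `V` with the fibre of `G ×^H V`. -/
def IsCanonical.fibreLinEquiv (hP : P.IsCanonical) : M.V ≃ₗ[k] Fibre E.π :=
  hP.exists_fibreEquiv.choose

lemma IsCanonical.fibreLinEquiv_val (hP : P.IsCanonical) (v : M.V) :
    (hP.fibreLinEquiv v).1 = P.κ 1 (1 ⊗ₜ v) := hP.exists_fibreEquiv.choose_spec v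

lemma IsCanonical.fibreEquiv_baseChange (hP : P.IsCanonical) {T : Sch k} (v : Fn T ⊗[k] M.V) :
    (fibreEquiv E.π T (hP.fibreLinEquiv.toLinearMap.baseChange (Fn T) v)).1 = P.κ 1 v := by
  obtain ⟨e, he⟩ := hP.fibre_iso (1 : T ⟶ S.G)
  have h1 : (1 : T ⟶ S.G) ≫ S.q = 1 := MonObj.one_comp _
  have : (fibreEquiv E.π T).toLinearMap ∘ₗ hP.fibreLinEquiv.toLinearMap.baseChange (Fn T) =
      (Fib.congr h1).toLinearMap ∘ₗ e.toLinearMap := by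
    ext v
    apply Subtype.ext
    change (fibreEquiv E.π T (hP.fibreLinEquiv.toLinearMap.baseChange (Fn T) (1 ⊗ₜ v))).1 =
      (e (1 ⊗ₜ v)).1
    rw [LinearMap.baseChange_tmul, fibreEquiv_tmul, one_smul, he]
    change toUnit T ≫ (hP.fibreLinEquiv v).1 = _
    rw [fibreLinEquiv_val, ← P.natural, MonObj.comp_one, ptPull_tmul, map_one]
  exact (congrArg Subtype.val (LinearMap.congr_fun this v)).trans (he v)

/-- The isomorphism of `V` with the fibre of `G ×^H V`. -/
def fibreIso (hP : P.IsCanonical) : M ≅ E.fibre :=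
  FinRep.isoMk hP.fibreLinEquiv fun {T} h v => by
    apply (fibreEquiv E.π T).injective
    apply Subtype.ext
    refine (hP.fibreEquiv_baseChange _).trans ?_
    refine Eq.trans ?_ (E.fibreEquiv_ρ h _).symm
    refine Eq.trans ?_ (congrArg (E.act (h ≫ S.j)) (hP.fibreEquiv_baseChange v)).symm
    rw [hP.act, mul_one, eq_comm, P.eq_iff]
    exact ⟨h, by rw [mul_inv_cancel], rfl⟩

end InducedSpace

variable (S) in
/-- The unit of the equivalence. -/
def indUnit : 𝟭 (FinRep S.H) ≅ Ind S ⋙ fibreFunctor S :=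
  NatIso.ofComponents (fun M => InducedSpace.fibreIso (Ind.isCanonical M)) fun {M N} f => by
    apply FinRep.Hom.ext
    refine LinearMap.ext fun v => Subtype.ext ?_
    change ((Ind.isCanonical N).fibreLinEquiv (f.toLin v)).1 =
      ((Ind.isCanonical M).fibreLinEquiv v).1 ≫ ((Ind S).map f).hom
    rw [InducedSpace.IsCanonical.fibreLinEquiv_val, InducedSpace.IsCanonical.fibreLinEquiv_val,
      Ind.κ_map, LinearMap.baseChange_tmul]

variable (S) in
/-- The counit of the equivalence. -/
def indCounit : fibreFunctor S ⋙ Ind S ≅ 𝟭 (Rep0 S) :=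
  NatIso.ofComponents (fun E => InducedSpace.isoMk (Ind.isCanonical E.fibre)
      E.inducedSpace_isCanonical) fun {E F} φ => by
    refine InducedSpace.rep_hom_ext (Ind.induced E.fibre) fun {T} g v => ?_
    change _ ≫ ((Ind S).map ((fibreFunctor S).map φ)).hom ≫ (InducedSpace.isoMk _ _).hom.hom =
      _ ≫ (InducedSpace.isoMk _ _).hom.hom ≫ φ.hom
    refine (Category.assoc _ _ _).symm.trans ?_
    refine (congrArg (· ≫ _) (Ind.κ_map ((fibreFunctor S).map φ) g v)).trans ?_
    refine (InducedSpace.κ_isoMk_hom _ _ g _).trans ?_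
    refine Eq.trans ?_ (Category.assoc _ _ _)
    refine Eq.trans ?_ (congrArg (· ≫ φ.hom) (InducedSpace.κ_isoMk_hom (Ind.isCanonical E.fibre)
      E.inducedSpace_isCanonical g v).symm)
    refine Eq.trans ?_ (φ.equivariant g (fibreEquiv E.π T v).1).symm
    exact congrArg (F.act g) (congrArg Subtype.val (SModule.Hom.fibreEquiv_fibre φ T v))

variable (S) in
/-- The equivalence of `H`-modules with `S`-modules. -/
def indEquivalence : FinRep S.H ≌ Rep0 S :=
  CategoryTheory.Equivalence.mk (Ind S) (fibreFunctor S) (indUnit S) (indCounit S)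

/-- Both `F` and, through `g · v`, `E` itself are induced spaces of the `H`-module `E_0`. -/
theorem exists_iso_of_isCanonical (E F : Rep0 S) (P : InducedSpace S E.fibre F.X)
    (hP : P.IsCanonical) : ∃ i : F ≅ E, ∀ {T : Sch k} (g : T ⟶ S.G) (v : Fn T ⊗[k] Fibre E.π),
      P.κ g v ≫ i.hom.hom = E.act g (fibreEquiv E.π T v).1 :=
  ⟨InducedSpace.isoMk hP E.inducedSpace_isCanonical, fun g v =>
    InducedSpace.κ_isoMk_hom hP E.inducedSpace_isCanonical g v⟩

end

end AffExt

/-! ### Abelian structure on `H`-modules and on `S`-modules. -/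

namespace AffExt

noncomputable section

namespace FinRep

variable {k : Type u} [Field k] {H : Sch k} [GrpObj H]

/-! ### The category of representations is preadditive -/

@[simp]
lemma id_toLin (M : FinRep H) : FinRep.Hom.toLin (𝟙 M) = LinearMap.id := rfl

@[simp]
lemma comp_toLin {M N L : FinRep H} (f : M ⟶ N) (g : N ⟶ L) :
    (f ≫ g).toLin = g.toLin ∘ₗ f.toLin := rfl

lemma hom_ext {M N : FinRep H} {f g : M ⟶ N} (h : f.toLin = g.toLin) : f = g :=
  FinRep.Hom.ext h

/-- The equivariant linear maps. -/
def equivariantMaps (M N : FinRep H) : AddSubgroup (M.V →ₗ[k] N.V) where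
  carrier := {f | ∀ {T : Sch k} (h : T ⟶ H) (v : Fn T ⊗[k] M.V),
    f.baseChange (Fn T) (M.ρ T h v) = N.ρ T h (f.baseChange (Fn T) v)}
  add_mem' hf hg := fun h v => by
    simp only [LinearMap.baseChange_add, LinearMap.add_apply, map_add, hf h v, hg h v]
  zero_mem' := fun h v => by simp
  neg_mem' hf := fun h v => by
    simp only [LinearMap.baseChange_neg, LinearMap.neg_apply, map_neg, hf h v]

/-- Morphisms of representations are equivariant linear maps. -/
def homEquiv (M N : FinRep H) : (M ⟶ N) ≃ equivariantMaps M N where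
  toFun f := ⟨f.toLin, f.equivariant⟩
  invFun f := ⟨f.1, f.2⟩
  left_inv _ := rfl
  right_inv _ := rfl

instance (M N : FinRep H) : AddCommGroup (M ⟶ N) := (homEquiv M N).addCommGroup

instance : Preadditive (FinRep H) where
  add_comp _ _ _ f f' g := hom_ext (LinearMap.comp_add f.toLin f'.toLin g.toLin)
  comp_add _ _ _ f g g' := hom_ext (LinearMap.add_comp f.toLin g'.toLin g.toLin)

lemma toLin_zero {M N : FinRep H} : FinRep.Hom.toLin (0 : M ⟶ N) = 0 := rfl

lemma toLin_add {M N : FinRep H} (f g : M ⟶ N) :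
    FinRep.Hom.toLin (f + g) = f.toLin + g.toLin := rfl

/-! ### Products -/

/-- The zero representation. -/
def zeroRep : FinRep H where
  V := PUnit.{u + 1}
  ρ _ := 1
  ρ_natural _ _ _ := rfl

instance : Limits.HasZeroObject (FinRep H) :=
  ⟨zeroRep, (Limits.IsZero.iff_id_eq_zero _).2 (hom_ext (LinearMap.ext fun _ => rfl))⟩

lemma ptPull_baseChange_comp {V W : Type u} [AddCommGroup V] [Module k V] [AddCommGroup W]
    [Module k W] (φ : V →ₗ[k] W) {T' T : Sch k} (f : T' ⟶ T) (v : Fn T ⊗[k] V) :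
    φ.baseChange (Fn T') (ptPull V f v) = ptPull W f (φ.baseChange (Fn T) v) :=
  (ptPull_baseChange φ f v).symm

section

variable (M N : FinRep H) {T : Sch k}

lemma fst_inl_baseChange (x : Fn T ⊗[k] M.V) : (LinearMap.fst k M.V N.V).baseChange (Fn T)
    ((LinearMap.inl k M.V N.V).baseChange (Fn T) x) = x := by
  rw [← LinearMap.comp_apply, ← LinearMap.baseChange_comp, LinearMap.fst_comp_inl]
  simp

lemma snd_inr_baseChange (x : Fn T ⊗[k] N.V) : (LinearMap.snd k M.V N.V).baseChange (Fn T)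
    ((LinearMap.inr k M.V N.V).baseChange (Fn T) x) = x := by
  rw [← LinearMap.comp_apply, ← LinearMap.baseChange_comp, LinearMap.snd_comp_inr]
  simp

lemma fst_inr_baseChange (x : Fn T ⊗[k] N.V) : (LinearMap.fst k M.V N.V).baseChange (Fn T)
    ((LinearMap.inr k M.V N.V).baseChange (Fn T) x) = 0 := by
  rw [← LinearMap.comp_apply, ← LinearMap.baseChange_comp, LinearMap.fst_comp_inr]
  simp

lemma snd_inl_baseChange (x : Fn T ⊗[k] M.V) : (LinearMap.snd k M.V N.V).baseChange (Fn T)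
    ((LinearMap.inl k M.V N.V).baseChange (Fn T) x) = 0 := by
  rw [← LinearMap.comp_apply, ← LinearMap.baseChange_comp, LinearMap.snd_comp_inl]
  simp

/-- The diagonal action on the direct sum. -/
def prodAct (h : T ⟶ H) : Module.End (Fn T) (Fn T ⊗[k] (M.V × N.V)) :=
  (LinearMap.inl k M.V N.V).baseChange (Fn T) ∘ₗ M.ρ T h ∘ₗ
      (LinearMap.fst k M.V N.V).baseChange (Fn T) +
    (LinearMap.inr k M.V N.V).baseChange (Fn T) ∘ₗ N.ρ T h ∘ₗ
      (LinearMap.snd k M.V N.V).baseChange (Fn T)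

lemma prodAct_apply (h : T ⟶ H) (v : Fn T ⊗[k] (M.V × N.V)) : prodAct M N h v =
    (LinearMap.inl k M.V N.V).baseChange (Fn T)
        (M.ρ T h ((LinearMap.fst k M.V N.V).baseChange (Fn T) v)) +
      (LinearMap.inr k M.V N.V).baseChange (Fn T)
        (N.ρ T h ((LinearMap.snd k M.V N.V).baseChange (Fn T) v)) := rfl

lemma fst_prodAct (h : T ⟶ H) (v : Fn T ⊗[k] (M.V × N.V)) :
    (LinearMap.fst k M.V N.V).baseChange (Fn T) (prodAct M N h v) =
      M.ρ T h ((LinearMap.fst k M.V N.V).baseChange (Fn T) v) := by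
  rw [prodAct_apply, map_add, fst_inl_baseChange, fst_inr_baseChange, add_zero]

lemma snd_prodAct (h : T ⟶ H) (v : Fn T ⊗[k] (M.V × N.V)) :
    (LinearMap.snd k M.V N.V).baseChange (Fn T) (prodAct M N h v) =
      N.ρ T h ((LinearMap.snd k M.V N.V).baseChange (Fn T) v) := by
  rw [prodAct_apply, map_add, snd_inl_baseChange, snd_inr_baseChange, zero_add]

lemma inl_prodAct (h : T ⟶ H) (v : Fn T ⊗[k] M.V) :
    (LinearMap.inl k M.V N.V).baseChange (Fn T) (M.ρ T h v) =
      prodAct M N h ((LinearMap.inl k M.V N.V).baseChange (Fn T) v) := by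
  rw [prodAct_apply, fst_inl_baseChange, snd_inl_baseChange, map_zero, map_zero, add_zero]

lemma inr_prodAct (h : T ⟶ H) (v : Fn T ⊗[k] N.V) :
    (LinearMap.inr k M.V N.V).baseChange (Fn T) (N.ρ T h v) =
      prodAct M N h ((LinearMap.inr k M.V N.V).baseChange (Fn T) v) := by
  rw [prodAct_apply, fst_inr_baseChange, snd_inr_baseChange, map_zero, map_zero, zero_add]

end

/-- The direct sum of two representations. -/
def prod (M N : FinRep H) : FinRep H where
  V := M.V × N.V
  ρ T :=
    { toFun := prodAct M N
      map_one' := by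
        simp only [prodAct, map_one, Module.End.one_eq_id, LinearMap.id_comp,
          ← LinearMap.baseChange_comp, ← LinearMap.baseChange_add]
        rw [← LinearMap.baseChange_id]
        congr 1
        ext <;> simp
      map_mul' := fun h h' => LinearMap.ext fun x => by
        rw [Module.End.mul_apply, prodAct_apply M N h, fst_prodAct, snd_prodAct, prodAct_apply,
          map_mul, map_mul]
        rfl }
  ρ_natural {T' T} f h v := by
    change prodAct M N (f ≫ h) _ = ptPull _ f (prodAct M N h v)
    rw [prodAct_apply, prodAct_apply, ptPull_baseChange_comp, ptPull_baseChange_comp, M.ρ_natural,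
      N.ρ_natural, ptPull_baseChange_comp, ptPull_baseChange_comp, map_add]

/-- The biproduct structure on the direct sum. -/
def bicone (M N : FinRep H) : Limits.BinaryBicone M N where
  pt := prod M N
  fst := ⟨LinearMap.fst k M.V N.V, fst_prodAct M N⟩
  snd := ⟨LinearMap.snd k M.V N.V, snd_prodAct M N⟩
  inl := ⟨LinearMap.inl k M.V N.V, inl_prodAct M N⟩
  inr := ⟨LinearMap.inr k M.V N.V, inr_prodAct M N⟩
  inl_fst := hom_ext (LinearMap.fst_comp_inl k M.V N.V)
  inl_snd := hom_ext ((LinearMap.snd_comp_inl k M.V N.V).trans toLin_zero.symm)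
  inr_fst := hom_ext ((LinearMap.fst_comp_inr k M.V N.V).trans toLin_zero.symm)
  inr_snd := hom_ext (LinearMap.snd_comp_inr k M.V N.V)

instance : Limits.HasBinaryBiproducts (FinRep H) where
  has_binary_biproduct M N := Limits.hasBinaryBiproduct_of_total (bicone M N)
    (hom_ext ((toLin_add _ _).trans (LinearMap.ext fun x =>
      have h (y : M.V × N.V) : (y.1, 0) + (0, y.2) = y := by simp
      h x)))

instance : Limits.HasFiniteProducts (FinRep H) :=
  have := Limits.HasZeroObject.hasTerminal (C := FinRep H)
  hasFiniteProducts_of_has_binary_and_terminal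

/-! ### Kernels and cokernels -/

/-- The representation on a retract `W` of `M.V`, given by `r ρ i`. -/
def retract (M : FinRep H) {W : Type u} [AddCommGroup W] [Module k W] (i : W →ₗ[k] M.V)
    (r : M.V →ₗ[k] W) (hr : r ∘ₗ i = LinearMap.id)
    (mul : ∀ {T : Sch k} (h h' : T ⟶ H) (w : Fn T ⊗[k] W),
      r.baseChange (Fn T) (M.ρ T h (i.baseChange (Fn T) (r.baseChange (Fn T)
        (M.ρ T h' (i.baseChange (Fn T) w))))) =
      r.baseChange (Fn T) (M.ρ T h (M.ρ T h' (i.baseChange (Fn T) w)))) : FinRep H where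
  V := W
  finite := Module.Finite.of_surjective r fun w => ⟨i w, LinearMap.congr_fun hr w⟩
  ρ T :=
    { toFun := fun h => r.baseChange (Fn T) ∘ₗ M.ρ T h ∘ₗ i.baseChange (Fn T)
      map_one' := by
        rw [map_one, Module.End.one_eq_id, LinearMap.id_comp, ← LinearMap.baseChange_comp, hr,
          LinearMap.baseChange_id]
        rfl
      map_mul' := fun h h' => LinearMap.ext fun w => by
        rw [map_mul]
        exact (mul h h' w).symm }
  ρ_natural {T' T} f h v := by
    change LinearMap.baseChange _ _ (M.ρ T' (f ≫ h) (LinearMap.baseChange _ _ _)) =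
      ptPull _ f (LinearMap.baseChange _ _ (M.ρ T h (LinearMap.baseChange _ _ _)))
    rw [ptPull_baseChange_comp, M.ρ_natural, ptPull_baseChange_comp]

/-- Over a field every linear map splits off its kernel and image. With such an `s`, kernels and
cokernels are given by identities between linear maps, which persist after base change to `𝒪(T)`; no
exactness of base change has to be invoked. -/
lemma exists_pseudoInverse {V W : Type u} [AddCommGroup V] [Module k V] [AddCommGroup W]
    [Module k W] (f : V →ₗ[k] W) : ∃ s : W →ₗ[k] V, f ∘ₗ s ∘ₗ f = f := by
  obtain ⟨t, ht⟩ := f.rangeRestrict.exists_rightInverse_of_surjective f.range_rangeRestrict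
  obtain ⟨s, hs⟩ := LinearMap.exists_extend t
  refine ⟨s, LinearMap.ext fun v => ?_⟩
  have h1 : s (f v) = t (f.rangeRestrict v) := LinearMap.congr_fun hs (f.rangeRestrict v)
  have h2 := congrArg Subtype.val (LinearMap.congr_fun ht (f.rangeRestrict v))
  rw [LinearMap.comp_apply, LinearMap.comp_apply, h1]
  exact h2

lemma baseChange_comp_apply {U V W : Type u} [AddCommGroup U] [Module k U] [AddCommGroup V]
    [Module k V] [AddCommGroup W] [Module k W] (f : U →ₗ[k] V) (g : V →ₗ[k] W) {T : Sch k}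
    (x : Fn T ⊗[k] U) :
    g.baseChange (Fn T) (f.baseChange (Fn T) x) = (g ∘ₗ f).baseChange (Fn T) x := by
  rw [LinearMap.baseChange_comp, LinearMap.comp_apply]

variable {M N : FinRep H} (f : M ⟶ N)

/-- Data of a kernel of `f`, with a linear retraction. -/
lemma exists_kernel : ∃ (K : FinRep H) (i : K ⟶ M) (r : M.V →ₗ[k] K.V) (s : N.V →ₗ[k] M.V),
    f.toLin ∘ₗ i.toLin = 0 ∧ r ∘ₗ i.toLin = LinearMap.id ∧
      i.toLin ∘ₗ r = LinearMap.id - s ∘ₗ f.toLin := by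
  obtain ⟨s, hs⟩ := exists_pseudoInverse f.toLin
  let W := LinearMap.ker f.toLin
  let i : W →ₗ[k] M.V := W.subtype
  let r : M.V →ₗ[k] W := LinearMap.codRestrict W (LinearMap.id - s ∘ₗ f.toLin) fun v => by
    rw [LinearMap.mem_ker, LinearMap.sub_apply, map_sub, sub_eq_zero]
    exact (LinearMap.congr_fun hs v).symm
  have hfi : f.toLin ∘ₗ i = 0 := LinearMap.ext fun w => w.2
  have hri : r ∘ₗ i = LinearMap.id := LinearMap.ext fun w => Subtype.ext (by
    change (w : M.V) - s (f.toLin w) = w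
    rw [show f.toLin w = 0 from w.2, map_zero, sub_zero])
  have hir : i ∘ₗ r = LinearMap.id - s ∘ₗ f.toLin := rfl
  -- The kernel is stable: `i ∘ r = 1 - s ∘ f`, and `f` kills `h · i(w)` by equivariance.
  have key : ∀ {T : Sch k} (h : T ⟶ H) (w : Fn T ⊗[k] W),
      i.baseChange (Fn T) (r.baseChange (Fn T) (M.ρ T h (i.baseChange (Fn T) w))) =
        M.ρ T h (i.baseChange (Fn T) w) := fun {T} h w => by
    rw [baseChange_comp_apply, hir, LinearMap.baseChange_sub, LinearMap.sub_apply,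
      ← baseChange_comp_apply, f.equivariant, baseChange_comp_apply, hfi]
    simp
  exact ⟨retract M i r hri fun h h' w => by rw [key], ⟨i, key⟩, r, s, hfi, hri, hir⟩

/-- Data of a cokernel of `f`, with a linear section. -/
lemma exists_cokernel : ∃ (C : FinRep H) (p : N ⟶ C) (i : C.V →ₗ[k] N.V) (s : N.V →ₗ[k] M.V),
    p.toLin ∘ₗ f.toLin = 0 ∧ p.toLin ∘ₗ i = LinearMap.id ∧
      i ∘ₗ p.toLin = LinearMap.id - f.toLin ∘ₗ s := by
  obtain ⟨s, hs⟩ := exists_pseudoInverse f.toLin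
  let R := LinearMap.range f.toLin
  let p : N.V →ₗ[k] N.V ⧸ R := R.mkQ
  let i : N.V ⧸ R →ₗ[k] N.V := R.liftQ (LinearMap.id - f.toLin ∘ₗ s) (by
    rintro _ ⟨v, rfl⟩
    rw [LinearMap.mem_ker, LinearMap.sub_apply, sub_eq_zero]
    exact (LinearMap.congr_fun hs v).symm)
  have hpf : p ∘ₗ f.toLin = 0 := LinearMap.ext fun v =>
    (Submodule.Quotient.mk_eq_zero R).2 ⟨v, rfl⟩
  have hip : i ∘ₗ p = LinearMap.id - f.toLin ∘ₗ s := Submodule.liftQ_mkQ _ _ _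
  have hpi : p ∘ₗ i = LinearMap.id := by
    refine Submodule.linearMap_qext R ?_
    change p ∘ₗ (i ∘ₗ p) = p
    rw [hip, LinearMap.comp_sub, ← LinearMap.comp_assoc, hpf]
    simp
  -- The action passes to the quotient: `i ∘ p` differs from the identity by elements of the image
  -- of `f`, which is stable and killed by `p`.
  have key : ∀ {T : Sch k} (h : T ⟶ H) (w : Fn T ⊗[k] N.V),
      p.baseChange (Fn T) (N.ρ T h (i.baseChange (Fn T) (p.baseChange (Fn T) w))) =
        p.baseChange (Fn T) (N.ρ T h w) := fun {T} h w => by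
    rw [baseChange_comp_apply, hip, LinearMap.baseChange_sub, LinearMap.sub_apply,
      LinearMap.baseChange_id, LinearMap.id_apply, map_sub, map_sub, ← baseChange_comp_apply,
      ← f.equivariant, baseChange_comp_apply, hpf]
    simp
  exact ⟨retract N i p hpi fun h h' w => key _ _, ⟨p, fun h w => (key h w).symm⟩, i, s, hpf, hpi,
    hip⟩

/-- Lifting along a morphism with a linear retraction. -/
def liftHom {K L M : FinRep H} (i : K ⟶ M) (r : M.V →ₗ[k] K.V) (hri : r ∘ₗ i.toLin = LinearMap.id)
    (l : L ⟶ M) (hl : i.toLin ∘ₗ r ∘ₗ l.toLin = l.toLin) : L ⟶ K :=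
  ⟨r ∘ₗ l.toLin, fun {T} h v => by
    have hl' : ∀ x, i.toLin.baseChange (Fn T) ((r ∘ₗ l.toLin).baseChange (Fn T) x) =
        l.toLin.baseChange (Fn T) x := fun x => by rw [baseChange_comp_apply, hl]
    have hr' : ∀ x, r.baseChange (Fn T) (i.toLin.baseChange (Fn T) x) = x := fun x => by
      rw [baseChange_comp_apply, hri, LinearMap.baseChange_id, LinearMap.id_apply]
    rw [← hr' ((r ∘ₗ l.toLin).baseChange (Fn T) _), hl', l.equivariant, ← hl', ← i.equivariant,
      hr']⟩

/-- Descending along a morphism with a linear section. -/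
def descHom {C L N : FinRep H} (p : N ⟶ C) (i : C.V →ₗ[k] N.V) (hpi : p.toLin ∘ₗ i = LinearMap.id)
    (l : N ⟶ L) (hl : (l.toLin ∘ₗ i) ∘ₗ p.toLin = l.toLin) : C ⟶ L :=
  ⟨l.toLin ∘ₗ i, fun {T} h v => by
    have hl' : ∀ x, (l.toLin ∘ₗ i).baseChange (Fn T) (p.toLin.baseChange (Fn T) x) =
        l.toLin.baseChange (Fn T) x := fun x => by rw [baseChange_comp_apply, hl]
    have hp' : ∀ x, p.toLin.baseChange (Fn T) (i.baseChange (Fn T) x) = x := fun x => by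
      rw [baseChange_comp_apply, hpi, LinearMap.baseChange_id, LinearMap.id_apply]
    rw [← hp' v, ← p.equivariant, hl', hl', l.equivariant]⟩

lemma liftHom_comp {K L M : FinRep H} (i : K ⟶ M) (r : M.V →ₗ[k] K.V)
    (hri : r ∘ₗ i.toLin = LinearMap.id) (l : L ⟶ M) (hl : i.toLin ∘ₗ r ∘ₗ l.toLin = l.toLin) :
    liftHom i r hri l hl ≫ i = l := hom_ext hl

lemma comp_descHom {C L N : FinRep H} (p : N ⟶ C) (i : C.V →ₗ[k] N.V)
    (hpi : p.toLin ∘ₗ i = LinearMap.id) (l : N ⟶ L) (hl : (l.toLin ∘ₗ i) ∘ₗ p.toLin = l.toLin) :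
    p ≫ descHom p i hpi l hl = l := hom_ext hl

lemma mono_of_retraction {K M : FinRep H} (i : K ⟶ M) (r : M.V →ₗ[k] K.V)
    (hri : r ∘ₗ i.toLin = LinearMap.id) : Mono i :=
  ⟨fun a b h => hom_ext (by
    have := congrArg (fun z => r ∘ₗ FinRep.Hom.toLin z) h
    simp only [comp_toLin, ← LinearMap.comp_assoc, hri, LinearMap.id_comp] at this
    exact this)⟩

lemma epi_of_section {N C : FinRep H} (p : N ⟶ C) (i : C.V →ₗ[k] N.V)
    (hpi : p.toLin ∘ₗ i = LinearMap.id) : Epi p :=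
  ⟨fun a b h => hom_ext (by
    have := congrArg (fun z => FinRep.Hom.toLin z ∘ₗ i) h
    simp only [comp_toLin, LinearMap.comp_assoc, hpi, LinearMap.comp_id] at this
    exact this)⟩

instance : Limits.HasKernels (FinRep H) where
  has_limit {M N} f := by
    obtain ⟨K, i, r, s, hfi, hri, hir⟩ := exists_kernel f
    have := mono_of_retraction i r hri
    refine ⟨⟨Limits.KernelFork.ofι i (hom_ext (hfi.trans toLin_zero.symm)), Limits.KernelFork.IsLimit.ofι' _ _
      fun {L} l hl => ⟨liftHom i r hri l ?_, liftHom_comp _ _ _ _ _⟩⟩⟩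
    have h0 : f.toLin ∘ₗ l.toLin = 0 := (congrArg FinRep.Hom.toLin hl).trans toLin_zero
    rw [← LinearMap.comp_assoc, hir, LinearMap.sub_comp, LinearMap.comp_assoc, h0]
    simp

instance : Limits.HasCokernels (FinRep H) where
  has_colimit {M N} f := by
    obtain ⟨C, p, i, s, hpf, hpi, hip⟩ := exists_cokernel f
    have := epi_of_section p i hpi
    refine ⟨⟨Limits.CokernelCofork.ofπ p (hom_ext (hpf.trans toLin_zero.symm)), Limits.CokernelCofork.IsColimit.ofπ' _ _
      fun {L} l hl => ⟨descHom p i hpi l ?_, comp_descHom _ _ _ _ _⟩⟩⟩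
    have h0 : l.toLin ∘ₗ f.toLin = 0 := (congrArg FinRep.Hom.toLin hl).trans toLin_zero
    rw [LinearMap.comp_assoc, hip, LinearMap.comp_sub, ← LinearMap.comp_assoc, h0]
    simp

lemma exists_retraction_of_mono [Mono f] : ∃ s : N.V →ₗ[k] M.V, s ∘ₗ f.toLin = LinearMap.id := by
  obtain ⟨K, i, r, s, hfi, hri, hir⟩ := exists_kernel f
  have h0 : i = 0 := by
    rw [← cancel_mono f, Limits.zero_comp]
    exact hom_ext (hfi.trans toLin_zero.symm)
  refine ⟨s, ?_⟩
  rw [h0, toLin_zero, LinearMap.zero_comp] at hir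
  exact (sub_eq_zero.1 hir.symm).symm

lemma exists_section_of_epi [Epi f] : ∃ s : N.V →ₗ[k] M.V, f.toLin ∘ₗ s = LinearMap.id := by
  obtain ⟨C, p, i, s, hpf, hpi, hip⟩ := exists_cokernel f
  have h0 : p = 0 := by
    rw [← cancel_epi f, Limits.comp_zero]
    exact hom_ext (hpf.trans toLin_zero.symm)
  refine ⟨s, ?_⟩
  rw [h0, toLin_zero, LinearMap.comp_zero] at hip
  exact (sub_eq_zero.1 hip.symm).symm

/-- A monomorphism is the kernel of its cokernel: a vector killed by `p` equals `f (s v)` because `i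
∘ p = 1 - f ∘ s`, and the linear retraction of `f` provides the factorization. -/
instance : IsNormalMonoCategory (FinRep H) where
  normalMonoOfMono {M N} f _ := by
    obtain ⟨r, hr⟩ := exists_retraction_of_mono f
    obtain ⟨C, p, i, s, hpf, hpi, hip⟩ := exists_cokernel f
    refine ⟨⟨C, p, hom_ext (hpf.trans toLin_zero.symm), Limits.KernelFork.IsLimit.ofι' _ _
      fun {L} l hl => ⟨liftHom f r hr l ?_, liftHom_comp _ _ _ _ _⟩⟩⟩
    have h0 : p.toLin ∘ₗ l.toLin = 0 := (congrArg FinRep.Hom.toLin hl).trans toLin_zero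
    refine LinearMap.ext fun v => ?_
    have h1 : f.toLin (s (l.toLin v)) = l.toLin v := by
      have h2 := LinearMap.congr_fun hip (l.toLin v)
      rw [LinearMap.comp_apply, show p.toLin (l.toLin v) = 0 from LinearMap.congr_fun h0 v,
        map_zero] at h2
      exact (sub_eq_zero.1 h2.symm).symm
    rw [LinearMap.comp_apply, LinearMap.comp_apply, ← h1]
    exact congrArg f.toLin (LinearMap.congr_fun hr _)

instance : IsNormalEpiCategory (FinRep H) where
  normalEpiOfEpi {M N} f _ := by
    obtain ⟨s, hs⟩ := exists_section_of_epi f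
    obtain ⟨K, i, r, t, hfi, hri, hir⟩ := exists_kernel f
    refine ⟨⟨K, i, hom_ext (hfi.trans toLin_zero.symm), Limits.CokernelCofork.IsColimit.ofπ' _ _
      fun {L} l hl => ⟨descHom f s hs l ?_, comp_descHom _ _ _ _ _⟩⟩⟩
    have h0 : l.toLin ∘ₗ i.toLin = 0 := (congrArg FinRep.Hom.toLin hl).trans toLin_zero
    have h1 : ∀ v, l.toLin (t (f.toLin v)) = l.toLin v := fun v => by
      have h2 := congrArg l.toLin (LinearMap.congr_fun hir v)
      rw [LinearMap.comp_apply, show l.toLin (i.toLin (r v)) = 0 from LinearMap.congr_fun h0 _,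
        LinearMap.sub_apply, map_sub] at h2
      exact (sub_eq_zero.1 h2.symm).symm
    refine LinearMap.ext fun v => ?_
    rw [LinearMap.comp_apply, LinearMap.comp_apply, ← h1, ← h1 v]
    exact congrArg (fun w => l.toLin (t w)) (LinearMap.congr_fun hs (f.toLin v))

instance : Abelian (FinRep H) where

end FinRep

theorem nonempty_abelian {k : Type u} [Field k] (S : AffineExtension k) :
    Nonempty (Abelian (Rep0 S)) := by
  let e := (indEquivalence S).symm
  -- The addition of morphisms of `S`-modules is read off on the fibres at the origin.
  let : Preadditive (Rep0 S) := Preadditive.ofFullyFaithful e.fullyFaithfulFunctor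
  have : Limits.HasFiniteProducts (Rep0 S) :=
    ⟨fun _ => Adjunction.hasLimitsOfShape_of_equivalence e.functor⟩
  exact ⟨abelianOfEquivalence e.functor⟩

end

end AffExt

/-! ### Tensor products of `H`-modules. -/

namespace AffExt

noncomputable section

/-! ### The product of points of two vector spaces -/

section

variable {k : Type u} [Field k] (R : Type u) [CommRing R] [Algebra k R]
variable {V W U V' W' : Type u} [AddCommGroup V] [Module k V] [AddCommGroup W] [Module k W]
  [AddCommGroup U] [Module k U] [AddCommGroup V'] [Module k V'] [AddCommGroup W'] [Module k W']

variable (V W) in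
/-- The product `(R ⊗ V) × (R ⊗ W) → R ⊗ (V ⊗ W)`. -/
def ptMul : R ⊗[k] V →ₗ[R] R ⊗[k] W →ₗ[R] R ⊗[k] (V ⊗[k] W) :=
  (TensorProduct.mk R _ _).compr₂
    (TensorProduct.AlgebraTensorModule.distribBaseChange k R V W).symm.toLinearMap

lemma ptMul_tmul_tmul (a b : R) (v : V) (w : W) :
    ptMul R V W (a ⊗ₜ v) (b ⊗ₜ w) = (a * b) ⊗ₜ[k] (v ⊗ₜ[k] w) := by
  rw [mul_comm]
  rfl

lemma isTensorProduct_ptMul : IsTensorProduct (ptMul R V W (k := k)) := by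
  have : TensorProduct.lift (ptMul R V W (k := k)) =
      (TensorProduct.AlgebraTensorModule.distribBaseChange k R V W).symm.toLinearMap :=
    TensorProduct.ext' fun x y => rfl
  rw [IsTensorProduct, this]
  exact LinearEquiv.bijective _

/-- Products of points of `V` and of `W` generate the points of `V ⊗ W` additively, so linear
identities need only be checked on them, even though the action of `H` does not preserve the form `1
⊗ v`. -/
lemma ptMul_ext {N : Type*} [AddCommGroup N] [Module R N] {f g : R ⊗[k] (V ⊗[k] W) →ₗ[R] N}
    (h : ∀ x y, f (ptMul R V W x y) = g (ptMul R V W x y)) : f = g := by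
  refine LinearMap.ext fun z => (isTensorProduct_ptMul R).inductionOn z ?_ h fun x y hx hy => ?_
  · rw [map_zero, map_zero]
  · rw [map_add, map_add, hx, hy]

lemma baseChange_map_ptMul (f : V →ₗ[k] V') (g : W →ₗ[k] W') (x : R ⊗[k] V) (y : R ⊗[k] W) :
    (TensorProduct.map f g).baseChange R (ptMul R V W x y) =
      ptMul R V' W' (f.baseChange R x) (g.baseChange R y) := by
  induction x using TensorProduct.induction_on with
  | zero => simp only [map_zero, LinearMap.zero_apply]
  | add x x' hx hx' => simp only [map_add, LinearMap.add_apply, hx, hx']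
  | tmul a v =>
    induction y using TensorProduct.induction_on with
    | zero => simp only [map_zero]
    | add y y' hy hy' => simp only [map_add, hy, hy']
    | tmul b w => simp only [ptMul_tmul_tmul, LinearMap.baseChange_tmul, TensorProduct.map_tmul]

lemma baseChange_comm_ptMul (x : R ⊗[k] V) (y : R ⊗[k] W) :
    (TensorProduct.comm k V W).toLinearMap.baseChange R (ptMul R V W x y) = ptMul R W V y x := by
  induction x using TensorProduct.induction_on with
  | zero => simp only [map_zero, LinearMap.zero_apply]
  | add x x' hx hx' => simp only [map_add, LinearMap.add_apply, hx, hx']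
  | tmul a v =>
    induction y using TensorProduct.induction_on with
    | zero => simp only [map_zero, LinearMap.zero_apply]
    | add y y' hy hy' => simp only [map_add, LinearMap.add_apply, hy, hy']
    | tmul b w =>
      rw [ptMul_tmul_tmul, ptMul_tmul_tmul, LinearMap.baseChange_tmul, mul_comm]
      rfl

lemma baseChange_assoc_ptMul (x : R ⊗[k] V) (y : R ⊗[k] W) (z : R ⊗[k] U) :
    (TensorProduct.assoc k V W U).toLinearMap.baseChange R
      (ptMul R (V ⊗[k] W) U (ptMul R V W x y) z) = ptMul R V (W ⊗[k] U) x (ptMul R W U y z) := by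
  induction x using TensorProduct.induction_on with
  | zero => simp only [map_zero, LinearMap.zero_apply]
  | add x x' hx hx' => simp only [map_add, LinearMap.add_apply, hx, hx']
  | tmul a v =>
    induction y using TensorProduct.induction_on with
    | zero => simp only [map_zero, LinearMap.zero_apply]
    | add y y' hy hy' => simp only [map_add, LinearMap.add_apply, hy, hy']
    | tmul b w =>
      induction z using TensorProduct.induction_on with
      | zero => simp only [map_zero]
      | add z z' hz hz' => simp only [map_add, hz, hz']
      | tmul c u =>
        simp only [ptMul_tmul_tmul, LinearMap.baseChange_tmul, mul_assoc]
        rfl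

lemma baseChange_lid_ptMul (c : R) (x : R ⊗[k] V) :
    (TensorProduct.lid k V).toLinearMap.baseChange R (ptMul R k V (c ⊗ₜ 1) x) = c • x := by
  induction x using TensorProduct.induction_on with
  | zero => simp only [map_zero, smul_zero]
  | add x x' hx hx' => simp only [map_add, smul_add, hx, hx']
  | tmul a v =>
    rw [ptMul_tmul_tmul, LinearMap.baseChange_tmul, LinearEquiv.coe_coe, TensorProduct.lid_tmul,
      one_smul, TensorProduct.smul_tmul', smul_eq_mul]

lemma baseChange_rid_ptMul (c : R) (x : R ⊗[k] V) :
    (TensorProduct.rid k V).toLinearMap.baseChange R (ptMul R V k x (c ⊗ₜ 1)) = c • x := by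
  induction x using TensorProduct.induction_on with
  | zero => simp only [map_zero, smul_zero, LinearMap.zero_apply]
  | add x x' hx hx' => simp only [map_add, smul_add, hx, hx', LinearMap.add_apply]
  | tmul a v =>
    rw [ptMul_tmul_tmul, LinearMap.baseChange_tmul, LinearEquiv.coe_coe, TensorProduct.rid_tmul,
      one_smul, TensorProduct.smul_tmul', smul_eq_mul, mul_comm]

lemma exists_eq_tmul_one (x : R ⊗[k] k) : ∃ c : R, x = c ⊗ₜ 1 := by
  induction x using TensorProduct.induction_on with
  | zero => exact ⟨0, (TensorProduct.zero_tmul _ _).symm⟩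
  | add x y hx hy =>
    obtain ⟨c, rfl⟩ := hx
    obtain ⟨d, rfl⟩ := hy
    exact ⟨c + d, (TensorProduct.add_tmul _ _ _).symm⟩
  | tmul c a =>
    refine ⟨a • c, ?_⟩
    rw [TensorProduct.smul_tmul, smul_eq_mul, mul_one]

variable {R}

/-- The tensor product of two endomorphisms of the points. -/
def ptTensor (f : Module.End R (R ⊗[k] V)) (g : Module.End R (R ⊗[k] W)) :
    Module.End R (R ⊗[k] (V ⊗[k] W)) :=
  (isTensorProduct_ptMul R).map (isTensorProduct_ptMul R) f g

lemma ptTensor_ptMul (f : Module.End R (R ⊗[k] V)) (g : Module.End R (R ⊗[k] W)) (x : R ⊗[k] V)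
    (y : R ⊗[k] W) : ptTensor f g (ptMul R V W x y) = ptMul R V W (f x) (g y) :=
  IsTensorProduct.map_eq _ _ _ _ _ _

end

lemma ptPull_ptMul {k : Type u} [Field k] {V W : Type u} [AddCommGroup V] [Module k V]
    [AddCommGroup W] [Module k W] {T' T : Sch k} (t : T' ⟶ T) (x : Fn T ⊗[k] V)
    (y : Fn T ⊗[k] W) :
    ptPull (V ⊗[k] W) t (ptMul (Fn T) V W x y) =
      ptMul (Fn T') V W (ptPull V t x) (ptPull W t y) := by
  induction x using TensorProduct.induction_on with
  | zero => simp only [map_zero, LinearMap.zero_apply]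
  | add x x' hx hx' => simp only [map_add, LinearMap.add_apply, hx, hx']
  | tmul a v =>
    induction y using TensorProduct.induction_on with
    | zero => simp only [map_zero]
    | add y y' hy hy' => simp only [map_add, hy, hy']
    | tmul b w => simp only [ptMul_tmul_tmul, ptPull_tmul, map_mul]

namespace FinRep

variable {k : Type u} [Field k] {H : Sch k} [GrpObj H]

/-! ### Tensor products of representations -/

/-- The tensor product of two representations. -/
def tensor (M N : FinRep H) : FinRep H where
  V := M.V ⊗[k] N.V
  ρ T :=
    { toFun := fun h => ptTensor (M.ρ T h) (N.ρ T h)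
      map_one' := ptMul_ext _ fun x y => by
        rw [ptTensor_ptMul, map_one, map_one]
        rfl
      map_mul' := fun h h' => ptMul_ext _ fun x y => by
        rw [Module.End.mul_apply, ptTensor_ptMul, ptTensor_ptMul, ptTensor_ptMul, map_mul, map_mul]
        rfl }
  ρ_natural {T' T} t h v := by
    change ptTensor _ _ _ = ptPull _ t (ptTensor _ _ v)
    refine (isTensorProduct_ptMul (Fn T)).inductionOn v ?_ (fun x y => ?_) fun x y hx hy => ?_
    · simp only [map_zero]
    · rw [ptPull_ptMul, ptTensor_ptMul, ptTensor_ptMul, ptPull_ptMul, M.ρ_natural, N.ρ_natural]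
    · simp only [map_add, hx, hy]

lemma tensor_ρ_ptMul (M N : FinRep H) {T : Sch k} (h : T ⟶ H) (x : Fn T ⊗[k] M.V)
    (y : Fn T ⊗[k] N.V) : (tensor M N).ρ T h (ptMul (Fn T) M.V N.V x y) =
      ptMul (Fn T) M.V N.V (M.ρ T h x) (N.ρ T h y) := ptTensor_ptMul _ _ _ _

/-- A linear map out of a tensor product is equivariant if it is so on products. -/
def tensorDesc {M N L : FinRep H} (f : M.V ⊗[k] N.V →ₗ[k] L.V)
    (hf : ∀ {T : Sch k} (h : T ⟶ H) (x : Fn T ⊗[k] M.V) (y : Fn T ⊗[k] N.V),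
      f.baseChange (Fn T) (ptMul (Fn T) M.V N.V (M.ρ T h x) (N.ρ T h y)) =
        L.ρ T h (f.baseChange (Fn T) (ptMul (Fn T) M.V N.V x y))) : tensor M N ⟶ L :=
  ⟨f, fun {T} h v => by
    have : f.baseChange (Fn T) ∘ₗ (ptTensor (M.ρ T h) (N.ρ T h)) =
        L.ρ T h ∘ₗ f.baseChange (Fn T) := ptMul_ext _ fun x y => by
      rw [LinearMap.comp_apply, LinearMap.comp_apply, ptTensor_ptMul]
      exact hf h x y
    exact LinearMap.congr_fun this v⟩

/-- The tensor product of two morphisms. -/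
def tensorMap {M M' N N' : FinRep H} (f : M ⟶ M') (g : N ⟶ N') : tensor M N ⟶ tensor M' N' :=
  tensorDesc (L := tensor M' N') (TensorProduct.map f.toLin g.toLin) fun {T} h x y => by
    refine (baseChange_map_ptMul _ _ _ _ _).trans ?_
    refine Eq.trans ?_ (congrArg _ (baseChange_map_ptMul _ _ _ _ _).symm)
    rw [tensor_ρ_ptMul, f.equivariant, g.equivariant]

/-- The trivial representation. -/
def unit : FinRep H where
  V := k
  ρ _ := 1
  ρ_natural _ _ _ := rfl

/-- Passes from products `x y` to arbitrary points of the first tensor product; it is what the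
equivariance of the associator needs. -/
lemma tensorDesc₃ {M N L K : FinRep H} (f : (M.V ⊗[k] N.V) ⊗[k] L.V →ₗ[k] K.V)
    (hf : ∀ {T : Sch k} (h : T ⟶ H) (x : Fn T ⊗[k] M.V) (y : Fn T ⊗[k] N.V) (z : Fn T ⊗[k] L.V),
      f.baseChange (Fn T) (ptMul (Fn T) (M.V ⊗[k] N.V) L.V
          (ptMul (Fn T) M.V N.V (M.ρ T h x) (N.ρ T h y)) (L.ρ T h z)) =
        K.ρ T h (f.baseChange (Fn T) (ptMul (Fn T) (M.V ⊗[k] N.V) L.V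
          (ptMul (Fn T) M.V N.V x y) z)))
    {T : Sch k} (h : T ⟶ H) (p : Fn T ⊗[k] (M.V ⊗[k] N.V)) (z : Fn T ⊗[k] L.V) :
    f.baseChange (Fn T) (ptMul (Fn T) (M.V ⊗[k] N.V) L.V ((tensor M N).ρ T h p) (L.ρ T h z)) =
      K.ρ T h (f.baseChange (Fn T) (ptMul (Fn T) (M.V ⊗[k] N.V) L.V p z)) := by
  have : f.baseChange (Fn T) ∘ₗ (ptMul (Fn T) (M.V ⊗[k] N.V) L.V).flip (L.ρ T h z) ∘ₗ
        ptTensor (M.ρ T h) (N.ρ T h) =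
      K.ρ T h ∘ₗ f.baseChange (Fn T) ∘ₗ (ptMul (Fn T) (M.V ⊗[k] N.V) L.V).flip z :=
    ptMul_ext _ fun x y => by
      simp only [LinearMap.comp_apply, LinearMap.flip_apply, ptTensor_ptMul]
      exact hf h x y z
  exact LinearMap.congr_fun this p

/-- The associator. -/
def assoc (M N L : FinRep H) : tensor (tensor M N) L ≅ tensor M (tensor N L) :=
  let f : tensor (tensor M N) L ⟶ tensor M (tensor N L) :=
    tensorDesc (M := tensor M N) (L := tensor M (tensor N L))
      (TensorProduct.assoc k M.V N.V L.V).toLinearMap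
      (tensorDesc₃ (K := tensor M (tensor N L)) _ fun {T} h x y z => by
        refine (baseChange_assoc_ptMul _ _ _ _).trans ?_
        refine Eq.trans ?_ (congrArg _ (baseChange_assoc_ptMul _ _ _ _).symm)
        refine Eq.trans ?_ (tensor_ρ_ptMul M (tensor N L) h _ _).symm
        exact congrArg _ (tensor_ρ_ptMul N L h _ _).symm)
  FinRep.isoMk (M := tensor (tensor M N) L) (N := tensor M (tensor N L))
    (TensorProduct.assoc k M.V N.V L.V) f.equivariant

/-- The left unitor. -/
def lid (M : FinRep H) : tensor unit M ≅ M :=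
  let f : tensor unit M ⟶ M := tensorDesc (M := unit) (TensorProduct.lid k M.V).toLinearMap
    fun {T} h x y => by
      obtain ⟨c, rfl⟩ := exists_eq_tmul_one _ x
      refine (baseChange_lid_ptMul _ _ _).trans ?_
      refine Eq.trans ?_ (congrArg _ (baseChange_lid_ptMul _ _ _).symm)
      rw [map_smul]
  FinRep.isoMk (M := tensor unit M) (TensorProduct.lid k M.V) f.equivariant

/-- The right unitor. -/
def rid (M : FinRep H) : tensor M unit ≅ M :=
  let f : tensor M unit ⟶ M := tensorDesc (N := unit) (TensorProduct.rid k M.V).toLinearMap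
    fun {T} h x y => by
      obtain ⟨c, rfl⟩ := exists_eq_tmul_one _ y
      refine (baseChange_rid_ptMul _ _ _).trans ?_
      refine Eq.trans ?_ (congrArg _ (baseChange_rid_ptMul _ _ _).symm)
      rw [map_smul]
  FinRep.isoMk (M := tensor M unit) (TensorProduct.rid k M.V) f.equivariant

/-- The braiding. -/
def comm (M N : FinRep H) : tensor M N ≅ tensor N M :=
  let f : tensor M N ⟶ tensor N M :=
    tensorDesc (L := tensor N M) (TensorProduct.comm k M.V N.V).toLinearMap
      fun {T} h x y => by
        refine (baseChange_comm_ptMul _ _ _).trans ?_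
        refine Eq.trans ?_ (congrArg _ (baseChange_comm_ptMul _ _ _).symm)
        exact (tensor_ρ_ptMul N M h _ _).symm
  FinRep.isoMk (M := tensor M N) (N := tensor N M) (TensorProduct.comm k M.V N.V) f.equivariant

instance : MonoidalCategoryStruct (FinRep H) where
  tensorObj := tensor
  whiskerLeft M _ _ f := tensorMap (𝟙 M) f
  whiskerRight f N := tensorMap f (𝟙 N)
  tensorHom := tensorMap
  tensorUnit := unit
  associator := assoc
  leftUnitor := lid
  rightUnitor := rid

/-- A morphism is determined by its linear map, so the coherence laws are those of vector spaces,
checked on pure tensors; the ones involving the unit use linearity. -/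
instance : MonoidalCategory (FinRep H) where
  tensorHom_def f g := hom_ext (TensorProduct.ext' fun _ _ => rfl)
  id_tensorHom_id M N := hom_ext (TensorProduct.ext' fun _ _ => rfl)
  tensorHom_comp_tensorHom f g f' g' := hom_ext (TensorProduct.ext' fun _ _ => rfl)
  whiskerLeft_id M N := hom_ext (TensorProduct.ext' fun _ _ => rfl)
  id_whiskerRight M N := hom_ext (TensorProduct.ext' fun _ _ => rfl)
  associator_naturality f g h := hom_ext (TensorProduct.ext_threefold fun _ _ _ => rfl)
  leftUnitor_naturality f := hom_ext (TensorProduct.ext' fun (a : k) v => (map_smul f.toLin a v).symm)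
  rightUnitor_naturality f := hom_ext (TensorProduct.ext' fun v (a : k) => (map_smul f.toLin a v).symm)
  pentagon M N L K := hom_ext (TensorProduct.ext_fourfold fun _ _ _ _ => rfl)
  triangle M N := hom_ext (TensorProduct.ext_threefold fun v (a : k) w =>
    (TensorProduct.smul_tmul a v w).symm)

/-- The braiding serves to obtain left duals from right duals. -/
instance : BraidedCategory (FinRep H) where
  braiding := comm
  braiding_naturality_right M _ _ f := hom_ext (TensorProduct.ext' fun _ _ => rfl)
  braiding_naturality_left f M := hom_ext (TensorProduct.ext' fun _ _ => rfl)
  hexagon_forward M N L := hom_ext (TensorProduct.ext_threefold fun _ _ _ => rfl)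
  hexagon_reverse M N L := by
    -- Composing with the associator makes the source `(M ⊗ N) ⊗ L`, on which maps are determined by
    -- pure tensors bracketed to the left.
    rw [← cancel_epi (α_ M N L).hom]
    exact hom_ext (TensorProduct.ext_threefold fun _ _ _ => rfl)

end FinRep

end

end AffExt

/-! ### Duals and rigidity of `H`-modules. -/

namespace AffExt

noncomputable section

/-! ### The pairing of a vector space with its dual -/

section

variable {k : Type u} [Field k] (R : Type u) [CommRing R] [Algebra k R]
variable (V : Type u) [AddCommGroup V] [Module k V]

/-- The evaluation pairing `(R ⊗ V*) × (R ⊗ V) → R`. -/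
def ptPair : R ⊗[k] Module.Dual k V →ₗ[R] Module.Dual R (R ⊗[k] V) :=
  (ptMul R (Module.Dual k V) V).compr₂
    ((TensorProduct.AlgebraTensorModule.rid k R R).toLinearMap ∘ₗ
      (contractLeft k V).baseChange R)

variable {V}

lemma ptPair_tmul_tmul (a b : R) (ξ : Module.Dual k V) (v : V) :
    ptPair R V (a ⊗ₜ ξ) (b ⊗ₜ v) = ξ v • (a * b) := by
  change TensorProduct.AlgebraTensorModule.rid k R R
    ((contractLeft k V).baseChange R (ptMul R (Module.Dual k V) V (a ⊗ₜ ξ) (b ⊗ₜ v))) = _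
  rw [ptMul_tmul_tmul, LinearMap.baseChange_tmul, contractLeft_apply,
    TensorProduct.AlgebraTensorModule.rid_tmul]

lemma baseChange_contractLeft_ptMul (x : R ⊗[k] Module.Dual k V) (y : R ⊗[k] V) :
    (contractLeft k V).baseChange R (ptMul R (Module.Dual k V) V x y) =
      ptPair R V x y ⊗ₜ[k] (1 : k) :=
  ((TensorProduct.AlgebraTensorModule.rid k R R).symm_apply_apply _).symm

variable {n : Type*} [Fintype n] (b : Module.Basis n k V)

lemma sum_ptPair_coord_smul (y : R ⊗[k] V) :
    ∑ i, ptPair R V (1 ⊗ₜ b.coord i) y • ((1 : R) ⊗ₜ[k] b i) = y := by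
  induction y using TensorProduct.induction_on with
  | zero => simp only [map_zero, zero_smul, Finset.sum_const_zero]
  | add x y hx hy =>
    simp only [map_add, add_smul, Finset.sum_add_distrib]
    rw [hx, hy]
  | tmul a v =>
    conv_rhs => rw [← b.sum_repr v, TensorProduct.tmul_sum]
    refine Finset.sum_congr rfl fun i _ => ?_
    rw [ptPair_tmul_tmul, one_mul, TensorProduct.smul_tmul', smul_eq_mul, mul_one,
      TensorProduct.smul_tmul, Module.Basis.coord_apply]

lemma sum_ptPair_smul_coord (x : R ⊗[k] Module.Dual k V) :
    ∑ i, ptPair R V x (1 ⊗ₜ b i) • ((1 : R) ⊗ₜ[k] b.coord i) = x := by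
  induction x using TensorProduct.induction_on with
  | zero => simp only [map_zero, zero_smul, Finset.sum_const_zero, LinearMap.zero_apply]
  | add x y hx hy =>
    simp only [map_add, add_smul, Finset.sum_add_distrib, LinearMap.add_apply]
    rw [hx, hy]
  | tmul a ξ =>
    have h : ∑ i, ξ (b i) • b.coord i = ξ := b.ext fun j => by
      classical
      rw [LinearMap.sum_apply]
      simp [Finsupp.single_apply]
    conv_rhs => rw [← h, TensorProduct.tmul_sum]
    refine Finset.sum_congr rfl fun i _ => ?_
    rw [ptPair_tmul_tmul, mul_one, TensorProduct.smul_tmul', smul_eq_mul, mul_one,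
      TensorProduct.smul_tmul]

lemma ptPair_bijective [Module.Finite k V] : Function.Bijective (ptPair R V (k := k)) := by
  let b := Module.finBasis k V
  refine ⟨fun x y h => ?_, fun φ => ⟨∑ i, φ (1 ⊗ₜ b i) • ((1 : R) ⊗ₜ[k] b.coord i), ?_⟩⟩
  · rw [← sum_ptPair_smul_coord R b x, h, sum_ptPair_smul_coord]
  · refine LinearMap.ext fun y => ?_
    conv_rhs => rw [← sum_ptPair_coord_smul R b y, map_sum]
    rw [map_sum, LinearMap.sum_apply]
    refine Finset.sum_congr rfl fun i _ => ?_
    rw [map_smul, map_smul, LinearMap.smul_apply, smul_eq_mul, smul_eq_mul, mul_comm]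

variable (V) in
/-- `R ⊗ V*` is the dual of `R ⊗ V`. -/
def ptDual [Module.Finite k V] : R ⊗[k] Module.Dual k V ≃ₗ[R] Module.Dual R (R ⊗[k] V) :=
  LinearEquiv.ofBijective (ptPair R V) (ptPair_bijective R)

variable {R}

/-- The transpose of an endomorphism of the points. -/
def ptTranspose [Module.Finite k V] (f : Module.End R (R ⊗[k] V)) :
    Module.End R (R ⊗[k] Module.Dual k V) :=
  (ptDual R V).symm.toLinearMap ∘ₗ Module.Dual.transpose f ∘ₗ (ptDual R V).toLinearMap

lemma ptPair_transpose [Module.Finite k V] (f : Module.End R (R ⊗[k] V))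
    (x : R ⊗[k] Module.Dual k V) (y : R ⊗[k] V) :
    ptPair R V (ptTranspose f x) y = ptPair R V x (f y) :=
  LinearMap.congr_fun ((ptDual R V).apply_symm_apply _) y

lemma ptPair_ext [Module.Finite k V] {x x' : R ⊗[k] Module.Dual k V}
    (h : ∀ y, ptPair R V x y = ptPair R V x' y) : x = x' :=
  (ptPair_bijective R).1 (LinearMap.ext h)

/-- The canonical element `∑ bᵢ ⊗ bᵢ*` is invariant, which makes the coevaluation equivariant.
Expanding `f bᵢ` in the basis and exchanging the sums collects the second factors into `gᵗ fᵗ bⱼ*`,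
which is `bⱼ*` because `f g = 1`. -/
lemma sum_ptMul_transpose [Module.Finite k V] {f g : Module.End R (R ⊗[k] V)} (h : f * g = 1) :
    ∑ i, ptMul R V (Module.Dual k V) (f (1 ⊗ₜ b i)) (ptTranspose g (1 ⊗ₜ b.coord i)) =
      ∑ i, ptMul R V (Module.Dual k V) (1 ⊗ₜ b i) (1 ⊗ₜ b.coord i) := by
  have h1 : ∀ i, ptMul R V (Module.Dual k V) (f (1 ⊗ₜ b i)) (ptTranspose g (1 ⊗ₜ b.coord i)) =
      ∑ j, ptMul R V (Module.Dual k V) (1 ⊗ₜ b j)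
        (ptTranspose g (ptPair R V (1 ⊗ₜ b.coord j) (f (1 ⊗ₜ b i)) • (1 ⊗ₜ b.coord i))) :=
    fun i => by
      conv_lhs => rw [← sum_ptPair_coord_smul R b (f (1 ⊗ₜ b i))]
      rw [map_sum, LinearMap.sum_apply]
      refine Finset.sum_congr rfl fun j _ => ?_
      rw [map_smul, LinearMap.smul_apply, map_smul, map_smul]
  rw [Finset.sum_congr rfl fun i _ => h1 i, Finset.sum_comm]
  refine Finset.sum_congr rfl fun j _ => ?_
  rw [← map_sum, ← map_sum]
  congr 1
  have h2 : ∑ i, ptPair R V (1 ⊗ₜ b.coord j) (f (1 ⊗ₜ b i)) • ((1 : R) ⊗ₜ[k] b.coord i) =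
      ptTranspose f (1 ⊗ₜ b.coord j) := by
    simp only [← ptPair_transpose]
    exact sum_ptPair_smul_coord R b _
  rw [h2]
  refine ptPair_ext fun y => ?_
  rw [ptPair_transpose, ptPair_transpose]
  exact congrArg _ (LinearMap.congr_fun h y)

end

lemma pull_ptPair {k : Type u} [Field k] {V : Type u} [AddCommGroup V] [Module k V] {T' T : Sch k}
    (t : T' ⟶ T) (x : Fn T ⊗[k] Module.Dual k V) (y : Fn T ⊗[k] V) :
    Fn.pull t (ptPair (Fn T) V x y) =
      ptPair (Fn T') V (ptPull (Module.Dual k V) t x) (ptPull V t y) := by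
  induction x using TensorProduct.induction_on with
  | zero => simp only [map_zero, LinearMap.zero_apply]
  | add x x' hx hx' => simp only [map_add, LinearMap.add_apply, hx, hx']
  | tmul a v =>
    induction y using TensorProduct.induction_on with
    | zero => simp only [map_zero]
    | add y y' hy hy' => simp only [map_add, hy, hy']
    | tmul b w => simp only [ptPair_tmul_tmul, ptPull_tmul, map_mul, map_smul]

namespace FinRep

variable {k : Type u} [Field k] {H : Sch k} [GrpObj H]

lemma ρ_mul_inv (M : FinRep H) {T : Sch k} (h : T ⟶ H) : M.ρ T h * M.ρ T h⁻¹ = 1 := by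
  rw [← map_mul, mul_inv_cancel, map_one]

lemma ρ_inv_ρ (M : FinRep H) {T : Sch k} (h : T ⟶ H) (v : Fn T ⊗[k] M.V) :
    M.ρ T h⁻¹ (M.ρ T h v) = v := by
  rw [← Module.End.mul_apply, ← map_mul, inv_mul_cancel, map_one]
  rfl

/-- The dual representation. -/
def dual (M : FinRep H) : FinRep H where
  V := Module.Dual k M.V
  ρ T :=
    { toFun := fun h => ptTranspose (M.ρ T h⁻¹)
      map_one' := LinearMap.ext fun x => ptPair_ext fun y => by
        rw [ptPair_transpose, inv_one, map_one]
        rfl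
      map_mul' := fun h h' => LinearMap.ext fun x => ptPair_ext fun y => by
        rw [Module.End.mul_apply, ptPair_transpose, ptPair_transpose, ptPair_transpose, mul_inv_rev,
          map_mul]
        rfl }
  ρ_natural {T' T} t h x := by
    change ptTranspose (M.ρ T' (t ≫ h)⁻¹) (ptPull _ t x) = ptPull _ t (ptTranspose (M.ρ T h⁻¹) x)
    apply (ptPair_bijective (Fn T')).1
    refine TensorProduct.AlgebraTensorModule.curry_injective ?_
    refine LinearMap.ext_ring (LinearMap.ext fun v => ?_)
    change ptPair (Fn T') M.V _ (1 ⊗ₜ v) = ptPair (Fn T') M.V _ (1 ⊗ₜ v)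
    -- A functional on `𝒪(T') ⊗ V` is determined by its values on the vectors `1 ⊗ v`, which are
    -- pulled back from `T`; naturality of the dual action thus follows from that of `M`.
    have h1 : (1 : Fn T') ⊗ₜ[k] v = ptPull M.V t (1 ⊗ₜ v) := by rw [ptPull_tmul, map_one]
    rw [h1, ptPair_transpose, ← GrpObj.comp_inv, M.ρ_natural, ← pull_ptPair, ← pull_ptPair,
      ptPair_transpose]

lemma ptPair_dual_ρ (M : FinRep H) {T : Sch k} (h : T ⟶ H) (x : Fn T ⊗[k] Module.Dual k M.V)
    (y : Fn T ⊗[k] M.V) :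
    ptPair (Fn T) M.V (M.dual.ρ T h x) (M.ρ T h y) = ptPair (Fn T) M.V x y :=
  (ptPair_transpose _ _ _).trans (congrArg _ (M.ρ_inv_ρ h y))

/-- The evaluation `M* ⊗ M ⟶ k`. -/
def evaluation (M : FinRep H) : tensor M.dual M ⟶ unit :=
  tensorDesc (M := M.dual) (L := unit) (contractLeft k M.V) fun {T} h x y => by
    refine (baseChange_contractLeft_ptMul _ _ _).trans ?_
    refine Eq.trans ?_ (baseChange_contractLeft_ptMul _ _ _).symm
    exact congrArg (fun c : Fn T => c ⊗ₜ[k] (1 : k)) (ptPair_dual_ρ M h x y)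

/-- The coevaluation `k ⟶ M ⊗ M*`. -/
def coevaluation (M : FinRep H) : unit ⟶ tensor M M.dual :=
  ⟨_root_.coevaluation k M.V, fun {T} h x => by
    obtain ⟨c, rfl⟩ := exists_eq_tmul_one _ x
    have h1 : (_root_.coevaluation k M.V).baseChange (Fn T) (c ⊗ₜ 1) =
        c • ∑ i, ptMul (Fn T) M.V (Module.Dual k M.V) (1 ⊗ₜ Module.Basis.ofVectorSpace k M.V i)
          (1 ⊗ₜ (Module.Basis.ofVectorSpace k M.V).coord i) := by
      rw [LinearMap.baseChange_tmul, coevaluation_apply_one, TensorProduct.tmul_sum,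
        Finset.smul_sum]
      refine Finset.sum_congr rfl fun i _ => ?_
      rw [ptMul_tmul_tmul, TensorProduct.smul_tmul', smul_eq_mul, mul_one, mul_one]
    refine h1.trans (Eq.trans ?_ (congrArg ((tensor M M.dual).ρ T h) h1).symm)
    refine Eq.trans ?_ (map_smul ((tensor M M.dual).ρ T h) c _).symm
    congr 1
    refine Eq.trans ?_ (map_sum ((tensor M M.dual).ρ T h) _ _).symm
    rw [← sum_ptMul_transpose (Module.Basis.ofVectorSpace k M.V) (M.ρ_mul_inv h)]
    exact Finset.sum_congr rfl fun i _ => (tensor_ρ_ptMul M M.dual h _ _).symm⟩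

instance (M : FinRep H) : ExactPairing M M.dual where
  coevaluation' := coevaluation M
  evaluation' := evaluation M
  coevaluation_evaluation' := hom_ext (contractLeft_assoc_coevaluation k M.V)
  evaluation_coevaluation' := hom_ext (contractLeft_assoc_coevaluation' k M.V)

instance : RightRigidCategory (FinRep H) where
  rightDual M := ⟨M.dual⟩

instance : RigidCategory (FinRep H) := BraidedCategory.rigidCategoryOfRightRigidCategory

end FinRep

end

end AffExt

/-! ### Bilinear maps of bundles spread out from the origin by `G`. -/

namespace AffExt

noncomputable section

variable {k : Type u} [Field k] {S : AffineExtension k}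

namespace SModule

/-! ### Trivializations of `S`-modules -/

/-- The trivialization `v ↦ g · v` of the fibre over `q(g)`. -/
def triv (E : SModule S) {T : Sch k} (g : T ⟶ S.G) {b : T ⟶ S.A} (w : b = g ≫ S.q) :
    Fn T ⊗[k] Fibre E.π ≃ₗ[Fn T] Fib E.π b :=
  (fibreEquiv E.π T).trans (E.actEquiv g (w.trans (mul_one _).symm))

lemma triv_eq_iff (E : SModule S) {T : Sch k} {g g' : T ⟶ S.G} {b b' : T ⟶ S.A}
    (w : b = g ≫ S.q) (w' : b' = g' ≫ S.q) (v v' : Fn T ⊗[k] Fibre E.π) :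
    (E.triv g w v).1 = (E.triv g' w' v').1 ↔ b = b' ∧ v' = tr E.fibre g g' v := by
  subst w w'
  exact E.inducedSpace.κ_eq_iff g g' v v'

lemma act_triv (E : SModule S) {T : Sch k} (g' g : T ⟶ S.G) {b b' : T ⟶ S.A}
    (w : b = g ≫ S.q) (w' : b' = (g' * g) ≫ S.q) (v : Fn T ⊗[k] Fibre E.π) :
    E.act g' (E.triv g w v).1 = (E.triv (g' * g) w' v).1 := (E.act_mul _ _ _).symm

lemma triv_map {E F : SModule S} (φ : E ⟶ F) {T : Sch k} (g : T ⟶ S.G) {b : T ⟶ S.A}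
    (w : b = g ≫ S.q) (v : Fn T ⊗[k] Fibre E.π) :
    (E.triv g w v).map φ.hom φ.isBundleHom.w =
      F.triv g w ((Hom.fibre φ).baseChange (Fn T) v) := by
  refine Subtype.ext ?_
  refine (φ.equivariant g (fibreEquiv E.π T v).1).trans ?_
  exact congrArg (F.act g) (congrArg Subtype.val (Hom.fibreEquiv_fibre φ T v)).symm

/-! ### Bilinear maps of `S`-modules -/

variable {E F K : SModule S} (f : FinRep.tensor E.fibre F.fibre ⟶ K.fibre)

/-- The bilinear map on points defined by a morphism `E_0 ⊗ F_0 ⟶ K_0`. -/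
def mulPt (T : Sch k) :
    Fn T ⊗[k] Fibre E.π →ₗ[Fn T] Fn T ⊗[k] Fibre F.π →ₗ[Fn T] Fn T ⊗[k] Fibre K.π :=
  (ptMul (Fn T) (Fibre E.π) (Fibre F.π)).compr₂ (f.toLin.baseChange (Fn T))

lemma mulPt_apply {T : Sch k} (v : Fn T ⊗[k] Fibre E.π) (v' : Fn T ⊗[k] Fibre F.π) :
    mulPt f T v v' = f.toLin.baseChange (Fn T) (ptMul (Fn T) (Fibre E.π) (Fibre F.π) v v') := rfl

lemma ptPull_mulPt {T' T : Sch k} (t : T' ⟶ T) (v : Fn T ⊗[k] Fibre E.π)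
    (v' : Fn T ⊗[k] Fibre F.π) :
    ptPull _ t (mulPt f T v v') = mulPt f T' (ptPull _ t v) (ptPull _ t v') := by
  refine (ptPull_baseChange f.toLin t _).trans ?_
  exact congrArg _ (ptPull_ptMul t v v')

lemma mulPt_tr {T : Sch k} (g g' : T ⟶ S.G) (v : Fn T ⊗[k] Fibre E.π)
    (v' : Fn T ⊗[k] Fibre F.π) :
    mulPt f T (tr E.fibre g g' v) (tr F.fibre g g' v') = tr K.fibre g g' (mulPt f T v v') := by
  refine Eq.trans ?_ (f.equivariant (hdiff g g') _)
  exact congrArg _ (FinRep.tensor_ρ_ptMul E.fibre F.fibre _ v v').symm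

/-- The product does not depend on the lift: changing it applies `tr` to both coordinates, and `f`
commutes with `tr`. -/
lemma triv_mulPt_congr {T' T : Sch k} {b : T ⟶ S.A} (e : Fib E.π b) (e' : Fib F.π b)
    {t t' : T' ⟶ T} (ht : t = t') {g g' : T' ⟶ S.G} (w : t ≫ b = g ≫ S.q)
    (w' : t' ≫ b = g' ≫ S.q) {v₁ v₂ : Fn T' ⊗[k] Fibre E.π} {v₁' v₂' : Fn T' ⊗[k] Fibre F.π}
    (h₁ : E.triv g w v₁ = e.pull t) (h₁' : F.triv g w v₁' = e'.pull t)
    (h₂ : E.triv g' w' v₂ = e.pull t') (h₂' : F.triv g' w' v₂' = e'.pull t') :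
    (K.triv g w (mulPt f T' v₁ v₁')).1 = (K.triv g' w' (mulPt f T' v₂ v₂')).1 := by
  subst ht
  have h := ((E.triv_eq_iff w w' v₁ v₂).1 (congrArg Subtype.val (h₁.trans h₂.symm))).2
  have h' := ((F.triv_eq_iff w w' v₁' v₂').1 (congrArg Subtype.val (h₁'.trans h₂'.symm))).2
  rw [triv_eq_iff, h, h', mulPt_tr]
  exact ⟨rfl, rfl⟩

/-- Over the torsor of `b` both points have coordinates in the fibres at the origin, where `f`
multiplies them; the result descends by independence of the lift. -/
lemma exists_mul {T : Sch k} {b : T ⟶ S.A} (e : Fib E.π b) (e' : Fib F.π b) :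
    ∃ z : Fib K.π b, ∀ {T' : Sch k} (t : T' ⟶ T) (g : T' ⟶ S.G) (w : t ≫ b = g ≫ S.q)
      (v : Fn T' ⊗[k] Fibre E.π) (v' : Fn T' ⊗[k] Fibre F.π), E.triv g w v = e.pull t →
        F.triv g w v' = e'.pull t → K.triv g w (mulPt f T' v v') = z.pull t := by
  obtain ⟨v₀, h₀⟩ := (E.triv (torsor.snd b) (torsor.w b)).surjective (e.pull (torsor.fst b))
  obtain ⟨v₀', h₀'⟩ := (F.triv (torsor.snd b) (torsor.w b)).surjective (e'.pull (torsor.fst b))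
  have wp : ∀ {T' : Sch k} (p : T' ⟶ torsor b),
      (p ≫ torsor.fst b) ≫ b = (p ≫ torsor.snd b) ≫ S.q := fun p => by
    rw [Category.assoc, Category.assoc, torsor.w]
  have hE : ∀ {T' : Sch k} (p : T' ⟶ torsor b), E.triv (p ≫ torsor.snd b) (wp p) (ptPull _ p v₀) =
      e.pull (p ≫ torsor.fst b) := fun p => Subtype.ext (by
    have := congrArg (fun x => p ≫ x.1) h₀
    exact (E.inducedSpace.natural p _ v₀).trans (this.trans (Category.assoc _ _ _).symm))
  have hF : ∀ {T' : Sch k} (p : T' ⟶ torsor b), F.triv (p ≫ torsor.snd b) (wp p) (ptPull _ p v₀') =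
      e'.pull (p ≫ torsor.fst b) := fun p => Subtype.ext (by
    have := congrArg (fun x => p ≫ x.1) h₀'
    exact (F.inducedSpace.natural p _ v₀').trans (this.trans (Category.assoc _ _ _).symm))
  let x := K.triv (torsor.snd b) (torsor.w b) (mulPt f _ v₀ v₀')
  have hK : ∀ {T' : Sch k} (p : T' ⟶ torsor b), p ≫ x.1 = (K.triv (p ≫ torsor.snd b) (wp p)
      (mulPt f T' (ptPull _ p v₀) (ptPull _ p v₀'))).1 := fun p => by
    rw [← ptPull_mulPt]
    exact (K.inducedSpace.natural p _ _).symm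
  obtain ⟨z, hz⟩ := (torsor.isFpqc b).exists_desc x.1 fun p p' h => by
    rw [hK, hK]
    exact triv_mulPt_congr f e e' h _ _ (hE p) (hF p) (hE p') (hF p')
  refine ⟨⟨z, (torsor.isFpqc b).hom_ext ?_⟩, fun {T'} t g w v v' h h' => Subtype.ext ?_⟩
  · rw [← Category.assoc, hz, x.2]
  · change _ = t ≫ z
    have ht : torsor.lift t g w ≫ torsor.fst b = t := torsor.lift_fst t g w
    conv_rhs => rw [← ht, Category.assoc, hz, hK]
    exact triv_mulPt_congr f e e' ht.symm _ _ h h' (hE _) (hF _)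

/-- The bilinear map of bundles defined by a morphism `E_0 ⊗ F_0 ⟶ K_0`, on points. -/
def mul {T : Sch k} {b : T ⟶ S.A} (e : Fib E.π b) (e' : Fib F.π b) : Fib K.π b :=
  (exists_mul f e e').choose

lemma mul_pull_eq {T' T : Sch k} {b : T ⟶ S.A} {e : Fib E.π b} {e' : Fib F.π b} {t : T' ⟶ T}
    {g : T' ⟶ S.G} {w : t ≫ b = g ≫ S.q} {v : Fn T' ⊗[k] Fibre E.π} {v' : Fn T' ⊗[k] Fibre F.π}
    (h : E.triv g w v = e.pull t) (h' : F.triv g w v' = e'.pull t) :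
    (mul f e e').pull t = K.triv g w (mulPt f T' v v') :=
  ((exists_mul f e e').choose_spec t g w v v' h h').symm

/-- Every point is of the form `g · v` after an fpqc base change. -/
lemma exists_triv (E : SModule S) {T : Sch k} {b : T ⟶ S.A} (e : Fib E.π b) :
    ∃ v, E.triv (torsor.snd b) (torsor.w b) v = e.pull (torsor.fst b) :=
  (E.triv _ _).surjective _

lemma mul_pull {T' T : Sch k} (t : T' ⟶ T) {b : T ⟶ S.A} (e : Fib E.π b) (e' : Fib F.π b) :
    mul f (e.pull t) (e'.pull t) = (mul f e e').pull t := by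
  apply Fib.pull_injective (torsor.isFpqc _)
  obtain ⟨v, hv⟩ := E.exists_triv (e.pull t)
  obtain ⟨v', hv'⟩ := F.exists_triv (e'.pull t)
  rw [mul_pull_eq f hv hv']
  have wt := torsor.w (t ≫ b)
  rw [← Category.assoc] at wt
  have h1 : E.triv _ wt v = e.pull (torsor.fst (t ≫ b) ≫ t) :=
    Subtype.ext ((congrArg Subtype.val hv).trans (Category.assoc _ _ _).symm)
  have h2 : F.triv _ wt v' = e'.pull (torsor.fst (t ≫ b) ≫ t) :=
    Subtype.ext ((congrArg Subtype.val hv').trans (Category.assoc _ _ _).symm)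
  exact Subtype.ext ((congrArg Subtype.val (mul_pull_eq f h1 h2)).symm.trans (Category.assoc _ _ _))

lemma triv_add_pull {T' T : Sch k} {b : T ⟶ S.A} {e e' : Fib E.π b} {t : T' ⟶ T}
    {g : T' ⟶ S.G} {w : t ≫ b = g ≫ S.q} {v v' : Fn T' ⊗[k] Fibre E.π}
    (h : E.triv g w v = e.pull t) (h' : E.triv g w v' = e'.pull t) :
    E.triv g w (v + v') = (e + e').pull t := by
  rw [map_add, h, h', VectorBundle.pull_add]

lemma triv_smul_pull {T' T : Sch k} {b : T ⟶ S.A} {e : Fib E.π b} {t : T' ⟶ T}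
    {g : T' ⟶ S.G} {w : t ≫ b = g ≫ S.q} {v : Fn T' ⊗[k] Fibre E.π} (c : Fn T)
    (h : E.triv g w v = e.pull t) :
    E.triv g w (Fn.pull t c • v) = (c • e).pull t := by
  rw [map_smul, h, VectorBundle.pull_smul]

/-- The bilinear map of bundles defined by a morphism `E_0 ⊗ F_0 ⟶ K_0`. -/
def bilin {T : Sch k} (b : T ⟶ S.A) : Fib E.π b →ₗ[Fn T] Fib F.π b →ₗ[Fn T] Fib K.π b :=
  LinearMap.mk₂ (Fn T) (mul f)
    (fun e₁ e₂ e' => by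
      apply Fib.pull_injective (torsor.isFpqc _)
      obtain ⟨v₁, h₁⟩ := E.exists_triv e₁
      obtain ⟨v₂, h₂⟩ := E.exists_triv e₂
      obtain ⟨v', h'⟩ := F.exists_triv e'
      rw [VectorBundle.pull_add, mul_pull_eq f h₁ h', mul_pull_eq f h₂ h',
        mul_pull_eq f (triv_add_pull h₁ h₂) h', map_add, LinearMap.add_apply, map_add])
    (fun c e e' => by
      apply Fib.pull_injective (torsor.isFpqc _)
      obtain ⟨v, h⟩ := E.exists_triv e
      obtain ⟨v', h'⟩ := F.exists_triv e'
      rw [VectorBundle.pull_smul, mul_pull_eq f h h',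
        mul_pull_eq f (triv_smul_pull c h) h', map_smul, LinearMap.smul_apply, map_smul])
    (fun e e₁ e₂ => by
      apply Fib.pull_injective (torsor.isFpqc _)
      obtain ⟨v₁, h₁⟩ := F.exists_triv e₁
      obtain ⟨v₂, h₂⟩ := F.exists_triv e₂
      obtain ⟨v', h'⟩ := E.exists_triv e
      rw [VectorBundle.pull_add, mul_pull_eq f h' h₁, mul_pull_eq f h' h₂,
        mul_pull_eq f h' (triv_add_pull h₁ h₂), map_add, map_add])
    (fun c e e' => by
      apply Fib.pull_injective (torsor.isFpqc _)
      obtain ⟨v, h⟩ := E.exists_triv e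
      obtain ⟨v', h'⟩ := F.exists_triv e'
      rw [VectorBundle.pull_smul, mul_pull_eq f h h',
        mul_pull_eq f h (triv_smul_pull c h'), map_smul, map_smul])

/-- The translated points have, at the lift multiplied by `g`, the same coordinates as the original
points at the original lift; so do their products. -/
lemma act_mul_eq {T : Sch k} (g : T ⟶ S.G) {b b' : T ⟶ S.A} (e : Fib E.π b) (e' : Fib F.π b)
    (x : Fib E.π b') (x' : Fib F.π b') (hx : x.1 = E.act g e.1) (hx' : x'.1 = F.act g e'.1) :
    (mul f x x').1 = K.act g (mul f e e').1 := by
  have hb : b' = (g ≫ S.q) * b := by rw [← x.2, hx, act_π, e.2]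
  apply (torsor.isFpqc b).hom_ext
  let t := torsor.fst b
  obtain ⟨v, h⟩ := E.exists_triv e
  obtain ⟨v', h'⟩ := F.exists_triv e'
  have w' : t ≫ b' = ((t ≫ g) * torsor.snd b) ≫ S.q := by
    rw [hb, MonObj.comp_mul, MonObj.mul_comp, ← torsor.w, Category.assoc]
  have h2 : E.triv ((t ≫ g) * torsor.snd b) w' v = x.pull t := Subtype.ext (by
    rw [← E.act_triv _ _ (torsor.w b), h]
    change E.act (t ≫ g) (t ≫ e.1) = t ≫ x.1
    rw [hx, comp_act])
  have h2' : F.triv ((t ≫ g) * torsor.snd b) w' v' = x'.pull t := Subtype.ext (by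
    rw [← F.act_triv _ _ (torsor.w b), h']
    change F.act (t ≫ g) (t ≫ e'.1) = t ≫ x'.1
    rw [hx', comp_act])
  rw [comp_act]
  refine (congrArg Subtype.val (mul_pull_eq f h2 h2')).trans ?_
  rw [← K.act_triv _ _ (torsor.w b), ← mul_pull_eq f h h']
  rfl

end SModule

end

end AffExt

/-! ### The tensor product property and coherence, checked on the torsor. -/

namespace AffExt

noncomputable section

/-! ### Descent of tensor products -/

/-- After base change to `R'` the map `P ⊗ Q → K` becomes `P' ⊗ Q' → K'`, which is bijective;
faithful flatness reflects bijectivity. -/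
lemma isTensorProduct_of_faithfullyFlat {R R' : Type u} [CommRing R] [CommRing R'] [Algebra R R']
    [Module.FaithfullyFlat R R'] {P Q K P' Q' K' : Type u} [AddCommGroup P] [Module R P]
    [AddCommGroup Q] [Module R Q] [AddCommGroup K] [Module R K] [AddCommGroup P'] [Module R P']
    [Module R' P'] [IsScalarTower R R' P'] [AddCommGroup Q'] [Module R Q'] [Module R' Q']
    [IsScalarTower R R' Q'] [AddCommGroup K'] [Module R K'] [Module R' K'] [IsScalarTower R R' K']
    {p : P →ₗ[R] P'} {q : Q →ₗ[R] Q'} {r : K →ₗ[R] K'} (hp : IsBaseChange R' p)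
    (hq : IsBaseChange R' q) (hr : IsBaseChange R' r) (B : P →ₗ[R] Q →ₗ[R] K)
    {B' : P' →ₗ[R'] Q' →ₗ[R'] K'} (hB' : IsTensorProduct B')
    (h : ∀ x y, r (B x y) = B' (p x) (q y)) : IsTensorProduct B := by
  rw [IsTensorProduct, ← Module.FaithfullyFlat.lTensor_bijective_iff_bijective R R']
  let e : R' ⊗[R] (P ⊗[R] Q) ≃ₗ[R'] K' :=
    (TensorProduct.AlgebraTensorModule.distribBaseChange R R' P Q).trans
      ((TensorProduct.congr hp.equiv hq.equiv).trans hB'.equiv)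
  have key : hr.equiv.toLinearMap ∘ₗ (TensorProduct.lift B).baseChange R' = e.toLinearMap := by
    refine TensorProduct.AlgebraTensorModule.curry_injective ?_
    refine LinearMap.ext_ring (TensorProduct.ext' fun x y => ?_)
    change hr.equiv (1 ⊗ₜ B x y) = B' (hp.equiv (1 ⊗ₜ x)) (hq.equiv (1 ⊗ₜ y))
    rw [hr.equiv_tmul, hp.equiv_tmul, hq.equiv_tmul, one_smul, one_smul, one_smul, h]
  have : ((TensorProduct.lift B).lTensor R' : _ → _) = hr.equiv.symm ∘ e := funext fun z => by
    rw [Function.comp_apply, LinearEquiv.eq_symm_apply]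
    exact LinearMap.congr_fun key z
  rw [this]
  exact hr.equiv.symm.bijective.comp e.bijective

namespace FinRep

variable {k : Type u} [Field k] {H : Sch k} [GrpObj H] {M N L K : FinRep H} {T : Sch k}

lemma id_baseChange (M : FinRep H) (v : Fn T ⊗[k] M.V) :
    (FinRep.Hom.toLin (𝟙 M)).baseChange (Fn T) v = v := by
  rw [id_toLin, LinearMap.baseChange_id, LinearMap.id_apply]

lemma comp_baseChange (f : M ⟶ N) (g : N ⟶ L) (v : Fn T ⊗[k] M.V) :
    (FinRep.Hom.toLin (f ≫ g)).baseChange (Fn T) v =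
      g.toLin.baseChange (Fn T) (f.toLin.baseChange (Fn T) v) := by
  rw [comp_toLin, LinearMap.baseChange_comp, LinearMap.comp_apply]

lemma comp_baseChange₃ (f : M ⟶ N) (g : N ⟶ L) (h : L ⟶ K) (v : Fn T ⊗[k] M.V) :
    (FinRep.Hom.toLin (f ≫ g ≫ h)).baseChange (Fn T) v =
      h.toLin.baseChange (Fn T) (g.toLin.baseChange (Fn T) (f.toLin.baseChange (Fn T) v)) := by
  rw [comp_baseChange, comp_baseChange]

lemma tensorMap_baseChange {M' N' : FinRep H} (f : M ⟶ M') (g : N ⟶ N') (x : Fn T ⊗[k] M.V)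
    (y : Fn T ⊗[k] N.V) :
    (tensorMap f g).toLin.baseChange (Fn T) (ptMul (Fn T) M.V N.V x y) =
      ptMul (Fn T) M'.V N'.V (f.toLin.baseChange (Fn T) x) (g.toLin.baseChange (Fn T) y) :=
  baseChange_map_ptMul _ _ _ _ _

end FinRep

variable {k : Type u} [Field k] {S : AffineExtension k}

namespace SModule

/-- The equivariant function on `T ×_A G` defined by a point of `E` over `b`. -/
def untriv (E : SModule S) {T : Sch k} (b : T ⟶ S.A) :
    Fib E.π b →ₗ[Fn T] Fn (torsor b) ⊗[k] Fibre E.π where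
  toFun e := (E.triv (torsor.snd b) (torsor.w b)).symm (e.pull (torsor.fst b))
  map_add' e e' := by rw [VectorBundle.pull_add, map_add]
  map_smul' c e := by
    rw [VectorBundle.pull_smul, map_smul, ← torsor.algebraMap_eq, algebraMap_smul]
    rfl

lemma triv_untriv (E : SModule S) {T : Sch k} {b : T ⟶ S.A} (e : Fib E.π b) :
    E.triv (torsor.snd b) (torsor.w b) (E.untriv b e) = e.pull (torsor.fst b) :=
  LinearEquiv.apply_symm_apply _ _

lemma untriv_injective (E : SModule S) {T : Sch k} (b : T ⟶ S.A) :
    Function.Injective (E.untriv b) := fun e e' h =>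
  Fib.pull_injective (torsor.isFpqc b) (by rw [← triv_untriv, h, triv_untriv])

lemma comp_triv_val (E : SModule S) {T T' : Sch k} {b : T ⟶ S.A} (p : T' ⟶ torsor b)
    (v : Fn (torsor b) ⊗[k] Fibre E.π) :
    p ≫ (E.triv (torsor.snd b) (torsor.w b) v).1 =
      (E.triv (p ≫ torsor.snd b) (torsor.comp_w p).symm (ptPull _ p v)).1 :=
  (E.inducedSpace.natural p _ v).symm

/-- Coordinates with respect to the universal lift come from a point over `T` exactly when they are
equivariant: this is fpqc descent along the torsor. It allows `sec_isBaseChange` to be applied to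
the fibres of `E`. -/
lemma range_untriv (E : SModule S) {T : Sch k} (b : T ⟶ S.A) :
    LinearMap.range (E.untriv b) = secSub E.fibre b := by
  ext s
  constructor
  · rintro ⟨e, rfl⟩ T' p p' h
    have h1 : p ≫ (e.pull (torsor.fst b)).1 = p' ≫ (e.pull (torsor.fst b)).1 := by
      change p ≫ torsor.fst b ≫ e.1 = p' ≫ torsor.fst b ≫ e.1
      rw [← Category.assoc, h, Category.assoc]
    rw [← triv_untriv, comp_triv_val, comp_triv_val, triv_eq_iff] at h1
    exact h1.2
  · intro hs
    let x := E.triv (torsor.snd b) (torsor.w b) s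
    obtain ⟨z, hz⟩ := (torsor.isFpqc b).exists_desc x.1 fun p p' h => by
      rw [comp_triv_val, comp_triv_val, triv_eq_iff]
      refine ⟨?_, hs p p' h⟩
      rw [← Category.assoc, h, Category.assoc]
    refine ⟨⟨z, (torsor.isFpqc b).hom_ext ?_⟩, ?_⟩
    · rw [← Category.assoc, hz, x.2]
    · apply (E.triv (torsor.snd b) (torsor.w b)).injective
      exact (E.triv_untriv _).trans (Subtype.ext hz)

lemma untriv_isBaseChange (E : SModule S) {T : Sch k} [IsAffine T.left] (b : T ⟶ S.A) :
    IsBaseChange (Fn (torsor b)) (E.untriv b) := by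
  let e : Fib E.π b ≃ₗ[Fn T] secSub E.fibre b :=
    (LinearEquiv.ofInjective (E.untriv b) (E.untriv_injective b)).trans
      (LinearEquiv.ofEq _ _ (E.range_untriv b))
  have := (IsBaseChange.ofEquiv e).comp (sec_isBaseChange (M := E.fibre) b)
  exact this

variable {E F K : SModule S} (f : FinRep.tensor E.fibre F.fibre ⟶ K.fibre)

lemma untriv_mul {T : Sch k} {b : T ⟶ S.A} (e : Fib E.π b) (e' : Fib F.π b) :
    K.untriv b (mul f e e') = mulPt f _ (E.untriv b e) (F.untriv b e') := by
  apply (K.triv (torsor.snd b) (torsor.w b)).injective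
  rw [triv_untriv, mul_pull_eq f (E.triv_untriv e) (F.triv_untriv e')]

lemma isTensorProduct_mulPt (hf : Function.Bijective f.toLin) (T : Sch k) :
    IsTensorProduct (mulPt f T) := by
  let e : Fibre E.π ⊗[k] Fibre F.π ≃ₗ[k] Fibre K.π := LinearEquiv.ofBijective f.toLin hf
  let e' : Fn T ⊗[k] (Fibre E.π ⊗[k] Fibre F.π) ≃ₗ[Fn T] Fn T ⊗[k] Fibre K.π :=
    LinearEquiv.baseChange k (Fn T) _ _ e
  have h : TensorProduct.lift (mulPt f T) = e'.toLinearMap ∘ₗ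
      TensorProduct.lift (ptMul (Fn T) (Fibre E.π) (Fibre F.π)) :=
    TensorProduct.ext' fun x y => rfl
  rw [IsTensorProduct, h]
  exact e'.bijective.comp (isTensorProduct_ptMul (Fn T))

/-- `T` is affine here so that the torsor is affine and its ring of functions is faithfully flat
over `𝒪(T)`. -/
lemma isTensorProduct_bilin (hf : Function.Bijective f.toLin) {T : Sch k} [IsAffine T.left]
    (b : T ⟶ S.A) : IsTensorProduct (bilin f b) :=
  have := torsor.flat b
  isTensorProduct_of_faithfullyFlat (E.untriv_isBaseChange b) (F.untriv_isBaseChange b)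
    (K.untriv_isBaseChange b) (bilin f b) (isTensorProduct_mulPt f hf (torsor b)) (untriv_mul f)

/-! ### Compatibilities of bilinear maps -/

lemma triv_map_pull {E F : SModule S} (φ : E ⟶ F) {T' T : Sch k} {b : T ⟶ S.A} {e : Fib E.π b}
    {t : T' ⟶ T} {g : T' ⟶ S.G} {w : t ≫ b = g ≫ S.q} {v : Fn T' ⊗[k] Fibre E.π}
    (h : E.triv g w v = e.pull t) :
    F.triv g w ((Hom.fibre φ).baseChange (Fn T') v) = (e.map φ.hom φ.isBundleHom.w).pull t := by
  rw [← triv_map, h, Fib.pull_map]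

/-- An identity between morphisms of `H`-modules at the origin propagates to the bundles, since over
the torsor all maps are computed in the same trivialization. The associativity and unit formulas are
proved in the same way. -/
lemma mul_map {E' F' K' : SModule S} (f' : FinRep.tensor E'.fibre F'.fibre ⟶ K'.fibre)
    (φ : E ⟶ E') (ψ : F ⟶ F') (χ : K ⟶ K')
    (h : FinRep.tensorMap ((fibreFunctor S).map φ) ((fibreFunctor S).map ψ) ≫ f' =
      f ≫ (fibreFunctor S).map χ) {T : Sch k} {b : T ⟶ S.A} (e : Fib E.π b) (e' : Fib F.π b) :
    (mul f e e').map χ.hom χ.isBundleHom.w =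
      mul f' (e.map φ.hom φ.isBundleHom.w) (e'.map ψ.hom ψ.isBundleHom.w) := by
  apply Fib.pull_injective (torsor.isFpqc b)
  rw [mul_pull_eq f' (triv_map_pull φ (E.triv_untriv e)) (triv_map_pull ψ (F.triv_untriv e'))]
  rw [← triv_map_pull χ (mul_pull_eq f (E.triv_untriv e) (F.triv_untriv e')).symm]
  congr 1
  refine (FinRep.comp_baseChange f ((fibreFunctor S).map χ) _).symm.trans ?_
  rw [← h]
  refine (FinRep.comp_baseChange (FinRep.tensorMap _ _) f' _).trans ?_
  exact congrArg (f'.toLin.baseChange _) (FinRep.tensorMap_baseChange _ _ _ _)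

lemma mul_assoc_map {P Q R Q' : SModule S} (f₁ : FinRep.tensor E.fibre F.fibre ⟶ P.fibre)
    (f₂ : FinRep.tensor P.fibre K.fibre ⟶ Q.fibre) (g₁ : FinRep.tensor F.fibre K.fibre ⟶ R.fibre)
    (g₂ : FinRep.tensor E.fibre R.fibre ⟶ Q'.fibre) (α : Q ⟶ Q')
    (h : FinRep.tensorMap f₁ (𝟙 K.fibre) ≫ f₂ ≫ (fibreFunctor S).map α =
      (FinRep.assoc E.fibre F.fibre K.fibre).hom ≫ FinRep.tensorMap (𝟙 E.fibre) g₁ ≫ g₂)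
    {T : Sch k} {b : T ⟶ S.A} (x : Fib E.π b) (y : Fib F.π b) (z : Fib K.π b) :
    (mul f₂ (mul f₁ x y) z).map α.hom α.isBundleHom.w = mul g₂ x (mul g₁ y z) := by
  apply Fib.pull_injective (torsor.isFpqc b)
  have hx := E.triv_untriv x
  have hy := F.triv_untriv y
  have hz := K.triv_untriv z
  rw [mul_pull_eq g₂ hx (mul_pull_eq g₁ hy hz).symm,
    ← triv_map_pull α (mul_pull_eq f₂ (mul_pull_eq f₁ hx hy).symm hz).symm]
  congr 1
  rw [mulPt_apply, mulPt_apply, mulPt_apply, mulPt_apply]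
  refine Eq.trans ?_ ((FinRep.comp_baseChange₃ _ _ _ _).symm.trans
    ((congrArg (fun p => (FinRep.Hom.toLin p).baseChange (Fn (torsor b))
      (ptMul _ (Fibre E.π ⊗[k] Fibre F.π) (Fibre K.π)
        (ptMul _ (Fibre E.π) (Fibre F.π) (E.untriv b x) (F.untriv b y)) (K.untriv b z))) h).trans
      ((FinRep.comp_baseChange₃ _ _ _ _).trans ?_)))
  · congr 2
    refine Eq.trans ?_ (FinRep.tensorMap_baseChange (M := FinRep.tensor E.fibre F.fibre) f₁
      (𝟙 K.fibre) _ _).symm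
    refine congrArg _ ?_
    exact (FinRep.id_baseChange K.fibre _).symm
  · congr 1
    refine (congrArg _ (baseChange_assoc_ptMul _ _ _ _)).trans ?_
    refine (FinRep.tensorMap_baseChange (N := FinRep.tensor F.fibre K.fibre) (𝟙 E.fibre) g₁
      _ _).trans ?_
    exact congrArg (fun v => ptMul (Fn (torsor b)) (Fibre E.π) (Fibre R.π) v _)
      (FinRep.id_baseChange E.fibre _)

end SModule

end

end AffExt

/-! ### The unit bundle, and transport of the monoidal structure to `S`-modules. -/

namespace AffExt

noncomputable section

variable {k : Type u} [Field k] {S : AffineExtension k}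

namespace SModule

/-! ### The trivial line bundle -/

section

variable {E : SModule S} (ε : FinRep.unit ⟶ E.fibre)

/-- A morphism `k ⟶ E_0` as a linear map. -/
def unitLin : k →ₗ[k] Fibre E.π := ε.toLin

/-- The points of `E_0` defined by functions, for a morphism `k ⟶ E_0`. -/
def unitPt (T : Sch k) : Fn T →ₗ[Fn T] Fn T ⊗[k] Fibre E.π :=
  (unitLin ε).baseChange (Fn T) ∘ₗ
    (TensorProduct.AlgebraTensorModule.rid k (Fn T) (Fn T)).symm.toLinearMap

lemma unitPt_apply {T : Sch k} (c : Fn T) :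
    unitPt ε T c = (unitLin ε).baseChange (Fn T) (c ⊗ₜ[k] (1 : k)) := rfl

lemma ptPull_unitPt {T' T : Sch k} (t : T' ⟶ T) (c : Fn T) :
    ptPull _ t (unitPt ε T c) = unitPt ε T' (Fn.pull t c) :=
  ptPull_baseChange (unitLin ε) t (c ⊗ₜ[k] (1 : k))

/-- `H` acts trivially on the source of `ε`, so these coordinates are the same at every lift. -/
lemma tr_unitPt {T : Sch k} (g g' : T ⟶ S.G) (c : Fn T) :
    tr E.fibre g g' (unitPt ε T c) = unitPt ε T c := by
  rw [unitPt_apply]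
  exact (ε.equivariant (hdiff g g') (c ⊗ₜ[k] (1 : k))).symm

variable (hε : Function.Bijective ε.toLin)

include hε in
lemma unitPt_bijective (T : Sch k) : Function.Bijective (unitPt ε T) := by
  let e : k ≃ₗ[k] Fibre E.π := LinearEquiv.ofBijective ε.toLin hε
  let e' : Fn T ⊗[k] k ≃ₗ[Fn T] Fn T ⊗[k] Fibre E.π := LinearEquiv.baseChange k (Fn T) _ _ e
  exact e'.bijective.comp
    (TensorProduct.AlgebraTensorModule.rid k (Fn T) (Fn T)).symm.bijective

/-- The equivariant function on `T ×_A G` defined by a function on `T`. -/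
def unitFn {T : Sch k} (b : T ⟶ S.A) : Fn T →ₗ[Fn T] Fn (torsor b) ⊗[k] Fibre E.π :=
  (unitPt ε (torsor b)).restrictScalars (Fn T) ∘ₗ Algebra.linearMap (Fn T) (Fn (torsor b))

lemma unitFn_apply {T : Sch k} (b : T ⟶ S.A) (c : Fn T) :
    unitFn ε b c = unitPt ε _ (Fn.pull (torsor.fst b) c) := rfl

include hε in
lemma unitFn_injective {T : Sch k} (b : T ⟶ S.A) : Function.Injective (unitFn ε b) :=
  (unitPt_bijective ε hε _).1.comp (torsor.isFpqc b).pull_injective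

include hε in
-- For the trivial representation, equivariant functions are the functions on the torsor with equal
-- pullbacks to its self-product over `T`; by descent these are the functions on `T`.
lemma range_unitFn {T : Sch k} (b : T ⟶ S.A) :
    LinearMap.range (unitFn ε b) = secSub E.fibre b := by
  ext s
  constructor
  · rintro ⟨c, rfl⟩ T' p p' h
    rw [unitFn_apply]
    refine (ptPull_unitPt ε _ _).trans (Eq.trans ?_ (congrArg _ (ptPull_unitPt ε _ _).symm))
    rw [tr_unitPt, ← Fn.pull_comp, ← Fn.pull_comp, h]
  · intro hs
    obtain ⟨c, rfl⟩ := (unitPt_bijective ε hε _).2 s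
    obtain ⟨d, rfl⟩ := (torsor.isFpqc b).exists_fn c fun p p' h => by
      have h1 := hs p p' h
      apply (unitPt_bijective ε hε _).1
      refine (ptPull_unitPt ε _ _).symm.trans ?_
      refine Eq.trans ?_ (ptPull_unitPt ε _ _)
      refine Eq.trans ?_ h1.symm
      refine Eq.trans ?_ (congrArg _ (ptPull_unitPt ε _ _).symm)
      rw [tr_unitPt]
      exact ptPull_unitPt ε _ _
    exact ⟨d, rfl⟩

/-- The identification of `𝔸¹ × A` with `E`, on points. -/
def unitEquiv {T : Sch k} (b : T ⟶ S.A) : Fn T ≃ₗ[Fn T] Fib E.π b :=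
  (LinearEquiv.ofInjective (unitFn ε b) (unitFn_injective ε hε b)).trans
    ((LinearEquiv.ofEq _ _ ((range_unitFn ε hε b).trans (E.range_untriv b).symm)).trans
      (LinearEquiv.ofInjective (E.untriv b) (E.untriv_injective b)).symm)

lemma untriv_unitEquiv {T : Sch k} {b : T ⟶ S.A} (c : Fn T) :
    E.untriv b (unitEquiv ε hε b c) = unitFn ε b c :=
  congrArg Subtype.val ((LinearEquiv.ofInjective (E.untriv b) (E.untriv_injective b)).apply_symm_apply
    _)

lemma triv_unitPt {T' T : Sch k} {b : T ⟶ S.A} (c : Fn T) (t : T' ⟶ T) (g : T' ⟶ S.G)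
    (w : t ≫ b = g ≫ S.q) :
    E.triv g w (unitPt ε T' (Fn.pull t c)) = (unitEquiv ε hε b c).pull t := by
  let p := torsor.lift t g w
  have ht : p ≫ torsor.fst b = t := torsor.lift_fst t g w
  have hg : p ≫ torsor.snd b = g := torsor.lift_snd t g w
  have h1 := congrArg (fun x => p ≫ x.1) (E.triv_untriv (unitEquiv ε hε b c))
  refine Subtype.ext (Eq.trans ?_ (h1.trans ?_))
  · rw [comp_triv_val, untriv_unitEquiv, unitFn_apply, ptPull_unitPt, ← Fn.pull_comp, ht,
      triv_eq_iff]
    refine ⟨by rw [← ht, Category.assoc], ?_⟩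
    rw [tr_unitPt]
  · change p ≫ torsor.fst b ≫ (unitEquiv ε hε b c).1 = t ≫ (unitEquiv ε hε b c).1
    rw [← Category.assoc, ht]

lemma unitEquiv_pull {T' T : Sch k} (t : T' ⟶ T) (b : T ⟶ S.A) (c : Fn T) :
    unitEquiv ε hε (t ≫ b) (Fn.pull t c) = (unitEquiv ε hε b c).pull t := by
  apply Fib.pull_injective (torsor.isFpqc _)
  rw [← triv_unitPt ε hε _ _ _ (torsor.w _), ← Fn.pull_comp]
  have wt := torsor.w (t ≫ b)
  rw [← Category.assoc] at wt
  exact Subtype.ext ((congrArg Subtype.val (triv_unitPt ε hε c _ _ wt)).trans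
    (Category.assoc _ _ _))

lemma act_unitEquiv {T : Sch k} (g : T ⟶ S.G) (b : T ⟶ S.A) (c : Fn T) :
    E.act g (unitEquiv ε hε b c).1 = (unitEquiv ε hε ((g ≫ S.q) * b) c).1 := by
  apply (torsor.isFpqc b).hom_ext
  have w' : torsor.fst b ≫ ((g ≫ S.q) * b) = ((torsor.fst b ≫ g) * torsor.snd b) ≫ S.q := by
    rw [MonObj.comp_mul, MonObj.mul_comp, ← torsor.w, Category.assoc]
  have h1 := congrArg Subtype.val (triv_unitPt ε hε c _ _ (torsor.w b))
  have h2 := congrArg Subtype.val (triv_unitPt ε hε c _ _ w')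
  rw [comp_act]
  refine (congrArg (E.act _) h1.symm).trans (Eq.trans ?_ h2)
  exact E.act_triv _ _ _ _ _

/-- The hypothesis is left unitality of the monoidal fibre functor; over the torsor it reduces the
claim to `k ⊗ V ≃ V` on coordinates. -/
lemma mul_unit_left_map {F P : SModule S} (f : FinRep.tensor E.fibre F.fibre ⟶ P.fibre) (φ : P ⟶ F)
    (h : (FinRep.lid F.fibre).hom = FinRep.tensorMap ε (𝟙 F.fibre) ≫ f ≫ (fibreFunctor S).map φ)
    {T : Sch k} {b : T ⟶ S.A} (c : Fn T) (x : Fib F.π b) :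
    (mul f (unitEquiv ε hε b c) x).map φ.hom φ.isBundleHom.w = c • x := by
  apply Fib.pull_injective (torsor.isFpqc b)
  have hx := F.triv_untriv x
  rw [← triv_map_pull φ (mul_pull_eq f (triv_unitPt ε hε c _ _ (torsor.w b)) hx).symm,
    ← triv_smul_pull c hx]
  congr 1
  rw [mulPt_apply]
  refine Eq.trans ?_ ((FinRep.comp_baseChange₃ (FinRep.tensorMap ε (𝟙 F.fibre)) f
    ((fibreFunctor S).map φ) (ptMul _ k (Fibre F.π) (Fn.pull (torsor.fst b) c ⊗ₜ 1)
      (F.untriv b x))).symm.trans ?_)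
  · congr 2
    refine Eq.trans ?_ (FinRep.tensorMap_baseChange (M := FinRep.unit) ε (𝟙 F.fibre) _ _).symm
    exact congrArg _ (FinRep.id_baseChange F.fibre _).symm
  · rw [← h]
    exact baseChange_lid_ptMul _ _ _

lemma mul_unit_right_map {F P : SModule S} (f : FinRep.tensor F.fibre E.fibre ⟶ P.fibre) (φ : P ⟶ F)
    (h : (FinRep.rid F.fibre).hom = FinRep.tensorMap (𝟙 F.fibre) ε ≫ f ≫ (fibreFunctor S).map φ)
    {T : Sch k} {b : T ⟶ S.A} (c : Fn T) (x : Fib F.π b) :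
    (mul f x (unitEquiv ε hε b c)).map φ.hom φ.isBundleHom.w = c • x := by
  apply Fib.pull_injective (torsor.isFpqc b)
  have hx := F.triv_untriv x
  rw [← triv_map_pull φ (mul_pull_eq f hx (triv_unitPt ε hε c _ _ (torsor.w b))).symm,
    ← triv_smul_pull c hx]
  congr 1
  rw [mulPt_apply]
  refine Eq.trans ?_ ((FinRep.comp_baseChange₃ (FinRep.tensorMap (𝟙 F.fibre) ε) f
    ((fibreFunctor S).map φ) (ptMul _ (Fibre F.π) k (F.untriv b x)
      (Fn.pull (torsor.fst b) c ⊗ₜ 1))).symm.trans ?_)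
  · congr 2
    refine Eq.trans ?_ (FinRep.tensorMap_baseChange (N := FinRep.unit) (𝟙 F.fibre) ε _ _).symm
    exact congrArg (fun v => ptMul (Fn (torsor b)) (Fibre F.π) (Fibre E.π) v _)
      (FinRep.id_baseChange F.fibre _).symm
  · rw [← h]
    exact baseChange_rid_ptMul _ _ _

end

end SModule

/-! ### The monoidal structure -/

lemma FinRep.toLin_bijective {H : Sch k} [GrpObj H] {M N : FinRep H} (f : M ⟶ N) [IsIso f] :
    Function.Bijective f.toLin :=
  Function.bijective_iff_has_inverse.2 ⟨(inv f).toLin,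
    fun v => LinearMap.congr_fun (congrArg FinRep.Hom.toLin (IsIso.hom_inv_id f)) v,
    fun v => LinearMap.congr_fun (congrArg FinRep.Hom.toLin (IsIso.inv_hom_id f)) v⟩

section

variable [MonoidalCategory (Rep0 S)] [(fibreFunctor S).Monoidal]

/-- The structure map `E_0 ⊗ F_0 ⟶ (E ⊗ F)_0`. -/
def fibreTensor (E F : Rep0 S) :
    FinRep.tensor E.fibre F.fibre ⟶ SModule.fibre (E ⊗ F) :=
  Functor.LaxMonoidal.μ (fibreFunctor S) E F

variable (S) in
/-- The structure map `k ⟶ (𝟙_)_0`. -/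
def fibreUnit : FinRep.unit ⟶ SModule.fibre (𝟙_ (Rep0 S)) :=
  Functor.LaxMonoidal.ε (fibreFunctor S)

lemma fibreTensor_bijective (E F : Rep0 S) : Function.Bijective (fibreTensor E F).toLin :=
  FinRep.toLin_bijective (Functor.LaxMonoidal.μ (fibreFunctor S) E F)

variable (S) in
lemma fibreUnit_bijective : Function.Bijective (fibreUnit S).toLin :=
  FinRep.toLin_bijective (Functor.LaxMonoidal.ε (fibreFunctor S))

variable (S) in
/-- A monoidal structure for which the fibre functor is monoidal is given by the tensor product of
bundles. -/
def bundleTensorOfMonoidal : BundleTensor S where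
  tmul E F _ _ := SModule.bilin (fibreTensor E F) _
  tmul_pull E F _ _ t _ e f := SModule.mul_pull (fibreTensor E F) t e f
  isTensorProduct E F _ _ b :=
    SModule.isTensorProduct_bilin (fibreTensor E F) (fibreTensor_bijective E F) b
  act_tmul E F _ g _ _ e f e' f' h h' :=
    SModule.act_mul_eq (fibreTensor E F) g e f e' f' h h'
  unit b := SModule.unitEquiv (fibreUnit S) (fibreUnit_bijective S) b
  unit_pull t b c := SModule.unitEquiv_pull (fibreUnit S) _ t b c
  act_unit g b c := SModule.act_unitEquiv (fibreUnit S) _ g b c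
  map_tmul {E E' F F'} φ ψ _ _ e f := SModule.mul_map (fibreTensor E F) (fibreTensor E' F')
    φ ψ (φ ⊗ₘ ψ) (Functor.LaxMonoidal.μ_natural (fibreFunctor S) φ ψ) e f
  associator E F K _ _ e f l := SModule.mul_assoc_map (fibreTensor E F) (fibreTensor (E ⊗ F) K)
    (fibreTensor F K) (fibreTensor E (F ⊗ K)) (α_ E F K).hom
    (Functor.LaxMonoidal.associativity (fibreFunctor S) E F K) e f l
  leftUnitor E _ _ c e := SModule.mul_unit_left_map (fibreUnit S) _
    (fibreTensor (𝟙_ (Rep0 S)) E) (λ_ E).hom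
    (Functor.LaxMonoidal.left_unitality (fibreFunctor S) E) c e
  rightUnitor E _ _ c e := SModule.mul_unit_right_map (fibreUnit S) _
    (fibreTensor E (𝟙_ (Rep0 S))) (ρ_ E).hom
    (Functor.LaxMonoidal.right_unitality (fibreFunctor S) E) c e

end

variable (S) in
/-- The tensor product of `S`-modules. -/
@[reducible]
def monoidalRep0 : MonoidalCategory (Rep0 S) := Monoidal.transport (indEquivalence S)

variable (S) in
/-- The fibre functor is monoidal. -/
@[reducible]
def fibreFunctorMonoidal : @Functor.Monoidal (Rep0 S) _ (monoidalRep0 S) (FinRep S.H) _ _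
    (fibreFunctor S) :=
  -- Transport makes the inverse of the equivalence monoidal, and this inverse is the fibre functor
  -- by definition.
  inferInstanceAs (Monoidal.equivalenceTransported (indEquivalence S)).inverse.Monoidal

theorem exists_monoidal (S : AffineExtension k) : ∃ _ : MonoidalCategory (Rep0 S),
    Nonempty (BundleTensor S) ∧ Nonempty (RigidCategory (Rep0 S)) := by
  let := monoidalRep0 S
  let := fibreFunctorMonoidal S
  let : (indEquivalence S).symm.functor.Monoidal := fibreFunctorMonoidal S
  -- Duals exist for `S`-modules because the fibre functor is a monoidal equivalence to the rigid
  -- category of `H`-modules.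
  exact ⟨monoidalRep0 S, ⟨bundleTensorOfMonoidal S⟩,
    ⟨rigidCategoryOfEquivalence (indEquivalence S).symm.toAdjunction⟩⟩

end

end AffExt

theorem mainTheorem6 {k : Type u} [Field k] (S : AffExt.AffineExtension k) :
    -- for every finite dimensional `H`-module `V` the quotient `G ×^H V` exists,
    (∀ V : AffExt.FinRep S.H, ∃ X : AffExt.Sch k, Nonempty (AffExt.InducedSpace S V X)) ∧
    -- and any such quotient is an `S`-module in the canonical way
    (∀ (V : AffExt.FinRep S.H) (X : AffExt.Sch k) (P : AffExt.InducedSpace S V X),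
      ∃ (π : X ⟶ S.A) (_ : AffExt.VectorBundle π) (hom : AffExt.IsHomogeneous π)
        (rep : AffExt.ExtHom S π),
        AffExt.InducedSpace.IsCanonical (E := AffExt.SModule.mk X π hom rep) P) ∧
    -- every `S`-module `E` is isomorphic to `G ×^H E_0` by `[g, v] ↦ g · v`
    (∀ (E F : AffExt.Rep0 S) (P : AffExt.InducedSpace S E.fibre F.X), P.IsCanonical →
      ∃ i : F ≅ E, ∀ {T : AffExt.Sch k} (g : T ⟶ S.G) (v : AffExt.Fn T ⊗[k] AffExt.Fibre E.π),
        P.κ g v ≫ i.hom.hom = E.act g (AffExt.fibreEquiv E.π T v).1) ∧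
    -- `V ↦ G ×^H V` and `E ↦ E_0` are quasi-inverse equivalences of categories
    (∃ (Ind : AffExt.FinRep S.H ⥤ AffExt.Rep0 S)
        (P : ∀ V : AffExt.FinRep S.H, AffExt.InducedSpace S V (Ind.obj V).X),
      (∀ V, (P V).IsCanonical) ∧
      (∀ {V W : AffExt.FinRep S.H} (f : V ⟶ W) {T : AffExt.Sch k} (g : T ⟶ S.G)
        (v : AffExt.Fn T ⊗[k] V.V),
        (P V).κ g v ≫ (Ind.map f).hom = (P W).κ g (f.toLin.baseChange (AffExt.Fn T) v)) ∧
      ∃ e : AffExt.FinRep S.H ≌ AffExt.Rep0 S,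
        e.functor = Ind ∧ e.inverse = AffExt.fibreFunctor S) ∧
    -- `Rep_0(S)` is abelian, and monoidal and rigid for the tensor product of bundles
    Nonempty (Abelian (AffExt.Rep0 S)) ∧
    (∃ _ : MonoidalCategory (AffExt.Rep0 S),
      Nonempty (AffExt.BundleTensor S) ∧ Nonempty (RigidCategory (AffExt.Rep0 S))) :=
  ⟨AffExt.exists_inducedSpace, fun _ _ P => AffExt.exists_isCanonical P,
    AffExt.exists_iso_of_isCanonical,
    ⟨AffExt.Ind S, AffExt.Ind.induced, AffExt.Ind.isCanonical, AffExt.Ind.κ_map,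
      AffExt.indEquivalence S, rfl, rfl⟩,
    AffExt.nonempty_abelian S, AffExt.exists_monoidal S⟩
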